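/- Let $\mathrm p:\mathbb R^3\to\mathbb R^2$ be the linear map with $\mathrm p(\mathbf e_1)=(-\tfrac{\sqrt3}{2},-\tfrac12)$, $\mathrm p(\mathbf e_2)=(\tfrac{\sqrt3}{2},-\tfrac12)$, $\mathrm p(\mathbf e_3)=(0,1)$, and for $k=1,2,3$ let $R_k$ be the rhombus spanned at the origin by the two vectors $\mathrm p(\mathbf e_j)$, $j\ne k$. Let $\mathbf M=\begin{pmatrix}0&1&0\\0&0&1\\1&-1&-1\end{pmatrix}$ with columns $\mathbf c_1,\mathbf c_2,\mathbf c_3$. Put $\mathcal P_0=\{R_1,R_2,R_3\}$, $\mathcal R(R_1)=\{R_3,\ \mathrm p(\mathbf c_2)+R_1,\ \mathrm p(\mathbf c_3)+R_2\}$, $\mathcal R(R_2)=\{R_1\}$, $\mathcal R(R_3)=\{R_2\}$, $\mathcal R(\mathrm p(z)+R_k)=\mathrm p(\mathbf Mz)+\mathcal R(R_k)$ (where each rhombus $\mathrm p(z)+R_k$ carries its recursively assigned $z\in\mathbb Z^3$), and let $\mathcal P_{i+1}$ be the union of the sets $\mathcal R(T)$, $T\in\mathcal P_i$. The Rauzy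 tiling is $\bigcup_i\mathcal P_i$. Let $Q$ (resp. $Q_i$) be the quiver with the vertices of the tiling (resp. of $\mathcal P_i$) as vertices and with two opposite arrows $b,\bar b$ for each edge of the tiling (resp. of $\mathcal P_i$); let $V_i$ be the vertex set of $Q_i$. A vertex $z\in V_i$ is a $(k,n)$-vertex if it lies on exactly $k$ edges of $\mathcal P_i$ and on exactly $n$ edges of the tiling. Let $K$ be a field. In the path algebra $KQ$ write $D_a(z)=b\bar b-b'\bar b'$ for a vertex $z$ and $a\in\{1,2,3\}$, where $b$ and $b'$ are the arrows starting at $z$ in the directions $\mathrm p(\mathbf e_a)$ and $-\mathrm p(\mathbf e_a)$, and where a path is replaced by $0$ if there is no such arrow. Fix signs $\varepsilon_a(z)\in\{1,-1\}$ with $\varepsilon_1(z)\varepsilon_2(z)\varepsilon_3(z)=1$ such that along every edge $z\,x$ of the tiling of direction $\pm\mathrm p(\mathbf e_a)$ one has $\varepsilon_a(x)=\varepsilon_a(z)$ and $\varepsilon_b(x)=-\varepsilon_b(z)$ for $b\ne a$. The Rauzy algebra is $A=KQ/I$, where the two-sided ideal $I$ is generated by: (1) all paths of length two whose two arrows are not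 sides of a common rhombus of the tiling; (2) all differences of two paths of length two that connect the same pair of opposite vertices of a rhombus of the tiling; (3) all elements $D_{a+1}(z)-\varepsilon_a(z)D_{a+2}(z)$ (indices modulo 3). Let $A_i=e_iAe_i$, where $e_i=\sum_{v\in V_i}e_v$ is the sum of the idempotents given by the trivial paths at the vertices in $V_i$. A loop at $z\in V_i$ is an element $\bar bb\in A_i$ with $\bar bb\notin\mathrm{rad}^2A_i$, where $\bar b$ is an arrow of $Q$ starting at $z$, $b$ is the opposite arrow, and neither $b$ nor $\bar b$ lies in $A_i$ (as elements of $A$). The number of loops at $z$ is the dimension of the subspace of $A_i/\mathrm{rad}^2A_i$ spanned by the classes of the loops at $z$. **Proposition.** Let $i\ge 0$ and let $z$ be a $(k,n)$-vertex of $Q_i$. Then there is a loop at $z$ in $A_i$ if and only if $k<n-2$. Moreover $n-k\le 3$; hence there is a loop at $z$ if and only if $(k,n)=(3,6)$ or $(k,n)=(2,5)$, and in these cases the number of loops at $z$ is exactly one. -/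

import Mathlib

/-! ### Path algebras -/

section PathAlgebra

/-- The paths (of all lengths, trivial paths included) of a quiver. -/
abbrev QuiverPath (V : Type) [Quiver.{0} V] : Type := Σ x y : V, Quiver.Path x y

/-- The underlying vector space of the path algebra: it has the set of all paths as a basis. -/
def PathAlgebra (K : Type*) [Field K] (V : Type) [Quiver.{0} V] : Type _ := QuiverPath V →₀ K

namespace PathAlgebra

variable (K : Type*) [Field K] {V : Type} [Quiver.{0} V]

noncomputable instance : AddCommGroup (PathAlgebra K V) :=
  inferInstanceAs (AddCommGroup (QuiverPath V →₀ K))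

noncomputable instance : Module K (PathAlgebra K V) :=
  inferInstanceAs (Module K (QuiverPath V →₀ K))

/-- The basis of the path algebra formed by the paths. -/
noncomputable def pathBasis : Module.Basis (QuiverPath V) K (PathAlgebra K V) :=
  Module.Basis.ofRepr (LinearEquiv.refl K (QuiverPath V →₀ K))

/-- A path as an element of the path algebra. -/
noncomputable def ofPath {x y : V} (p : Quiver.Path x y) : PathAlgebra K V :=
  pathBasis K ⟨x, y, p⟩

/-- The trivial path at a vertex. -/
noncomputable def vertexIdem (x : V) : PathAlgebra K V := ofPath K (Quiver.Path.nil : Quiver.Path x x)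

/-- An arrow as an element of the path algebra. -/
noncomputable def arrow {x y : V} (a : x ⟶ y) : PathAlgebra K V := ofPath K a.toPath

open Classical in
/-- The product of two paths: first `p`, then `q`, if they concatenate, and zero otherwise. -/
noncomputable def pathMul (p q : QuiverPath V) : PathAlgebra K V :=
  if h : p.2.1 = q.1 then ofPath K (p.2.2.comp (q.2.2.cast h.symm rfl)) else 0

/-- The bilinear extension of the product of paths. -/
noncomputable def mulLin : PathAlgebra K V →ₗ[K] PathAlgebra K V →ₗ[K] PathAlgebra K V :=
  (pathBasis K).constr K fun p => (pathBasis K).constr K fun q => pathMul K p q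

noncomputable instance : Mul (PathAlgebra K V) := ⟨fun f g => mulLin K f g⟩

theorem mul_def (f g : PathAlgebra K V) : f * g = mulLin K f g := rfl

theorem ofPath_mul_ofPath {x y z w : V} (p : Quiver.Path x y) (q : Quiver.Path z w) :
    ofPath K p * ofPath K q = pathMul K ⟨x, y, p⟩ ⟨z, w, q⟩ := by
  rw [mul_def, mulLin, ofPath, ofPath, Module.Basis.constr_basis, Module.Basis.constr_basis]

theorem ofPath_mul_comp {x y w : V} (p : Quiver.Path x y) (q : Quiver.Path y w) :
    ofPath K p * ofPath K q = ofPath K (p.comp q) := by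
  rw [ofPath_mul_ofPath, pathMul, dif_pos rfl]
  rfl

theorem ofPath_mul_ne {x y z w : V} (p : Quiver.Path x y) (q : Quiver.Path z w) (h : y ≠ z) :
    ofPath K p * ofPath K q = 0 := by
  rw [ofPath_mul_ofPath, pathMul, dif_neg h]

theorem induction_path {P : PathAlgebra K V → Prop} (f : PathAlgebra K V) (zero : P 0)
    (add : ∀ f g, P f → P g → P (f + g))
    (smul : ∀ (c : K) f, P f → P (c • f))
    (path : ∀ (x y : V) (p : Quiver.Path x y), P (ofPath K p)) : P f := by
  refine Submodule.span_induction (p := fun g _ => P g) ?_ zero (fun f g _ _ => add f g)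
    (fun c f _ => smul c f) ((pathBasis K).mem_span f)
  rintro _ ⟨⟨x, y, p⟩, rfl⟩
  exact path x y p

theorem smul_mul' (c : K) (f g : PathAlgebra K V) : (c • f) * g = c • (f * g) := by
  simp only [mul_def, map_smul, LinearMap.smul_apply]

theorem mul_smul' (c : K) (f g : PathAlgebra K V) : f * (c • g) = c • (f * g) := by
  simp only [mul_def, map_smul]

theorem add_mul' (f g h : PathAlgebra K V) : (f + g) * h = f * h + g * h := by
  simp only [mul_def, map_add, LinearMap.add_apply]

theorem mul_add' (f g h : PathAlgebra K V) : f * (g + h) = f * g + f * h := by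
  simp only [mul_def, map_add]

theorem zero_mul' (f : PathAlgebra K V) : 0 * f = 0 := by
  simp only [mul_def, map_zero, LinearMap.zero_apply]

theorem mul_zero' (f : PathAlgebra K V) : f * 0 = 0 := by
  simp only [mul_def, map_zero]

theorem mul_assoc' (f g h : PathAlgebra K V) : f * g * h = f * (g * h) := by
  induction f using induction_path with
  | zero => simp only [zero_mul']
  | add f f' hf hf' => simp only [add_mul', hf, hf']
  | smul c f hf => simp only [smul_mul', hf]
  | path x y p =>
    induction g using induction_path with
    | zero => simp only [zero_mul', mul_zero']
    | add f f' hf hf' => simp only [add_mul', mul_add', hf, hf']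
    | smul c f hf => simp only [smul_mul', mul_smul', hf]
    | path z w q =>
      induction h using induction_path with
      | zero => simp only [mul_zero']
      | add f f' hf hf' => simp only [mul_add', hf, hf']
      | smul c f hf => simp only [mul_smul', hf]
      | path u v r =>
        by_cases h1 : y = z
        · subst h1
          by_cases h2 : w = u
          · subst h2
            simp only [ofPath_mul_comp, Quiver.Path.comp_assoc]
          · simp only [ofPath_mul_comp, ofPath_mul_ne K _ _ h2, mul_zero']
        · by_cases h2 : w = u
          · subst h2
            simp only [ofPath_mul_comp, ofPath_mul_ne K _ _ h1, zero_mul']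
          · simp only [ofPath_mul_ne K _ _ h1, ofPath_mul_ne K _ _ h2, zero_mul', mul_zero']

/-- The path algebra is a (non-unital, if there are infinitely many vertices) ring. -/
noncomputable instance : NonUnitalRing (PathAlgebra K V) where
  left_distrib := mul_add' K
  right_distrib := add_mul' K
  zero_mul := zero_mul' K
  mul_zero := mul_zero' K
  mul_assoc := mul_assoc' K

instance : IsScalarTower K (PathAlgebra K V) (PathAlgebra K V) := ⟨smul_mul' K⟩

instance : SMulCommClass K (PathAlgebra K V) (PathAlgebra K V) :=
  ⟨fun c f g => (mul_smul' K c f g).symm⟩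

theorem vertexIdem_mul_self (x : V) : vertexIdem K x * vertexIdem K x = vertexIdem K x := by
  rw [vertexIdem, ofPath_mul_comp, Quiver.Path.comp_nil]

theorem vertexIdem_mul_ne {x y : V} (h : x ≠ y) : vertexIdem K x * vertexIdem K y = 0 :=
  ofPath_mul_ne K _ _ h

theorem vertexIdem_sum_mul_self (S : Finset V) :
    (∑ v ∈ S, vertexIdem K v) * (∑ v ∈ S, vertexIdem K v) = ∑ v ∈ S, vertexIdem K v := by
  rw [Finset.sum_mul_sum]
  refine Finset.sum_congr rfl fun v hv => ?_
  rw [Finset.sum_eq_single v (fun w _ hw => vertexIdem_mul_ne K hw.symm) (fun h => absurd hv h),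
    vertexIdem_mul_self]

/-- The path algebra has local units. -/
theorem exists_left_unit (f : PathAlgebra K V) : ∃ e : PathAlgebra K V, e * f = f := by
  classical
  suffices h : ∃ S : Finset V, ∀ T : Finset V, S ⊆ T → (∑ v ∈ T, vertexIdem K v) * f = f by
    obtain ⟨S, hS⟩ := h
    exact ⟨_, hS S subset_rfl⟩
  induction f using induction_path with
  | zero => exact ⟨∅, fun T _ => mul_zero _⟩
  | add f g hf hg =>
    obtain ⟨S, hS⟩ := hf
    obtain ⟨S', hS'⟩ := hg
    refine ⟨S ∪ S', fun T hT => ?_⟩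
    rw [mul_add, hS T (Finset.union_subset_left hT), hS' T (Finset.union_subset_right hT)]
  | smul c f hf =>
    obtain ⟨S, hS⟩ := hf
    exact ⟨S, fun T hT => by rw [mul_smul_comm, hS T hT]⟩
  | path x y p =>
    refine ⟨{x}, fun T hT => ?_⟩
    have h : ∑ v ∈ T, vertexIdem K v * ofPath K p = vertexIdem K x * ofPath K p :=
      Finset.sum_eq_single x (fun w _ hw => ofPath_mul_ne K _ _ hw)
        (fun h => absurd (hT (Finset.mem_singleton_self x)) h)
    rw [Finset.sum_mul, h, vertexIdem, ofPath_mul_comp, Quiver.Path.nil_comp]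

/-- Every two-sided ideal of the path algebra is a subspace. -/
theorem smul_mem (I : TwoSidedIdeal (PathAlgebra K V)) (c : K) {f : PathAlgebra K V}
    (hf : f ∈ I) : c • f ∈ I := by
  obtain ⟨e, he⟩ := exists_left_unit K f
  rw [← he, ← smul_mul_assoc]
  exact I.mul_mem_left _ _ hf

variable {K}

/-- The quotient of the path algebra by a two-sided ideal, a (non-unital) `K`-algebra. -/
abbrev Quot (I : TwoSidedIdeal (PathAlgebra K V)) : Type _ := I.ringCon.Quotient

namespace Quot

variable (I : TwoSidedIdeal (PathAlgebra K V))

/-- The class of an element of the path algebra. -/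
noncomputable def mk (f : PathAlgebra K V) : Quot I := (f : I.ringCon.Quotient)

theorem mk_surjective : Function.Surjective (mk I) := Quotient.mk_surjective

noncomputable instance : SMul K (Quot I) :=
  ⟨fun c => Quotient.map (fun f => c • f) fun f g h => by
    change I.ringCon (c • f) (c • g)
    have h' : I.ringCon f g := h
    rw [TwoSidedIdeal.rel_iff] at h' ⊢
    rw [← smul_sub]
    exact smul_mem K I c h'⟩

theorem smul_mk (c : K) (f : PathAlgebra K V) : c • mk I f = mk I (c • f) := rfl

noncomputable instance : Module K (Quot I) :=
  Function.Surjective.module K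
    ({ toFun := mk I, map_zero' := rfl, map_add' := fun _ _ => rfl } :
      PathAlgebra K V →+ Quot I)
    (mk_surjective I) fun _ _ => rfl

instance : IsScalarTower K (Quot I) (Quot I) := ⟨fun c a b => by
  obtain ⟨f, rfl⟩ := mk_surjective I a
  obtain ⟨g, rfl⟩ := mk_surjective I b
  exact congrArg (mk I) (smul_mul_assoc c f g)⟩

instance : SMulCommClass K (Quot I) (Quot I) := ⟨fun c a b => by
  obtain ⟨f, rfl⟩ := mk_surjective I a
  obtain ⟨g, rfl⟩ := mk_surjective I b
  exact congrArg (mk I) (mul_smul_comm c f g).symm⟩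

end Quot

end PathAlgebra

end PathAlgebra

/-! ### Corners `e A e` as algebras -/

section Corner

variable {K A : Type*} [Field K] [NonUnitalRing A] [Module K A] [IsScalarTower K A A]
  [SMulCommClass K A A] {e : A}

/-- The field acts on the ring `e A e` (whose unit is `e`) by `c ↦ c • e`. -/
noncomputable instance cornerAlgebra (he : IsIdempotentElem e) : Algebra K he.Corner where
  smul c a := ⟨c • a.1, by
    obtain ⟨r, hr⟩ := a.2
    exact ⟨c • r, by rw [← hr]; simp only [mul_smul_comm, smul_mul_assoc]⟩⟩
  algebraMap :=
    { toFun := fun c => ⟨c • e, c • e, by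
        simp only [mul_smul_comm, smul_mul_assoc, he.eq]⟩
      map_one' := Subtype.ext (one_smul K e)
      map_zero' := Subtype.ext (zero_smul K e)
      map_add' := fun c d => Subtype.ext (add_smul c d e)
      map_mul' := fun c d => Subtype.ext (by
        change (c * d) • e = (c • e) * (d • e)
        rw [mul_smul_comm, smul_mul_assoc, he.eq, smul_smul, mul_comm]) }
  commutes' := fun c a => Subtype.ext (by
    change (c • e) * a.1 = a.1 * (c • e)
    rw [smul_mul_assoc, mul_smul_comm, ((Subsemigroup.mem_corner_iff he).mp a.2).1,
      ((Subsemigroup.mem_corner_iff he).mp a.2).2])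
  smul_def' := fun c a => Subtype.ext (by
    change c • a.1 = (c • e) * a.1
    rw [smul_mul_assoc, ((Subsemigroup.mem_corner_iff he).mp a.2).1])

end Corner

namespace Rauzy

/-! ### The Rauzy tiling

The plane lattice `𝓛 = {m p(e₂) + n p(e₃)}` is described by the coordinates `(m, n)`, where
`p(e₁) = (-√3/2, -1/2)`, `p(e₂) = (√3/2, -1/2)`, `p(e₃) = (0, 1)`. The indices `1, 2, 3` of
the text become `0, 1, 2 : Fin 3`. -/

/-- The projection `p : ℤ³ → 𝓛`, in the coordinates of `𝓛`; note `p(e₁) = - p(e₂) - p(e₃)`. -/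
def proj (z : Fin 3 → ℤ) : ℤ × ℤ := (z 1 - z 0, z 2 - z 0)

/-- The edge vectors `p(e₁), p(e₂), p(e₃)` of the tiling. -/
def axis (a : Fin 3) : ℤ × ℤ := proj (Pi.single a 1)

/-- The point of the Euclidean plane with coordinates `(m, n)` in `𝓛`. -/
noncomputable def planePoint (v : ℤ × ℤ) : ℝ × ℝ :=
  (v.1 : ℝ) • (√3 / 2, -1 / 2) + (v.2 : ℝ) • ((0 : ℝ), (1 : ℝ))

theorem planePoint_proj (z : Fin 3 → ℤ) : planePoint (proj z) =
    (z 0 : ℝ) • (-(√3 / 2), -1 / 2) + (z 1 : ℝ) • (√3 / 2, -1 / 2) +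
      (z 2 : ℝ) • ((0 : ℝ), (1 : ℝ)) := by
  ext <;> simp [planePoint, proj] <;> ring

theorem planePoint_injective : Function.Injective planePoint := by
  rintro ⟨m, n⟩ ⟨m', n'⟩ h
  simp only [planePoint, Prod.smul_mk, smul_eq_mul, Prod.mk_add_mk, Prod.mk.injEq, mul_zero,
    add_zero, mul_one] at h
  have h3 : (√3 / 2 : ℝ) ≠ 0 := by positivity
  have hm : (m : ℝ) = m' := mul_right_cancel₀ h3 h.1
  have hn : (n : ℝ) = n' := by
    have := h.2
    rw [hm] at this
    linarith
  exact Prod.ext (by exact_mod_cast hm) (by exact_mod_cast hn)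

/-- `(z, k)` stands for the rhombus `p(z) + R_k`, where `R_k` is spanned at the origin by the
two vectors `p(e_j)`, `j ≠ k` (the projection of a face of the unit cube). -/
abbrev Tile : Type := (Fin 3 → ℤ) × Fin 3

/-- The matrix `M` derived from the Rauzy substitution. -/
def M : Matrix (Fin 3) (Fin 3) ℤ := !![0, 1, 0; 0, 0, 1; 1, -1, -1]

/-- The columns of `M`. -/
def col (j : Fin 3) : Fin 3 → ℤ := fun r => M r j

/-- The sets `ℛ(R_k)`. -/
def substBase (k : Fin 3) : Finset Tile :=
  ![{(0, 2), (col 1, 0), (col 2, 1)}, {(0, 0)}, {(0, 1)}] k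

/-- `ℛ(p(z) + R_k) = p(M z) + ℛ(R_k)`. -/
def subst (t : Tile) : Finset Tile :=
  (substBase t.2).image fun s => (M.mulVec t.1 + s.1, s.2)

/-- The patches `𝓟_i`. -/
def patch : ℕ → Finset Tile
  | 0 => {(0, 0), (0, 1), (0, 2)}
  | i + 1 => (patch i).biUnion subst

/-- The Rauzy tiling, the union of the patches. -/
def tiling : Set Tile := {t | ∃ i, t ∈ patch i}

/-- The four corners of the rhombus `p(z) + R_k`; opposite corners differ in both labels, and
corners that span a side differ in exactly one label. -/
def corner (t : Tile) (a b : Bool) : ℤ × ℤ :=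
  proj t.1 + (if a then axis (t.2 + 1) else 0) + (if b then axis (t.2 + 2) else 0)

/-- The set of corners of a rhombus. -/
def corners (t : Tile) : Finset (ℤ × ℤ) :=
  {corner t false false, corner t true false, corner t true true, corner t false true}

/-- The segment from `u` to `v` is a side of the rhombus. -/
def IsSide (t : Tile) (u v : ℤ × ℤ) : Prop :=
  ∃ a b, u = corner t a b ∧ (v = corner t (!a) b ∨ v = corner t a (!b))

/-- `u` and `v` are opposite corners of the rhombus. -/
def IsOpposite (t : Tile) (u v : ℤ × ℤ) : Prop :=
  ∃ a b, u = corner t a b ∧ v = corner t (!a) (!b)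

/-- The segment from `u` to `v` is an edge of the given collection of rhombi. -/
def IsEdge (T : Set Tile) (u v : ℤ × ℤ) : Prop := ∃ t ∈ T, IsSide t u v

theorem IsSide.symm {t : Tile} {u v : ℤ × ℤ} (h : IsSide t u v) : IsSide t v u := by
  obtain ⟨a, b, rfl, rfl | rfl⟩ := h
  · exact ⟨!a, b, rfl, Or.inl (by rw [Bool.not_not])⟩
  · exact ⟨a, !b, rfl, Or.inr (by rw [Bool.not_not])⟩

theorem IsEdge.symm {T : Set Tile} {u v : ℤ × ℤ} (h : IsEdge T u v) : IsEdge T v u :=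
  let ⟨t, ht, hs⟩ := h
  ⟨t, ht, hs.symm⟩

theorem IsSide.mem_corners {t : Tile} {u v : ℤ × ℤ} (h : IsSide t u v) : u ∈ corners t := by
  obtain ⟨a, b, rfl, -⟩ := h
  cases a <;> cases b <;> simp [corners]

/-! ### The quivers `Q` and `Q_i` -/

/-- The vertices of the tiling. -/
def Vertex : Type := {v : ℤ × ℤ // ∃ t ∈ tiling, v ∈ corners t}

/-- The quiver `Q`: each edge of the tiling is replaced by two opposite arrows. -/
instance : Quiver.{0} Vertex := ⟨fun u v => PLift (IsEdge tiling u.1 v.1)⟩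

/-- The arrow `b̄` opposite to `b`. -/
def bar {u v : Vertex} (b : u ⟶ v) : v ⟶ u := ⟨b.down.symm⟩

open Classical in
/-- The vertex set `V_i` of the patch `𝓟_i`. -/
noncomputable def vertices (i : ℕ) : Finset Vertex :=
  ((patch i).biUnion corners).subtype fun v => ∃ t ∈ tiling, v ∈ corners t

/-- `z` is a `(k, n)`-vertex of `Q_i`: it is a vertex of `Q_i` which lies on exactly `k` edges of
the patch `𝓟_i` and on exactly `n` edges of the whole tiling. -/
def IsKNVertex (i : ℕ) (z : Vertex) (k n : ℕ) : Prop :=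
  z ∈ vertices i ∧ {w | IsEdge (patch i : Set Tile) z.1 w}.ncard = k ∧
    {w | IsEdge tiling z.1 w}.ncard = n

/-! ### The Rauzy algebra -/

/-- A choice of signs in the star relations, `ε z a` being the sign at `z` whose superscript is
the direction of `p(e_a)`: `ε z 0 = ε^╱_z`, `ε z 1 = ε^╲_z`, `ε z 2 = ε^|_z`. The product of the
three signs at a vertex is `1`. The signs at neighbouring vertices determine each other: along an
edge of direction `p(e_a)` the sign with index `a` is preserved and the other two change. -/
structure IsSignSystem (ε : Vertex → Fin 3 → ℤˣ) : Prop where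
  prod_eq_one : ∀ z, ε z 0 * ε z 1 * ε z 2 = 1
  same : ∀ (u v : Vertex) (_ : u ⟶ v) (a : Fin 3), v.1 = u.1 + axis a → ε v a = ε u a
  flip : ∀ (u v : Vertex) (_ : u ⟶ v) (a b : Fin 3), v.1 = u.1 + axis a → b ≠ a →
    ε v b = - ε u b

section Algebra

variable (K : Type*) [Field K]

open PathAlgebra

open Classical in
/-- The path `b b̄` of length two, where `b` is the arrow from `z` with edge vector `d`, and zero
if there is no such arrow. -/
noncomputable def spoke (z : Vertex) (d : ℤ × ℤ) : PathAlgebra K Vertex :=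
  if h : IsEdge tiling z.1 (z.1 + d) then
    let w : Vertex := ⟨z.1 + d, let ⟨t, ht, hs⟩ := h; ⟨t, ht, hs.symm.mem_corners⟩⟩
    let b : z ⟶ w := ⟨h⟩
    arrow K b * arrow K (bar b)
  else 0

/-- The difference of the two paths `b b̄` at `z` in the directions `p(e_a)` and `- p(e_a)`. -/
noncomputable def axisDiff (z : Vertex) (a : Fin 3) : PathAlgebra K Vertex :=
  spoke K z (axis a) - spoke K z (-axis a)

/-- The relations: two-rhombus, mirror and star. In the counter-clockwise labelling of the arrows
`b₁, …, b₆` at `z` with `b₃` in direction `p(e₃)`, the arrows `b₅, b₁, b₃` have the directions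
`p(e₁), p(e₂), p(e₃)`, and `b₂, b₄, b₆` the opposite ones. -/
inductive Relation (ε : Vertex → Fin 3 → ℤˣ) : PathAlgebra K Vertex → Prop
  /-- A path of length two whose arrows are not sides of one rhombus is zero. -/
  | two_rhombus {x y z : Vertex} (b : x ⟶ y) (c : y ⟶ z)
      (h : ¬ ∃ t ∈ tiling, IsSide t x.1 y.1 ∧ IsSide t y.1 z.1) :
      Relation ε (arrow K b * arrow K c)
  /-- Two paths of length two connecting opposite corners of a rhombus are equal. -/
  | mirror {x y y' z : Vertex} (b : x ⟶ y) (c : y ⟶ z) (b' : x ⟶ y') (c' : y' ⟶ z)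
      (h : ∃ t ∈ tiling, IsOpposite t x.1 z.1) :
      Relation ε (arrow K b * arrow K c - arrow K b' * arrow K c')
  /-- The three star relations at `z`. -/
  | star (z : Vertex) (a : Fin 3) :
      Relation ε (axisDiff K z (a + 1) - (ε z a : ℤ) • axisDiff K z (a + 2))

/-- The two-sided ideal `I` generated by the relations. -/
noncomputable def relationIdeal (ε : Vertex → Fin 3 → ℤˣ) : TwoSidedIdeal (PathAlgebra K Vertex) :=
  TwoSidedIdeal.span {r | Relation K ε r}

/-- The infinite-dimensional Rauzy algebra `A = KQ/I`. -/
abbrev RauzyAlgebra (ε : Vertex → Fin 3 → ℤˣ) : Type _ := PathAlgebra.Quot (relationIdeal K ε)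

variable (ε : Vertex → Fin 3 → ℤˣ)

/-- The image of an arrow of `Q` in `A`. -/
noncomputable def arrowElt {u v : Vertex} (b : u ⟶ v) : RauzyAlgebra K ε :=
  PathAlgebra.Quot.mk (relationIdeal K ε) (arrow K b)

/-- The idempotent `e_i`, the sum of the idempotents of the vertices in `V_i`. -/
noncomputable def idem (i : ℕ) : RauzyAlgebra K ε :=
  PathAlgebra.Quot.mk (relationIdeal K ε) (∑ v ∈ vertices i, vertexIdem K v)

theorem isIdempotentElem_idem (i : ℕ) : IsIdempotentElem (idem K ε i) :=
  congrArg (PathAlgebra.Quot.mk (relationIdeal K ε)) (vertexIdem_sum_mul_self K (vertices i))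

/-- The finite-dimensional Rauzy algebra `A_i = e_i A e_i`. -/
abbrev FinRauzyAlgebra (i : ℕ) : Type _ := (isIdempotentElem_idem K ε i).Corner

/-- `rad² A_i`, the square of the Jacobson radical. -/
noncomputable def radSq (i : ℕ) : Ideal (FinRauzyAlgebra K ε i) :=
  Ring.jacobson (FinRauzyAlgebra K ε i) * Ring.jacobson (FinRauzyAlgebra K ε i)

/-- `β` is a loop at the vertex `z`: `β = b̄ b` is not in `rad² A_i`, where `b̄` is an arrow
starting at `z`, `b` is the opposite arrow, and neither belongs to `A_i`. -/
def IsLoopAt (i : ℕ) (z : Vertex) (β : FinRauzyAlgebra K ε i) : Prop :=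
  ∃ (x : Vertex) (b : x ⟶ z),
    β.1 = arrowElt K ε (bar b) * arrowElt K ε b ∧
      arrowElt K ε b ∉ NonUnitalRing.corner (idem K ε i) ∧
      arrowElt K ε (bar b) ∉ NonUnitalRing.corner (idem K ε i) ∧
      β ∉ radSq K ε i

/-- `z` yields a loop in `A_i`. -/
def YieldsLoop (i : ℕ) (z : Vertex) : Prop := ∃ β, IsLoopAt K ε i z β

/-- The number of loops at `z`: the dimension of the subspace of `A_i / rad² A_i` spanned by the
classes of the loops at `z`. -/
noncomputable def numLoops (i : ℕ) (z : Vertex) : ℕ :=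
  Module.finrank K (Submodule.span K
    (((radSq K ε i).restrictScalars K).mkQ '' {β | IsLoopAt K ε i z β}))

end Algebra

end Rauzy

/-!
The argument has a geometric and an algebraic half.

Geometry. The transpose of `M` has an eigenvector `wt` with positive entries for the eigenvalue
`lam` in `(0, 1)`, so `M` multiplies the height `ht` by `lam`, and all tiles, regarded as faces of
unit cubes in `ℤ³`, lie in the discrete plane `plane`. There every face has a unique origin `par`
under the substitution, and a face belongs to `patch (i + 1)` if and only if its origin belongs to
`patch i` (`mem_patch_succ`). Which faces near a given one belong to a patch is therefore decided by
a finite automaton: heights enter only through comparisons with finitely many vectors, so that they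
may be replaced by integers, and the neighbourhoods that occur are those of `table`, which contains
the neighbourhoods in the first patch (`table_zero`) and is closed under the substitution
(`table_succ`). Two facts are read off from the table. Of two opposite edges of the tiling at a
vertex of a patch, at least one belongs to the patch (`isEdge_patch_or`), and an edge of the tiling
between two vertices of a patch belongs to the patch (`isEdge_patch_of_mem_corners`). Hence at a
`(k, n)`-vertex at most one edge along each of the three axes is outside the patch, which yields `n
- k ≤ 3`, with equality if and only if all three axes have such an edge (`IsKNVertex.bounds`).

Algebra. All paths of length five are zero in the Rauzy algebra (`ar₅_eq_zero`): a path of length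
three is zero or, up to sign, of the form `b c c̄`; such an element can be moved across rhombi and,
by the star relations, traded for `b c' c̄'` with the other neighbour `c'` of `b`. Combinations of
paths of positive length are therefore nilpotent and make up the radical of `A_i`. A path `b b̄`
along an edge of the patch lies in `rad² A_i`. Modulo `rad² A_i` the star relations at `z` thus
involve only the edges outside the patch. If an axis has no such edge, they say that all `b b̄` at
`z` lie in `rad² A_i`, and there is no loop (`exists_isOuter_of_yieldsLoop`). If each axis has one,
they say that the three `b b̄` agree up to sign; the linear form `turnForm` with the coefficients
`outerCoeff` respects all relations, vanishes on `rad² A_i` and is nonzero on the `b b̄`, so that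
these are loops (`isLoopAt_turn`), and their classes span a line (`numLoops_eq_one`).
-/

namespace Rauzy

/-! ### Heights and the discrete plane -/

theorem exists_tribonacci_root : ∃ x : ℝ, 0 < x ∧ x ^ 3 + x ^ 2 + x = 1 := by
  have hc : ContinuousOn (fun x : ℝ => x ^ 3 + x ^ 2 + x) (Set.Icc 0 1) := by fun_prop
  obtain ⟨x, hx, h⟩ := intermediate_value_Icc (zero_le_one' ℝ) hc
    (show (1 : ℝ) ∈ Set.Icc _ _ by norm_num)
  refine ⟨x, lt_of_le_of_ne hx.1 ?_, h⟩
  rintro rfl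
  norm_num at h

/-- The eigenvalue of `M` inside the unit interval, the inverse of the tribonacci constant. -/
noncomputable def lam : ℝ := exists_tribonacci_root.choose

theorem lam_pos : 0 < lam := exists_tribonacci_root.choose_spec.1

theorem lam_cubic : lam ^ 3 + lam ^ 2 + lam = 1 := exists_tribonacci_root.choose_spec.2

theorem lt_lam : (0.54368 : ℝ) < lam := by
  by_contra! h
  have h1 : lam ^ 2 ≤ 0.54368 ^ 2 := pow_le_pow_left₀ lam_pos.le h 2
  have h2 : lam ^ 3 ≤ 0.54368 ^ 3 := pow_le_pow_left₀ lam_pos.le h 3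
  have := lam_cubic
  norm_num at h1 h2
  linarith

theorem lam_lt : lam < (0.54369 : ℝ) := by
  by_contra! h
  have h1 : (0.54369 : ℝ) ^ 2 ≤ lam ^ 2 := pow_le_pow_left₀ (by norm_num) h 2
  have h2 : (0.54369 : ℝ) ^ 3 ≤ lam ^ 3 := pow_le_pow_left₀ (by norm_num) h 3
  have := lam_cubic
  norm_num at h1 h2
  linarith

theorem lt_lam_sq : (0.29558 : ℝ) < lam ^ 2 := by
  have := pow_lt_pow_left₀ lt_lam (by norm_num) two_ne_zero
  norm_num at this
  linarith

theorem lam_sq_lt : lam ^ 2 < (0.29560 : ℝ) := by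
  have := pow_lt_pow_left₀ lam_lt lam_pos.le two_ne_zero
  norm_num at this
  linarith

/-- The heights of the three basis vectors: a left eigenvector of `M` for the eigenvalue `lam`. -/
noncomputable def wt : Fin 3 → ℝ := ![1, lam + lam ^ 2, lam]

/-- The height of a lattice point above the contracting plane of the substitution. -/
noncomputable def ht (z : Fin 3 → ℤ) : ℝ := z 0 * wt 0 + z 1 * wt 1 + z 2 * wt 2

/-- The height of the main diagonal of the unit cube. -/
noncomputable def cubeHt : ℝ := wt 0 + wt 1 + wt 2

theorem wt_zero : wt 0 = 1 := rfl
theorem wt_one : wt 1 = lam + lam ^ 2 := rfl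
theorem wt_two : wt 2 = lam := rfl

theorem wt_pos (a : Fin 3) : 0 < wt a := by
  have := lt_lam
  have := lt_lam_sq
  fin_cases a <;> simp [wt] <;> linarith

theorem wt_le_one (a : Fin 3) : wt a ≤ 1 := by
  have := lam_lt
  have := lam_sq_lt
  fin_cases a <;> simp [wt] <;> linarith

theorem cubeHt_pos : 0 < cubeHt := by
  have := wt_pos 0
  have := wt_pos 1
  have := wt_pos 2
  rw [cubeHt]
  linarith

theorem ht_zero : ht 0 = 0 := by simp [ht]

theorem ht_add (x y : Fin 3 → ℤ) : ht (x + y) = ht x + ht y := by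
  simp only [ht, Pi.add_apply, Int.cast_add]
  ring

theorem ht_neg (x : Fin 3 → ℤ) : ht (-x) = -ht x := by
  simp only [ht, Pi.neg_apply, Int.cast_neg]
  ring

theorem ht_sub (x y : Fin 3 → ℤ) : ht (x - y) = ht x - ht y := by
  rw [sub_eq_add_neg, ht_add, ht_neg, sub_eq_add_neg]

theorem ht_single (a : Fin 3) : ht (Pi.single a 1) = wt a := by
  fin_cases a <;> simp [ht]

theorem M_mulVec (z : Fin 3 → ℤ) : M.mulVec z = ![z 1, z 2, z 0 - z 1 - z 2] := by
  ext r
  fin_cases r <;> simp [M, Matrix.mulVec, dotProduct, Fin.sum_univ_three]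
  ring

theorem ht_mulVec (z : Fin 3 → ℤ) : ht (M.mulVec z) = lam * ht z := by
  have h : lam ^ 3 = 1 - lam ^ 2 - lam := by linarith [lam_cubic]
  rw [M_mulVec]
  simp only [ht, wt_zero, wt_one, wt_two, Matrix.cons_val_zero, Matrix.cons_val_one,
    Matrix.cons_val, Int.cast_sub]
  ring_nf
  rw [h]
  ring

/-- The inverse of `M`. -/
def Minv (z : Fin 3 → ℤ) : Fin 3 → ℤ := ![z 0 + z 1 + z 2, z 0, z 1]

theorem mulVec_Minv (z : Fin 3 → ℤ) : M.mulVec (Minv z) = z := by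
  rw [M_mulVec]
  ext r
  fin_cases r <;> simp [Minv]
  ring

theorem Minv_mulVec (z : Fin 3 → ℤ) : Minv (M.mulVec z) = z := by
  rw [M_mulVec]
  ext r
  fin_cases r <;> simp [Minv]

theorem Minv_add (x y : Fin 3 → ℤ) : Minv (x + y) = Minv x + Minv y := by
  ext r
  fin_cases r <;> simp [Minv]
  ring

theorem Minv_sub (x y : Fin 3 → ℤ) : Minv (x - y) = Minv x - Minv y := by
  ext r
  fin_cases r <;> simp [Minv]
  ring

/-- The discrete plane: all faces of unit cubes which separate the lattice cubes whose lowest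
corner has negative height from the others. -/
def plane : Set Tile := {t | 0 ≤ ht t.1 ∧ ht t.1 < wt t.2}

/-- The translation vector of the copy of `R_{k+1}` in `ℛ(R_1)`. The faces of type `k` whose base
point is at least as high as this vector arise from faces of type `0`. -/
def thr : Fin 3 → Fin 3 → ℤ := ![col 1, col 2, 0]

theorem ht_thr_zero : ht (thr 0) = 1 - lam := by
  simp [thr, col, M, ht, wt]
  ring

theorem ht_thr_one : ht (thr 1) = lam ^ 2 := by
  simp [thr, col, M, ht, wt]

theorem ht_thr_two : ht (thr 2) = 0 := by
  simp [thr, ht_zero]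

/-- Every face arises either from a face of type `0` or, by a mere change of type, from a face of
the next type. -/
theorem mem_subst_iff (t p : Tile) : t ∈ subst p ↔
    (p.2 = 0 ∧ t.1 = M.mulVec p.1 + thr t.2) ∨
      (t.2 ≠ 2 ∧ p.2 = t.2 + 1 ∧ t.1 = M.mulVec p.1) := by
  obtain ⟨z, k⟩ := t
  obtain ⟨y, j⟩ := p
  fin_cases j <;> fin_cases k <;> simp [subst, substBase, thr, eq_comm]

open Classical in
/-- The face of the discrete plane from which a given face arises by the substitution. -/
noncomputable def par (t : Tile) : Tile :=
  if ht (thr t.2) ≤ ht t.1 then (Minv (t.1 - thr t.2), 0) else (Minv t.1, t.2 + 1)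

theorem ht_Minv (z : Fin 3 → ℤ) : ht z = lam * ht (Minv z) := by
  rw [← ht_mulVec, mulVec_Minv]

theorem mem_plane_of_mem_subst {t p : Tile} (hp : p ∈ plane) (h : t ∈ subst p) : t ∈ plane := by
  obtain ⟨z, k⟩ := t
  obtain ⟨y, j⟩ := p
  obtain ⟨h0, h1⟩ := hp
  rw [mem_subst_iff] at h
  have hl := lam_pos
  have h2 : 0 ≤ lam * ht y := by positivity
  have h3 : lam * ht y < lam * wt j := by gcongr
  have h4 := lt_lam_sq
  have h5 := lam_lt
  have h6 := lam_cubic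
  obtain ⟨rfl, h⟩ | ⟨hk, rfl, h⟩ := h <;> simp only at h h3 <;> subst h
  · simp only [plane, Set.mem_ofPred_eq, ht_add, ht_mulVec]
    rw [wt_zero] at h3
    fin_cases k
    · simp only [Fin.zero_eta, ht_thr_zero, wt_zero]; constructor <;> linarith
    · simp only [Fin.mk_one, ht_thr_one, wt_one]; constructor <;> linarith
    · simp only [Fin.reduceFinMk, ht_thr_two, wt_two]; constructor <;> linarith
  · simp only [plane, Set.mem_ofPred_eq, ht_mulVec]
    refine ⟨h2, h3.trans_le ?_⟩
    fin_cases k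
    · simp [wt]; nlinarith
    · simp [wt]; nlinarith
    · exact absurd rfl hk

/-- The height of a face of the discrete plane tells from which type of face it arises. -/
theorem par_eq_of_mem_subst {t p : Tile} (hp : p ∈ plane) (h : t ∈ subst p) : par t = p := by
  obtain ⟨z, k⟩ := t
  obtain ⟨y, j⟩ := p
  obtain ⟨h0, h1⟩ := hp
  rw [mem_subst_iff] at h
  have hl := lam_pos
  have h2 : 0 ≤ lam * ht y := by positivity
  have h3 : lam * ht y < lam * wt j := by gcongr
  have h6 := lam_cubic
  obtain ⟨rfl, h⟩ | ⟨hk, rfl, h⟩ := h <;> simp only at h h3 <;> subst h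
  · rw [par, if_pos (by simp only [ht_add, ht_mulVec]; linarith)]
    simp only [add_sub_cancel_right, Minv_mulVec]
  · rw [par, if_neg, Minv_mulVec]
    simp only [ht_mulVec, not_le]
    fin_cases k
    · simp [ht_thr_zero, wt] at h3 ⊢; nlinarith
    · simp [ht_thr_one, wt] at h3 ⊢; nlinarith
    · exact absurd rfl hk

theorem mem_subst_par {t : Tile} (ht' : t ∈ plane) : t ∈ subst (par t) := by
  rw [mem_subst_iff, par]
  split_ifs with h
  · exact Or.inl ⟨rfl, by simp only [mulVec_Minv, sub_add_cancel]⟩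
  · refine Or.inr ⟨?_, rfl, by simp only [mulVec_Minv]⟩
    intro h2
    rw [h2, ht_thr_two] at h
    exact h ht'.1

theorem par_mem_plane {t : Tile} (ht' : t ∈ plane) : par t ∈ plane := by
  obtain ⟨z, k⟩ := t
  obtain ⟨h0, h1⟩ := ht'
  have hl := lam_pos
  have h6 := lam_cubic
  rw [par]
  split_ifs with h
  · have e := ht_Minv (z - thr k)
    rw [ht_sub] at e
    simp only at h h0 h1 ⊢
    refine ⟨?_, ?_⟩
    · by_contra! hn
      nlinarith
    · rw [wt_zero]
      by_contra! hn
      have : ht z - ht (thr k) < lam := by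
        fin_cases k
        · simp [ht_thr_zero, wt] at h1 ⊢; linarith
        · simp [ht_thr_one, wt] at h1 ⊢; linarith
        · simp [ht_thr_two, wt] at h1 ⊢; linarith
      simp only at hn
      nlinarith
  · have e := ht_Minv z
    simp only [not_le] at h h0 h1 ⊢
    refine ⟨?_, ?_⟩
    · by_contra! hn
      simp only at hn
      nlinarith
    · by_contra! hn
      simp only at hn
      fin_cases k
      · simp [ht_thr_zero, wt] at h hn; nlinarith
      · simp [ht_thr_one, wt] at h hn; nlinarith
      · simp [ht_thr_two] at h h0; linarith

theorem patch_subset_plane (i : ℕ) : (patch i : Set Tile) ⊆ plane := by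
  induction i with
  | zero =>
    intro t h
    simp only [patch, Finset.coe_insert, Finset.coe_singleton, Set.mem_insert_iff,
      Set.mem_singleton_iff] at h
    obtain rfl | rfl | rfl := h <;> simp [plane, ht_zero, wt_pos]
  | succ i ih =>
    intro t h
    simp only [patch, Finset.mem_coe, Finset.mem_biUnion] at h
    obtain ⟨p, hp, h⟩ := h
    exact mem_plane_of_mem_subst (ih hp) h

theorem mem_plane_of_mem_patch {i : ℕ} {t : Tile} (h : t ∈ patch i) : t ∈ plane :=
  patch_subset_plane i h

theorem mem_plane_of_mem_tiling {t : Tile} (h : t ∈ tiling) : t ∈ plane :=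
  let ⟨_, hi⟩ := h
  mem_plane_of_mem_patch hi

theorem mem_patch_zero {t : Tile} : t ∈ patch 0 ↔ t.1 = 0 := by
  obtain ⟨z, k⟩ := t
  fin_cases k <;> simp [patch]

/-- On the discrete plane the patches are the iterated preimages of the first one. -/
theorem mem_patch_succ {t : Tile} (ht' : t ∈ plane) (i : ℕ) :
    t ∈ patch (i + 1) ↔ par t ∈ patch i := by
  rw [patch, Finset.mem_biUnion]
  constructor
  · rintro ⟨p, hp, h⟩
    rwa [par_eq_of_mem_subst (mem_plane_of_mem_patch hp) h]
  · exact fun h => ⟨_, h, mem_subst_par ht'⟩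

/-! ### Integer approximations of heights -/

/-- Vectors and offsets in a form suited to computation. -/
abbrev Vec3 : Type := ℤ × ℤ × ℤ

/-- The lattice point with the given coordinates. -/
def vec (p : Vec3) : Fin 3 → ℤ := ![p.1, p.2.1, p.2.2]

theorem vec_add (p q : Vec3) : vec (p + q) = vec p + vec q := by
  ext r
  fin_cases r <;> simp [vec]

theorem vec_sub (p q : Vec3) : vec (p - q) = vec p - vec q := by
  ext r
  fin_cases r <;> simp [vec]

theorem vec_neg (p : Vec3) : vec (-p) = -vec p := by
  ext r
  fin_cases r <;> simp [vec]

theorem vec_zero : vec 0 = 0 := by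
  ext r
  fin_cases r <;> simp [vec]

theorem vec_injective : Function.Injective vec := fun p q h => by
  have h0 := congrFun h 0
  have h1 := congrFun h 1
  have h2 := congrFun h 2
  simp only [vec, Matrix.cons_val_zero, Matrix.cons_val_one, Matrix.cons_val] at h0 h1 h2
  exact Prod.ext h0 (Prod.ext h1 h2)

/-- Consecutive tribonacci numbers make up an integer weight vector which orders short vectors in
the same way as the heights `wt`. -/
def wtN : Fin 3 → ℤ := ![504, 423, 274]

/-- The integer height of a short vector. -/
def htN (p : Vec3) : ℤ := 504 * p.1 + 423 * p.2.1 + 274 * p.2.2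

theorem htN_sub (p q : Vec3) : htN (p - q) = htN p - htN q := by
  simp only [htN, Prod.fst_sub, Prod.snd_sub]
  ring

/-- The weights `504 * wt` and `wtN` differ by less than `0.02`, which is too little to change the
sign of the height of a short vector. -/
theorem ht_vec_pos {e : Vec3} (h1 : |e.2.1| ≤ 4) (h2 : |e.2.2| ≤ 4) (h : 1 ≤ htN e) :
    0 < ht (vec e) := by
  have hq := lt_lam_sq
  have hq' := lam_sq_lt
  have hl := lt_lam
  have hl' := lam_lt
  have h1' : |(e.2.1 : ℝ)| ≤ 4 := by exact_mod_cast h1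
  have h2' : |(e.2.2 : ℝ)| ≤ 4 := by exact_mod_cast h2
  have h' : (1 : ℝ) ≤ 504 * e.1 + 423 * e.2.1 + 274 * e.2.2 := by exact_mod_cast h
  have a1 : |(e.2.1 : ℝ) * (504 * (lam + lam ^ 2) - 423)| ≤ 4 * 0.02 := by
    rw [abs_mul]
    refine mul_le_mul h1' ?_ (abs_nonneg _) (by norm_num)
    rw [abs_le]
    constructor <;> linarith
  have a2 : |(e.2.2 : ℝ) * (504 * lam - 274)| ≤ 4 * 0.02 := by
    rw [abs_mul]
    refine mul_le_mul h2' ?_ (abs_nonneg _) (by norm_num)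
    rw [abs_le]
    constructor <;> linarith
  have b1 := (abs_le.mp a1).1
  have b2 := (abs_le.mp a2).1
  have : ht (vec e) = e.1 + e.2.1 * (lam + lam ^ 2) + e.2.2 * lam := by
    simp [ht, vec, wt]
  rw [this]
  norm_num at b1 b2
  linarith

/-- All coordinates have absolute value at most two. -/
def Short (c : Vec3) : Prop := |c.1| ≤ 2 ∧ |c.2.1| ≤ 2 ∧ |c.2.2| ≤ 2

instance (c : Vec3) : Decidable (Short c) := inferInstanceAs (Decidable (_ ∧ _ ∧ _))

theorem ht_vec_le_iff {c d : Vec3} (hc : Short c) (hd : Short d) :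
    ht (vec c) ≤ ht (vec d) ↔ htN c ≤ htN d := by
  have key : ∀ c d : Vec3, Short c → Short d → htN c < htN d → ht (vec c) < ht (vec d) := by
    intro c d hc hd h
    have := ht_vec_pos (e := d - c)
      ((abs_sub _ _).trans (add_le_add hd.2.1 hc.2.1))
      ((abs_sub _ _).trans (add_le_add hd.2.2 hc.2.2)) (by rw [htN_sub]; omega)
    rw [vec_sub, ht_sub] at this
    linarith
  constructor
  · intro h
    by_contra! hn
    exact absurd (key d c hd hc hn) (not_lt.mpr h)
  · intro h
    obtain h | h := h.lt_or_eq
    · exact (key c d hc hd h).le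
    · obtain ⟨h0, h1, h2⟩ := hc
      obtain ⟨h0', h1', h2'⟩ := hd
      rw [abs_le] at h0 h1 h2 h0' h1' h2'
      simp only [htN] at h
      have : c = d := Prod.ext (by omega) (Prod.ext (by omega) (by omega))
      rw [this]

/-- The vectors whose heights separate the different shapes of neighbourhoods of a face. -/
def levels : List Vec3 :=
  [(0, 0, 0), (1, -1, 0), (0, 1, -1), (-1, 1, 1), (1, 0, -1), (0, 0, 1), (1, -1, 1), (1, 1, -2),
    (0, 1, 0)]

/-- A short vector is critical if its height does not separate two heights in `[0, 1)` which the
vectors in `levels` do not separate. -/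
def Critical (c : Vec3) : Prop := Short c ∧ (c ∈ levels ∨ htN c ≤ 0 ∨ 504 ≤ htN c)

instance (c : Vec3) : Decidable (Critical c) := inferInstanceAs (Decidable (_ ∧ (_ ∨ _ ∨ _)))

/-- The integer `n` lies between the same integer heights of critical vectors as the real number
`H` does between the corresponding real heights. -/
def Sim (H : ℝ) (n : ℤ) : Prop := ∀ c, Critical c → (ht (vec c) ≤ H ↔ htN c ≤ n)

theorem sim_vec {d : Vec3} (hd : Short d) : Sim (ht (vec d)) (htN d) :=
  fun _ hc => ht_vec_le_iff hc.1 hd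

theorem levels_spec : ∀ c ∈ levels, Short c ∧ 0 ≤ htN c ∧ htN c < 504 := by decide +kernel

/-- The heights of faces fall into finitely many classes. -/
theorem exists_sim {H : ℝ} (h0 : 0 ≤ H) (h1 : H < 1) : ∃ c ∈ levels, Sim H (htN c) := by
  classical
  obtain ⟨d, hd, hmax⟩ := (levels.toFinset.filter fun c => ht (vec c) ≤ H).exists_max_image
    (fun c => ht (vec c)) ⟨(0, 0, 0), by
      simp only [Finset.mem_filter, List.mem_toFinset]
      exact ⟨by decide, by simpa [vec, ht] using h0⟩⟩
  simp only [Finset.mem_filter, List.mem_toFinset] at hd hmax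
  have hs := levels_spec d hd.1
  refine ⟨d, hd.1, fun c ⟨hc, hc'⟩ => ?_⟩
  rw [← ht_vec_le_iff hc hs.1]
  refine ⟨fun h => ?_, fun h => h.trans hd.2⟩
  obtain hl | hl | hl := hc'
  · exact hmax c ⟨hl, h⟩
  · exact (ht_vec_le_iff hc hs.1).mpr (hl.trans hs.2.1)
  · have h2 : ht (vec (1, 0, 0)) ≤ ht (vec c) := (ht_vec_le_iff (by decide) hc).mpr hl
    have h3 : ht (vec (1, 0, 0)) = 1 := by simp [ht, vec, wt]
    linarith

/-! ### Neighbourhoods of faces -/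

/-- A type of face together with a base point; as a relative position it stands for the face of
this type whose base point differs from that of a given face by the given vector. -/
abbrev Off : Type := Vec3 × Fin 3

/-- The face in a relative position to a given one. -/
def shift (t : Tile) (o : Off) : Tile := (t.1 + vec o.1, o.2)

/-- The relative positions of the neighbours of a face of type `k`. They comprise all faces of the
discrete plane which have a corner in common with it, and are chosen so that faces in neighbouring
positions arise from faces in neighbouring positions. -/
def nbr : Fin 3 → List Off := ![
  [((-1, 1, -1), 0), ((0, -1, 0), 0), ((0, -1, 1), 0), ((0, 0, -1), 0), ((0, 0, 0), 0), ((0, 0,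
   1), 0), ((0, 1, -1), 0), ((0, 1, 0), 0), ((1, -1, 1), 0), ((-1, 0, 1), 1), ((-1, 1, -1), 1),
   ((-1, 1, 0), 1), ((-1, 1, 1), 1), ((0, 0, -1), 1), ((0, 0, 0), 1), ((0, 0, 1), 1), ((0, 1, -1),
   1), ((-1, 0, 1), 2), ((-1, 1, 0), 2), ((-1, 1, 1), 2), ((0, -1, 0), 2), ((0, -1, 1), 2), ((0,
   0, 0), 2)],
  [((0, -1, 1), 0), ((0, 0, -1), 0), ((0, 0, 0), 0), ((0, 0, 1), 0), ((1, -1, -1), 0), ((1, -1,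
   0), 0), ((1, -1, 1), 0), ((1, 0, -1), 0), ((-1, 0, 1), 1), ((0, 0, -1), 1), ((0, 0, 0), 1),
   ((0, 0, 1), 1), ((1, 0, -1), 1), ((-1, 0, 1), 2), ((0, -1, 1), 2), ((0, 0, 0), 2), ((1, -1, 0),
   2)],
  [((0, 0, 0), 0), ((0, 1, -1), 0), ((0, 1, 0), 0), ((1, -1, -1), 0), ((1, -1, 0), 0), ((1, 0,
   -1), 0), ((-1, 1, 0), 1), ((0, 0, 0), 1), ((0, 1, -1), 1), ((1, 0, -1), 1), ((-1, 1, 0), 2),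
   ((0, 0, 0), 2), ((1, -1, 0), 2)]]

/-- The unit vectors. -/
def unitN : Fin 3 → Vec3 := ![(1, 0, 0), (0, 1, 0), (0, 0, 1)]

theorem vec_unitN (a : Fin 3) : vec (unitN a) = Pi.single a 1 := by
  ext r
  fin_cases a <;> fin_cases r <;> rfl

/-- The vectors `thr`. -/
def thrN : Fin 3 → Vec3 := ![(1, 0, -1), (0, 1, -1), (0, 0, 0)]

theorem vec_thrN (k : Fin 3) : vec (thrN k) = thr k := by
  ext r
  fin_cases k <;> fin_cases r <;> rfl

/-- The inverse of `M`. -/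
def MinvN (p : Vec3) : Vec3 := (p.1 + p.2.1 + p.2.2, p.1, p.2.1)

theorem vec_MinvN (p : Vec3) : vec (MinvN p) = Minv (vec p) := rfl

/-- The face in relative position `o` to a face of height `n` belongs to the discrete plane. -/
def inN (n : ℤ) (o : Off) : Bool := decide (0 ≤ n + htN o.1) && decide (n + htN o.1 < wtN o.2)

/-- The origin under the substitution of the face in relative position `o` to a face of height
`n`, if the base point of the latter is the origin. -/
def parN (n : ℤ) (o : Off) : Off :=
  if htN (thrN o.2) ≤ n + htN o.1 then (MinvN (o.1 - thrN o.2), 0) else (MinvN o.1, o.2 + 1)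

/-- The relative position of the origins under the substitution of two faces. -/
def relN (n : ℤ) (k : Fin 3) (o : Off) : Off := ((parN n o).1 - (parN n (0, k)).1, (parN n o).2)

/-- The encoding of a set of neighbours as a binary number. -/
def mask (l : List Off) (f : Off → Bool) : ℕ := l.foldr (fun o m => Nat.bit (f o) m) 0

/-- The membership in a set of neighbours that is encoded as a binary number. -/
def look (k : Fin 3) (m : ℕ) (o : Off) : Bool := m.testBit ((nbr k).idxOf o)

theorem testBit_mask (l : List Off) (f : Off → Bool) {o : Off} (ho : o ∈ l) :
    (mask l f).testBit (l.idxOf o) = f o := by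
  induction l with
  | nil => simp at ho
  | cons a l ih =>
    rw [mask, List.foldr_cons, ← mask]
    by_cases h : a = o
    · rw [h, List.idxOf_cons_self, Nat.testBit_bit_zero]
    · rw [List.idxOf_cons_ne _ h, Nat.testBit_bit_succ, ih]
      exact (List.mem_cons.mp ho).resolve_left (Ne.symm h)

theorem look_mask {k : Fin 3} (f : Off → Bool) {o : Off} (ho : o ∈ nbr k) :
    look k (mask (nbr k) f) o = f o := testBit_mask _ f ho

/-- All possibilities for the neighbourhood of a face with respect to a patch: the type of the
face, the set of its neighbours in the discrete plane, and the list of all nonempty intersections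
of this set with a patch. Sets of neighbours are encoded by `mask`: the binary digits of a number
tell which members of the list `nbr` belong to the set. -/
def table : List (Fin 3 × ℕ × List ℕ) := [
   (0, 1191455, [1, 134687, 1048578, 1056768, 1056770, 1191454, 1191455]),
   (0, 2256413, [1, 516, 1025, 134169, 2256412, 2256413]),
   (0, 2517596, [516, 8200, 395352, 395868, 2121728, 2121736, 2122244, 2517080, 2517596]),
   (0, 4577648, [55600, 262208, 264192, 264256, 268400, 4259840, 4315440, 4522048, 4528240,
    4577648]),
   (0, 4837872, [49408, 528624, 578032, 4210704, 4259840, 4276240, 4309248, 4309264, 4788464,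
    4837872]),
   (0, 6641780, [6196, 262208, 268404, 2097156, 2113540, 2119732, 6373376, 6379572, 6635584,
    6641780]),
   (0, 6769236, [516, 131584, 133648, 133652, 6768720, 6769236]),
   (1, 26423, [257, 514, 8198, 8455, 17968, 17970, 18225, 26166, 26423]),
   (1, 50365, [16, 50352, 50365]),
   (1, 58805, [257, 8448, 8452, 8453, 58548, 58805]),
   (1, 105708, [12, 3168, 3180, 32896, 32908, 33796, 33924, 36068, 36076, 69632, 72800, 72812,
    102528, 102540, 105696, 105708]),
   (1, 119981, [13, 16385, 17441, 17453, 119968, 119981]),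
   (2, 3579, [8, 65, 1026, 2488, 3579]),
   (2, 7095, [7, 144, 151, 2177, 2343, 2465, 2481, 2487, 4608, 4752, 6944, 6951, 7088, 7095]),
   (2, 8179, [65, 144, 209, 1026, 1088, 1090, 1091, 2336, 3362, 3427, 3571, 4608, 4817, 7088,
    7153, 7970, 8114, 8179])]

/-- All comparisons of heights in the neighbourhood of a face, including those in the definition of
`par`, are comparisons with critical vectors. -/
theorem nbr_critical : ∀ k, ∀ o ∈ nbr k,
    Short o.1 ∧ Critical (-o.1) ∧ Critical (unitN o.2 - o.1) ∧ Critical (thrN o.2 - o.1) := by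
  decide +kernel

theorem zero_mem_nbr : ∀ k : Fin 3, ((0, k) : Off) ∈ nbr k := by decide +kernel

/-- Faces in neighbouring positions arise from faces in neighbouring positions. -/
theorem relN_mem_nbr : ∀ c ∈ levels, ∀ k, ∀ o ∈ nbr k, htN c < wtN k → inN (htN c) o = true →
    relN (htN c) k o ∈ nbr (parN (htN c) (0, k)).2 := by
  decide +kernel

/-- The table contains the neighbourhoods with respect to the first patch. -/
theorem table_zero : ∀ k, ∀ o ∈ nbr k, 0 ≤ htN (-o.1) → htN (-o.1) < wtN k →
    ∃ e ∈ table, e.1 = k ∧ e.2.1 = mask (nbr k) (inN (htN (-o.1))) ∧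
      mask (nbr k) (fun o' => decide (o'.1 = o.1)) ∈ e.2.2 := by
  decide +kernel

/-- The table is closed under the substitution: if the entry `e` is compatible with the height of a
face and describes the neighbourhood of its origin, then the neighbourhood of the face either does
not meet the patch or is listed. -/
theorem table_succ : ∀ c ∈ levels, ∀ k, htN c < wtN k → ∀ e ∈ table,
    e.1 = (parN (htN c) (0, k)).2 →
    (∀ o ∈ nbr k, inN (htN c) o = true → look e.1 e.2.1 (relN (htN c) k o) = true) →
    ∀ F ∈ e.2.2,
      mask (nbr k) (fun o => inN (htN c) o && look e.1 F (relN (htN c) k o)) = 0 ∨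
      ∃ e' ∈ table, e'.1 = k ∧ e'.2.1 = mask (nbr k) (inN (htN c)) ∧
        mask (nbr k) (fun o => inN (htN c) o && look e.1 F (relN (htN c) k o)) ∈ e'.2.2 := by
  decide +kernel

theorem htN_unitN (a : Fin 3) : htN (unitN a) = wtN a := by
  fin_cases a <;> rfl

theorem htN_neg (p : Vec3) : htN (-p) = -htN p := by
  simp only [htN, Prod.fst_neg, Prod.snd_neg]
  ring

theorem shift_mem_plane_iff' {t : Tile} {n : ℤ} (hs : Sim (ht t.1) n) {o : Off}
    (h1 : Critical (-o.1)) (h2 : Critical (unitN o.2 - o.1)) :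
    shift t o ∈ plane ↔ inN n o = true := by
  have e1 := hs _ h1
  have e2 := hs _ h2
  rw [vec_neg, ht_neg, htN_neg] at e1
  rw [vec_sub, ht_sub, vec_unitN, ht_single, htN_sub, htN_unitN] at e2
  simp only [plane, Set.mem_ofPred_eq, shift, ht_add, inN, Bool.and_eq_true, decide_eq_true_eq]
  refine and_congr ?_ ?_
  · rw [← neg_le_iff_add_nonneg, e1, neg_le_iff_add_nonneg]
  · rw [← not_le, ← not_le, not_iff_not, ← sub_le_iff_le_add, ← sub_le_iff_le_add]
    exact e2

theorem shift_mem_plane_iff {t : Tile} {n : ℤ} (hs : Sim (ht t.1) n) {k : Fin 3} {o : Off}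
    (ho : o ∈ nbr k) : shift t o ∈ plane ↔ inN n o = true :=
  shift_mem_plane_iff' hs (nbr_critical _ o ho).2.1 (nbr_critical _ o ho).2.2.1

theorem par_shift {t : Tile} {n : ℤ} (hs : Sim (ht t.1) n) {k : Fin 3} {o : Off}
    (ho : o ∈ nbr k) :
    par (shift t o) = (Minv t.1 + vec (parN n o).1, (parN n o).2) := by
  obtain ⟨-, -, -, h⟩ := nbr_critical _ o ho
  have e := hs _ h
  rw [vec_sub, ht_sub, vec_thrN, htN_sub, sub_le_iff_le_add, sub_le_iff_le_add] at e
  have e' : ht (thr (shift t o).2) ≤ ht (shift t o).1 ↔ htN (thrN o.2) ≤ n + htN o.1 := by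
    rw [← e, shift, ht_add]
  rw [par, parN]
  by_cases h' : htN (thrN o.2) ≤ n + htN o.1
  · rw [if_pos h', if_pos (e'.mpr h')]
    simp only [shift, vec_MinvN, vec_sub, vec_thrN, Minv_sub, Minv_add]
    rw [add_sub_assoc]
  · rw [if_neg h', if_neg (fun h => h' (e'.mp h))]
    simp only [shift, vec_MinvN, Minv_add]

theorem shift_zero (t : Tile) : shift t (0, t.2) = t := by
  rw [shift, vec_zero, add_zero]

theorem par_snd {t : Tile} {n : ℤ} (hs : Sim (ht t.1) n) : (par t).2 = (parN n (0, t.2)).2 := by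
  conv_lhs => rw [← shift_zero t, par_shift hs (zero_mem_nbr t.2)]

/-- The relative position of the origins of two neighbouring faces depends only on the relative
position of the faces and on the class of the height. -/
theorem par_shift_eq_shift {t : Tile} {n : ℤ} (hs : Sim (ht t.1) n) {o : Off}
    (ho : o ∈ nbr t.2) : par (shift t o) = shift (par t) (relN n t.2 o) := by
  have h : par t = _ := (congrArg par (shift_zero t)).symm.trans (par_shift hs (zero_mem_nbr t.2))
  rw [par_shift hs ho, h, shift, relN]
  simp only [vec_sub]
  rw [add_add_sub_cancel]

theorem exists_sim_of_mem_plane {t : Tile} (h : t ∈ plane) :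
    ∃ c ∈ levels, Sim (ht t.1) (htN c) ∧ 0 ≤ htN c ∧ htN c < wtN t.2 := by
  obtain ⟨c, hc, hs⟩ := exists_sim h.1 (h.2.trans_le (wt_le_one _))
  refine ⟨c, hc, hs, (levels_spec c hc).2.1, ?_⟩
  have : inN (htN c) (0, t.2) = true :=
    (shift_mem_plane_iff hs (zero_mem_nbr t.2)).mp (by rwa [shift_zero])
  simp only [inN, Bool.and_eq_true, decide_eq_true_eq] at this
  simpa [htN] using this.2

/-- The entry `e` of the table and the number `F` describe the neighbourhood of `t` with respect
to the patch `𝓟_i`. -/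
structure Describes (t : Tile) (i : ℕ) (e : Fin 3 × ℕ × List ℕ) (F : ℕ) : Prop where
  kind : e.1 = t.2
  look_plane : ∀ o ∈ nbr t.2, look t.2 e.2.1 o = true ↔ shift t o ∈ plane
  look_patch : ∀ o ∈ nbr t.2, look t.2 F o = true ↔ shift t o ∈ patch i

theorem describes_of_eq {t : Tile} {i : ℕ} {e : Fin 3 × ℕ × List ℕ} {n : ℤ} {f : Off → Bool}
    (hs : Sim (ht t.1) n) (hk : e.1 = t.2) (he : e.2.1 = mask (nbr t.2) (inN n))
    (hf : ∀ o ∈ nbr t.2, f o = true ↔ shift t o ∈ patch i) :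
    Describes t i e (mask (nbr t.2) f) where
  kind := hk
  look_plane o ho := by rw [he, look_mask _ ho, shift_mem_plane_iff hs ho]
  look_patch o ho := by rw [look_mask _ ho, hf o ho]

/-- Neighbourhoods with respect to patches are as listed in the table. -/
theorem exists_describes (i : ℕ) {t : Tile} (htp : t ∈ plane)
    (h : ∃ o ∈ nbr t.2, shift t o ∈ patch i) :
    ∃ e ∈ table, ∃ F ∈ e.2.2, Describes t i e F := by
  induction i generalizing t with
  | zero =>
    obtain ⟨o, ho, h⟩ := h
    rw [mem_patch_zero] at h
    have ht1 : t.1 = vec (-o.1) := by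
      rw [vec_neg]
      exact eq_neg_of_add_eq_zero_left h
    have hs : Sim (ht t.1) (htN (-o.1)) := by
      rw [ht1]
      exact sim_vec (nbr_critical _ o ho).2.1.1
    have hin := (shift_mem_plane_iff hs (zero_mem_nbr t.2)).mp (by rwa [shift_zero])
    simp only [inN, Bool.and_eq_true, decide_eq_true_eq] at hin
    have h0 : htN (0 : Vec3) = 0 := rfl
    rw [h0, add_zero] at hin
    obtain ⟨e, he, hk, hS, hF⟩ := table_zero t.2 o ho hin.1 hin.2
    refine ⟨e, he, _, hF, describes_of_eq hs hk hS fun o' _ => ?_⟩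
    rw [mem_patch_zero, shift, ht1, ← vec_add, decide_eq_true_eq, ← vec_zero,
      vec_injective.eq_iff, neg_add_eq_zero, eq_comm]
  | succ i ih =>
    obtain ⟨c, hc, hs, -, hn⟩ := exists_sim_of_mem_plane htp
    have hrel : ∀ o ∈ nbr t.2, inN (htN c) o = true → relN (htN c) t.2 o ∈ nbr (par t).2 := by
      intro o ho h
      rw [par_snd hs]
      exact relN_mem_nbr c hc t.2 o ho hn h
    have hpatch : ∀ o ∈ nbr t.2, shift t o ∈ patch (i + 1) ↔
        inN (htN c) o = true ∧ shift (par t) (relN (htN c) t.2 o) ∈ patch i := by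
      intro o ho
      rw [← par_shift_eq_shift hs ho, ← shift_mem_plane_iff hs ho]
      exact ⟨fun h => have hp := mem_plane_of_mem_patch h; ⟨hp, (mem_patch_succ hp i).mp h⟩,
        fun h => (mem_patch_succ h.1 i).mpr h.2⟩
    obtain ⟨o, ho, h⟩ := h
    rw [hpatch o ho] at h
    obtain ⟨e, he, F, hF, hd⟩ := ih (par_mem_plane htp) ⟨_, hrel o ho h.1, h.2⟩
    have hf : ∀ o ∈ nbr t.2,
        (inN (htN c) o && look e.1 F (relN (htN c) t.2 o)) = true ↔
          shift t o ∈ patch (i + 1) := by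
      intro o ho
      rw [hpatch o ho, Bool.and_eq_true]
      refine and_congr_right fun hin => ?_
      rw [hd.kind, hd.look_patch _ (hrel o ho hin)]
    obtain h0 | ⟨e', he', hk, hS, hF'⟩ := table_succ c hc t.2 hn e he
      (hd.kind.trans (par_snd hs)) (fun o ho hin => by
        rw [hd.kind, hd.look_plane _ (hrel o ho hin), ← par_shift_eq_shift hs ho]
        exact par_mem_plane ((shift_mem_plane_iff hs ho).mpr hin)) F hF
    · have := look_mask (fun o => inN (htN c) o && look e.1 F (relN (htN c) t.2 o)) ho
      rw [h0, (hf o ho).mpr ((hpatch o ho).mpr h), look, Nat.zero_testBit] at this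
      exact absurd this Bool.false_ne_true
    · exact ⟨e', he', _, hF', describes_of_eq hs hk hS hf⟩

/-- The faces of the patches in a form suited to computation. -/
def patchN : ℕ → List Off
  | 0 => [(0, 0), (0, 1), (0, 2)]
  | i + 1 => (patchN i).flatMap fun p =>
      let q : Vec3 := (p.1.2.1, p.1.2.2, p.1.1 - p.1.2.1 - p.1.2.2)
      if p.2 = 0 then [(q, 2), (q + thrN 0, 0), (q + thrN 1, 1)] else [(q, p.2 - 1)]

theorem mem_patch_of_mem_patchN {i : ℕ} {o : Off} (h : o ∈ patchN i) :
    (vec o.1, o.2) ∈ patch i := by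
  induction i generalizing o with
  | zero =>
    rw [mem_patch_zero, ← vec_zero, vec_injective.eq_iff]
    simp only [patchN, List.mem_cons, List.not_mem_nil, or_false] at h
    obtain rfl | rfl | rfl := h <;> rfl
  | succ i ih =>
    simp only [patchN, List.mem_flatMap] at h
    obtain ⟨p, hp, h⟩ := h
    refine Finset.mem_biUnion.mpr ⟨_, ih hp, ?_⟩
    have hM : M.mulVec (vec p.1) = vec (p.1.2.1, p.1.2.2, p.1.1 - p.1.2.1 - p.1.2.2) :=
      M_mulVec _
    rw [mem_subst_iff]
    simp only
    rw [hM]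
    split_ifs at h with h0
    · simp only [List.mem_cons, List.not_mem_nil, or_false] at h
      refine Or.inl ⟨h0, ?_⟩
      obtain rfl | rfl | rfl := h
      · simp [thr]
      · simp only [vec_add, vec_thrN]
      · simp only [vec_add, vec_thrN]
    · rw [List.mem_singleton] at h
      subst h
      refine Or.inr ⟨?_, ?_, rfl⟩
      · simpa [sub_eq_iff_eq_add] using h0
      · simp

/-- The fourth patch contains the neighbours of the faces of the first one. -/
theorem nbr_mem_patchN : ∀ k, ∀ o ∈ nbr k, inN 0 o = true → o ∈ patchN 4 := by
  decide +kernel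

/-- All neighbours in the discrete plane of faces of the tiling belong to the tiling. -/
theorem exists_shift_mem_patch (i : ℕ) {t : Tile} (h : t ∈ patch i) {o : Off} (ho : o ∈ nbr t.2)
    (hp : shift t o ∈ plane) : ∃ j, shift t o ∈ patch j := by
  induction i generalizing t o with
  | zero =>
    rw [mem_patch_zero] at h
    have hs : Sim (ht t.1) 0 := by
      rw [h, ← vec_zero]
      exact sim_vec (by decide)
    have := mem_patch_of_mem_patchN (nbr_mem_patchN _ o ho ((shift_mem_plane_iff hs ho).mp hp))
    exact ⟨4, by rwa [shift, h, zero_add]⟩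
  | succ i ih =>
    have htp := mem_plane_of_mem_patch h
    obtain ⟨c, hc, hs, -, hn⟩ := exists_sim_of_mem_plane htp
    obtain ⟨j, hj⟩ := ih ((mem_patch_succ htp i).mp h) (o := relN (htN c) t.2 o)
      (by rw [par_snd hs]
          exact relN_mem_nbr c hc t.2 o ho hn ((shift_mem_plane_iff hs ho).mp hp))
      (by rw [← par_shift_eq_shift hs ho]; exact par_mem_plane hp)
    exact ⟨j + 1, (mem_patch_succ hp j).mpr (by rwa [par_shift_eq_shift hs ho])⟩

/-! ### Corners and sides in the lattice -/

/-- The corners of a face in the three-dimensional lattice. -/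
def corner3 (t : Tile) (p q : Bool) : Fin 3 → ℤ :=
  t.1 + (if p then Pi.single (t.2 + 1) 1 else 0) + (if q then Pi.single (t.2 + 2) 1 else 0)

theorem proj_add (x y : Fin 3 → ℤ) : proj (x + y) = proj x + proj y := by
  ext <;> simp [proj] <;> ring

theorem proj_corner3 (t : Tile) (p q : Bool) : proj (corner3 t p q) = corner t p q := by
  cases p <;> cases q <;> simp [corner3, corner, proj_add, axis]

/-- A strip of lattice points of the height of the unit cube projects injectively, since the kernel
of the projection is spanned by the diagonal of the cube. -/
theorem eq_of_proj_eq {x y : Fin 3 → ℤ} (h : proj x = proj y) (hx : 0 ≤ ht x ∧ ht x < cubeHt)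
    (hy : 0 ≤ ht y ∧ ht y < cubeHt) : x = y := by
  simp only [proj, Prod.mk.injEq] at h
  have e1 : x 1 = y 1 + (x 0 - y 0) := by omega
  have e2 : x 2 = y 2 + (x 0 - y 0) := by omega
  have e : ht x = ht y + ((x 0 - y 0 : ℤ) : ℝ) * cubeHt := by
    simp only [ht, e1, e2, cubeHt]
    push_cast
    ring
  have hS := cubeHt_pos
  have h1 : ((x 0 - y 0 : ℤ) : ℝ) < 1 := by
    by_contra! h
    nlinarith
  have h2 : (-1 : ℝ) < ((x 0 - y 0 : ℤ) : ℝ) := by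
    by_contra! h
    nlinarith
  have h3 : x 0 - y 0 < 1 := by exact_mod_cast h1
  have h4 : -1 < x 0 - y 0 := by exact_mod_cast h2
  have h0 : x 0 = y 0 := by omega
  ext r
  fin_cases r
  · exact h0
  · simp; omega
  · simp; omega

theorem exists_lift (u : ℤ × ℤ) : ∃ x, proj x = u ∧ 0 ≤ ht x ∧ ht x < cubeHt := by
  obtain ⟨n, hn⟩ : ∃ n : ℤ, n = ⌊ht ![0, u.1, u.2] / cubeHt⌋ := ⟨_, rfl⟩
  have h1 := Int.floor_le (ht ![0, u.1, u.2] / cubeHt)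
  have h2 := Int.lt_floor_add_one (ht ![0, u.1, u.2] / cubeHt)
  rw [← hn, le_div_iff₀ cubeHt_pos] at h1
  rw [← hn, div_lt_iff₀ cubeHt_pos] at h2
  have e : ht ![-n, u.1 - n, u.2 - n] = ht ![0, u.1, u.2] - n * cubeHt := by
    simp [ht, cubeHt]
    ring
  exact ⟨![-n, u.1 - n, u.2 - n], by ext <;> simp [proj], by rw [e]; linarith, by
    rw [e]; linarith⟩

/-- The vertex of the discrete plane over a given point of the plane lattice. -/
noncomputable def lift (u : ℤ × ℤ) : Fin 3 → ℤ := (exists_lift u).choose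

/-- The height of the vertex of the discrete plane over a given point of the plane lattice. -/
noncomputable def hgt (u : ℤ × ℤ) : ℝ := ht (lift u)

theorem proj_lift (u : ℤ × ℤ) : proj (lift u) = u := (exists_lift u).choose_spec.1

theorem hgt_nonneg (u : ℤ × ℤ) : 0 ≤ hgt u := (exists_lift u).choose_spec.2.1

theorem hgt_lt (u : ℤ × ℤ) : hgt u < cubeHt := (exists_lift u).choose_spec.2.2

theorem eq_lift {x : Fin 3 → ℤ} {u : ℤ × ℤ} (h : proj x = u) (hx : 0 ≤ ht x)
    (hx' : ht x < cubeHt) : x = lift u :=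
  eq_of_proj_eq (h.trans (proj_lift u).symm) ⟨hx, hx'⟩ ⟨hgt_nonneg u, hgt_lt u⟩

theorem corner3_eq_lift {t : Tile} (h : t ∈ plane) (p q : Bool) :
    corner3 t p q = lift (corner t p q) := by
  obtain ⟨z, k⟩ := t
  obtain ⟨h0, h1⟩ := h
  have e : cubeHt = wt k + wt (k + 1) + wt (k + 2) := by
    fin_cases k <;> simp [cubeHt] <;> ring
  have p1 := wt_pos (k + 1)
  have p2 := wt_pos (k + 2)
  refine eq_lift (proj_corner3 _ _ _) ?_ ?_ <;>
  · simp only at h0 h1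
    cases p <;> cases q <;> simp [corner3, ht_add, ht_single] <;> linarith

/-- The vector of an edge in a given positive or negative direction. -/
def dvec (a : Fin 3) (s : Bool) : ℤ × ℤ := if s then axis a else -axis a

theorem dvec_inj {a b : Fin 3} {s r : Bool} : dvec a s = dvec b r ↔ a = b ∧ s = r := by
  revert a b s r
  decide +kernel

theorem dvec_not (a : Fin 3) (s : Bool) : dvec a (!s) = -dvec a s := by
  cases s <;> simp [dvec]

/-- The loss of height from a vertex to the lowest corner of a rhombus with a side in the given
direction, as far as it is due to this side. -/
noncomputable def lo (a : Fin 3) (s : Bool) : ℝ := if s then 0 else wt a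

theorem corner_not_left (t : Tile) (p q : Bool) :
    corner t (!p) q = corner t p q + dvec (t.2 + 1) (!p) := by
  cases p <;> simp [corner, dvec] <;> abel

theorem corner_not_right (t : Tile) (p q : Bool) :
    corner t p (!q) = corner t p q + dvec (t.2 + 2) (!q) := by
  cases q <;> simp [corner, dvec]

theorem ht_corner3 (t : Tile) (p q : Bool) :
    ht (corner3 t p q) = ht t.1 + lo (t.2 + 1) (!p) + lo (t.2 + 2) (!q) := by
  cases p <;> cases q <;> simp [corner3, ht_add, ht_single, lo]

theorem hgt_corner {t : Tile} (h : t ∈ plane) (p q : Bool) :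
    hgt (corner t p q) = ht t.1 + lo (t.2 + 1) (!p) + lo (t.2 + 2) (!q) := by
  rw [hgt, ← corner3_eq_lift h, ht_corner3]

theorem exists_tile {y : ℤ × ℤ} {k : Fin 3} {p q : Bool}
    (h0 : 0 ≤ hgt y - lo (k + 1) (!p) - lo (k + 2) (!q))
    (h1 : hgt y - lo (k + 1) (!p) - lo (k + 2) (!q) < wt k) :
    ∃ t ∈ plane, t.2 = k ∧ corner t p q = y := by
  refine ⟨(lift y - (if p then Pi.single (k + 1) 1 else 0) -
    (if q then Pi.single (k + 2) 1 else 0), k), ?_, rfl, ?_⟩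
  · have : ht (lift y - (if p then Pi.single (k + 1) 1 else 0) -
        (if q then Pi.single (k + 2) 1 else 0)) =
          hgt y - lo (k + 1) (!p) - lo (k + 2) (!q) := by
      cases p <;> cases q <;> simp [ht_sub, ht_single, lo, hgt]
    exact ⟨by rw [this]; exact h0, by rw [this]; exact h1⟩
  · rw [← proj_corner3]
    conv_rhs => rw [← proj_lift y]
    congr 1
    cases p <;> cases q <;> simp [corner3]
    abel

/-- Two sides of one rhombus meet at `y`, in the directions given by `(a, s)` and `(b, r)`. -/
def Adj (T : Set Tile) (y : ℤ × ℤ) (a : Fin 3) (s : Bool) (b : Fin 3) (r : Bool) : Prop :=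
  ∃ t ∈ T, IsSide t (y + dvec a s) y ∧ IsSide t y (y + dvec b r)

theorem isSide_iff {t : Tile} {y w : ℤ × ℤ} : IsSide t y w ↔ ∃ p q, y = corner t p q ∧
    (w = y + dvec (t.2 + 1) (!p) ∨ w = y + dvec (t.2 + 2) (!q)) := by
  constructor
  · rintro ⟨p, q, rfl, h⟩
    exact ⟨p, q, rfl, by rwa [corner_not_left, corner_not_right] at h⟩
  · rintro ⟨p, q, rfl, h⟩
    exact ⟨p, q, rfl, by rwa [corner_not_left, corner_not_right]⟩

theorem corner_inj {t : Tile} {p q p' q' : Bool} (h : corner t p q = corner t p' q') :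
    p = p' ∧ q = q' := by
  obtain ⟨z, k⟩ := t
  simp only [corner, add_assoc, add_right_inj] at h
  revert p q p' q' k
  decide +kernel

theorem isSide_add_iff {t : Tile} {p q : Bool} {a : Fin 3} {s : Bool} :
    IsSide t (corner t p q) (corner t p q + dvec a s) ↔
      (a = t.2 + 1 ∧ s = !p) ∨ (a = t.2 + 2 ∧ s = !q) := by
  rw [isSide_iff]
  constructor
  · rintro ⟨p', q', h, h'⟩
    obtain ⟨rfl, rfl⟩ := corner_inj h
    simpa only [add_right_inj, dvec_inj] using h'
  · intro h
    exact ⟨p, q, rfl, by simpa only [add_right_inj, dvec_inj] using h⟩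

theorem IsSide.exists_corner {t : Tile} {y w : ℤ × ℤ} (h : IsSide t y w) :
    ∃ p q, corner t p q = y :=
  let ⟨p, q, h, _⟩ := h
  ⟨p, q, h.symm⟩

theorem add_one_ne_add_two : ∀ k : Fin 3, k + 1 ≠ k + 2 := by decide

theorem adj_plane_same {y : ℤ × ℤ} {a : Fin 3} {s r : Bool} (h : Adj plane y a s a r) :
    s = r := by
  obtain ⟨t, -, h1, h2⟩ := h
  obtain ⟨p, q, rfl⟩ := h2.exists_corner
  rw [isSide_add_iff] at h2
  have h1 := isSide_add_iff.mp h1.symm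
  have h12 := add_one_ne_add_two t.2
  obtain ⟨rfl, rfl⟩ | ⟨rfl, rfl⟩ := h1 <;> obtain ⟨h, rfl⟩ | ⟨h, rfl⟩ := h2
  · rfl
  · exact absurd h h12
  · exact absurd h.symm h12
  · rfl

/-- The height of a vertex decides which rhombi of the tiling it lies on. -/
theorem adj_plane_iff {y : ℤ × ℤ} {a b c : Fin 3} (hab : a ≠ b) (hac : a ≠ c) (hbc : b ≠ c)
    {s r : Bool} :
    Adj plane y a s b r ↔ 0 ≤ hgt y - lo a s - lo b r ∧ hgt y - lo a s - lo b r < wt c := by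
  have hc : (a = c + 1 ∧ b = c + 2) ∨ (a = c + 2 ∧ b = c + 1) := by
    revert a b c
    decide
  constructor
  · rintro ⟨t, ht, h1, h2⟩
    obtain ⟨p, q, rfl⟩ := h2.exists_corner
    rw [isSide_add_iff] at h2
    have h1 := isSide_add_iff.mp h1.symm
    have hc' : t.2 = c := by
      have key : ∀ a b c k : Fin 3, a ≠ b → a ≠ c → b ≠ c → (a = k + 1 ∨ a = k + 2) →
          (b = k + 1 ∨ b = k + 2) → k = c := by
        decide
      exact key a b c t.2 hab hac hbc (h1.imp And.left And.left) (h2.imp And.left And.left)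
    obtain ⟨h0, h0'⟩ := ht
    have e := hgt_corner ⟨h0, h0'⟩ p q
    rw [hc'] at h0' h1 h2 e
    obtain ⟨rfl, rfl⟩ | ⟨rfl, rfl⟩ := h1 <;> obtain ⟨h, rfl⟩ | ⟨h, rfl⟩ := h2
    · exact absurd h.symm hab
    · subst h
      constructor <;> linarith
    · subst h
      constructor <;> linarith
    · exact absurd h.symm hab
  · rintro ⟨h0, h1⟩
    obtain ⟨rfl, rfl⟩ | ⟨rfl, rfl⟩ := hc
    · obtain ⟨t, htp, hk, rfl⟩ := exists_tile (y := y) (k := c) (p := !s) (q := !r)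
        (by simpa using h0) (by simpa using h1)
      exact ⟨t, htp, (isSide_add_iff.mpr (by simp [hk])).symm, isSide_add_iff.mpr (by simp [hk])⟩
    · obtain ⟨t, htp, hk, rfl⟩ := exists_tile (y := y) (k := c) (p := !r) (q := !s)
        (by rw [Bool.not_not, Bool.not_not]; linarith)
        (by rw [Bool.not_not, Bool.not_not]; linarith)
      exact ⟨t, htp, (isSide_add_iff.mpr (by simp [hk])).symm, isSide_add_iff.mpr (by simp [hk])⟩

/-! ### Vertices and edges of the tiling and of its patches -/

theorem mem_corners_iff {t : Tile} {y : ℤ × ℤ} : y ∈ corners t ↔ ∃ p q, corner t p q = y := by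
  simp only [corners, Finset.mem_insert, Finset.mem_singleton, Bool.exists_bool, eq_comm (a := y)]
  tauto

/-- The position of a corner relative to the base point of a face. -/
def cornN (k : Fin 3) (p q : Bool) : Vec3 :=
  (if p then unitN (k + 1) else 0) + (if q then unitN (k + 2) else 0)

theorem corner3_eq (t : Tile) (p q : Bool) : corner3 t p q = t.1 + vec (cornN t.2 p q) := by
  cases p <;> cases q <;> simp [corner3, cornN, vec_add, vec_unitN, vec_zero, add_assoc]

theorem corner3_shift (t : Tile) (o : Off) (p q : Bool) :
    corner3 (shift t o) p q = t.1 + vec (o.1 + cornN o.2 p q) := by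
  rw [corner3_eq, vec_add, ← add_assoc]
  rfl

/-- The relative position of two faces which meet in a given pair of corners. -/
def meetOff (k : Fin 3) (p q : Bool) (k' : Fin 3) (p' q' : Bool) : Off :=
  (cornN k p q - cornN k' p' q', k')

theorem meetOff_critical : ∀ k p q k' p' q', Critical (-(meetOff k p q k' p' q').1) ∧
    Critical (unitN k' - (meetOff k p q k' p' q').1) := by
  decide +kernel

theorem meetOff_mem_nbr : ∀ c ∈ levels, ∀ k, htN c < wtN k → ∀ p q k' p' q',
    inN (htN c) (meetOff k p q k' p' q') = true → meetOff k p q k' p' q' ∈ nbr k := by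
  decide +kernel

/-- Faces with a common corner are neighbours. -/
theorem exists_shift_eq {t t' : Tile} (h : t ∈ plane) (h' : t' ∈ plane) {p q p' q' : Bool}
    (hc : corner t p q = corner t' p' q') :
    ∃ o ∈ nbr t.2, shift t o = t' ∧ o.1 + cornN o.2 p' q' = cornN t.2 p q := by
  have e : shift t (meetOff t.2 p q t'.2 p' q') = t' := by
    have h3 : corner3 t p q = corner3 t' p' q' := by
      rw [corner3_eq_lift h, corner3_eq_lift h', hc]
    rw [corner3_eq, corner3_eq] at h3
    refine Prod.ext ?_ rfl
    simp only [shift, meetOff, vec_sub]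
    rw [← add_sub_assoc, h3, add_sub_cancel_right]
  obtain ⟨c, hcl, hs, -, hn⟩ := exists_sim_of_mem_plane h
  obtain ⟨h1, h2⟩ := meetOff_critical t.2 p q t'.2 p' q'
  refine ⟨_, meetOff_mem_nbr c hcl t.2 hn p q t'.2 p' q' ?_, e, sub_add_cancel _ _⟩
  rw [← shift_mem_plane_iff' hs h1 h2, e]
  exact h'

theorem corner_shift_eq {t : Tile} {o : Off} {p q p' q' : Bool}
    (h : o.1 + cornN o.2 p' q' = cornN t.2 p q) : corner (shift t o) p' q' = corner t p q := by
  rw [← proj_corner3, ← proj_corner3, corner3_shift, h, corner3_eq]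

/-- All faces of the discrete plane at a vertex of the tiling belong to the tiling. -/
theorem mem_tiling_of_corner_eq {t t' : Tile} (h : t ∈ tiling) (h' : t' ∈ plane)
    {p q p' q' : Bool} (hc : corner t p q = corner t' p' q') : t' ∈ tiling := by
  obtain ⟨i, hi⟩ := h
  obtain ⟨o, ho, rfl, -⟩ := exists_shift_eq (mem_plane_of_mem_patch hi) h' hc
  exact exists_shift_mem_patch i hi ho h'

/-- The face in relative position `o` has the corner `u` and a side which starts there in the
direction `(a, s)`. -/
def sideN (o : Off) (u : Vec3) (a : Fin 3) (s : Bool) : Bool :=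
  decide (∃ p q, o.1 + cornN o.2 p q = u ∧ ((a = o.2 + 1 ∧ s = !p) ∨ (a = o.2 + 2 ∧ s = !q)))

/-- If a face of a patch has a corner where the tiling has both edges along an axis, then one of
them belongs to the patch. -/
theorem table_star : ∀ e ∈ table, ∀ F ∈ e.2.2, look e.1 F (0, e.1) = true → ∀ p q a,
    (∃ o ∈ nbr e.1, look e.1 e.2.1 o = true ∧ sideN o (cornN e.1 p q) a true = true) →
    (∃ o ∈ nbr e.1, look e.1 e.2.1 o = true ∧ sideN o (cornN e.1 p q) a false = true) →
    ∃ o ∈ nbr e.1, look e.1 F o = true ∧ ∃ s, sideN o (cornN e.1 p q) a s = true := by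
  decide +kernel

/-- The face in relative position `o` has the corner `u`. -/
def meetN (o : Off) (u : Vec3) : Bool := decide (∃ p q, o.1 + cornN o.2 p q = u)

/-- The face in relative position `o` has the side from `u` to `v`. -/
def joinN (o : Off) (u v : Vec3) : Bool :=
  decide (∃ p q, o.1 + cornN o.2 p q = u ∧
    (o.1 + cornN o.2 (!p) q = v ∨ o.1 + cornN o.2 p (!q) = v))

/-- If both ends of a side of a face of the discrete plane are corners of faces of a patch, then it
is a side of a face of the patch. -/
theorem table_edge : ∀ e ∈ table, ∀ F ∈ e.2.2, ∀ p q p' q',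
    ((p' = !p) ∧ q' = q) ∨ (p' = p ∧ q' = !q) →
    (∃ o ∈ nbr e.1, look e.1 F o = true ∧ meetN o (cornN e.1 p q) = true) →
    (∃ o ∈ nbr e.1, look e.1 F o = true ∧ meetN o (cornN e.1 p' q') = true) →
    ∃ o ∈ nbr e.1, look e.1 F o = true ∧ joinN o (cornN e.1 p q) (cornN e.1 p' q') = true := by
  decide +kernel

theorem exists_sideN {t t' : Tile} (h : t ∈ plane) (h' : t' ∈ plane) {p q : Bool} {a : Fin 3}
    {s : Bool} (hs : IsSide t' (corner t p q) (corner t p q + dvec a s)) :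
    ∃ o ∈ nbr t.2, shift t o = t' ∧ sideN o (cornN t.2 p q) a s = true := by
  obtain ⟨p', q', hc⟩ := hs.exists_corner
  obtain ⟨o, ho, rfl, e⟩ := exists_shift_eq h h' hc.symm
  rw [← hc, isSide_add_iff] at hs
  refine ⟨o, ho, rfl, ?_⟩
  rw [sideN, decide_eq_true_eq]
  exact ⟨p', q', e, hs⟩

/-- At a vertex of a patch, of two opposite edges of the tiling at least one belongs to the
patch. -/
theorem isEdge_patch_or {i : ℕ} {z : ℤ × ℤ} (hz : ∃ t ∈ patch i, z ∈ corners t) {a : Fin 3}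
    (h1 : IsEdge tiling z (z + dvec a true)) (h2 : IsEdge tiling z (z + dvec a false)) :
    ∃ s, IsEdge (patch i : Set Tile) z (z + dvec a s) := by
  obtain ⟨t, hti, hz⟩ := hz
  obtain ⟨p, q, rfl⟩ := mem_corners_iff.mp hz
  have htp := mem_plane_of_mem_patch hti
  obtain ⟨t1, ht1, h1⟩ := h1
  obtain ⟨t2, ht2, h2⟩ := h2
  have ht1 := mem_plane_of_mem_tiling ht1
  have ht2 := mem_plane_of_mem_tiling ht2
  obtain ⟨o1, ho1, rfl, hs1⟩ := exists_sideN htp ht1 h1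
  obtain ⟨o2, ho2, rfl, hs2⟩ := exists_sideN htp ht2 h2
  have h0 : shift t (0, t.2) ∈ patch i := by rwa [shift_zero]
  obtain ⟨e, he, F, hF, hd⟩ := exists_describes i htp ⟨_, zero_mem_nbr t.2, h0⟩
  have key := table_star e he F hF
  rw [hd.kind] at key
  obtain ⟨o, ho, hl, s, hs⟩ := key ((hd.look_patch _ (zero_mem_nbr t.2)).mpr h0) p q a
    ⟨o1, ho1, (hd.look_plane _ ho1).mpr ht1, hs1⟩ ⟨o2, ho2, (hd.look_plane _ ho2).mpr ht2, hs2⟩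
  rw [sideN, decide_eq_true_eq] at hs
  obtain ⟨p', q', e', hs⟩ := hs
  refine ⟨s, _, (hd.look_patch _ ho).mp hl, ?_⟩
  rw [← corner_shift_eq e', isSide_add_iff]
  exact hs

/-- An edge of the tiling between vertices of a patch belongs to the patch. -/
theorem isEdge_patch_of_mem_corners {i : ℕ} {u v : ℤ × ℤ} (h : IsEdge tiling u v)
    (hu : ∃ t ∈ patch i, u ∈ corners t) (hv : ∃ t ∈ patch i, v ∈ corners t) :
    IsEdge (patch i : Set Tile) u v := by
  obtain ⟨t, htt, h⟩ := h
  have htp := mem_plane_of_mem_tiling htt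
  obtain ⟨p, q, p', q', hpq, rfl, rfl⟩ : ∃ p q p' q', (((p' = !p) ∧ q' = q) ∨ (p' = p ∧ q' = !q)) ∧
      u = corner t p q ∧ v = corner t p' q' := by
    obtain ⟨p, q, hu, hv | hv⟩ := h
    · exact ⟨p, q, _, _, Or.inl ⟨rfl, rfl⟩, hu, hv⟩
    · exact ⟨p, q, _, _, Or.inr ⟨rfl, rfl⟩, hu, hv⟩
  have meet : ∀ p q, (∃ t' ∈ patch i, corner t p q ∈ corners t') → ∃ o ∈ nbr t.2,
      shift t o ∈ patch i ∧ meetN o (cornN t.2 p q) = true := by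
    rintro p q ⟨t', ht', hc⟩
    obtain ⟨p₁, q₁, hc⟩ := mem_corners_iff.mp hc
    obtain ⟨o, ho, rfl, e⟩ := exists_shift_eq htp (mem_plane_of_mem_patch ht') hc.symm
    exact ⟨o, ho, ht', decide_eq_true ⟨p₁, q₁, e⟩⟩
  obtain ⟨o1, ho1, h1, e1⟩ := meet p q hu
  obtain ⟨o2, ho2, h2, e2⟩ := meet p' q' hv
  obtain ⟨e, he, F, hF, hd⟩ := exists_describes i htp ⟨_, ho1, h1⟩
  have key := table_edge e he F hF
  rw [hd.kind] at key
  obtain ⟨o, ho, hl, hj⟩ := key p q p' q' hpq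
    ⟨o1, ho1, (hd.look_patch _ ho1).mpr h1, e1⟩ ⟨o2, ho2, (hd.look_patch _ ho2).mpr h2, e2⟩
  obtain ⟨p₁, q₁, e3, e4⟩ := of_decide_eq_true hj
  refine ⟨_, (hd.look_patch _ ho).mp hl, p₁, q₁, (corner_shift_eq e3).symm, ?_⟩
  exact e4.imp (fun e => (corner_shift_eq e).symm) fun e => (corner_shift_eq e).symm

theorem adj_tiling_iff (y : Vertex) {a : Fin 3} {s : Bool} {b : Fin 3} {r : Bool} :
    Adj tiling y.1 a s b r ↔ Adj plane y.1 a s b r := by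
  constructor
  · rintro ⟨t, h, h'⟩
    exact ⟨t, mem_plane_of_mem_tiling h, h'⟩
  · rintro ⟨t, h, h'⟩
    obtain ⟨t0, h0, hy⟩ := y.2
    obtain ⟨p, q, hy⟩ := mem_corners_iff.mp hy
    obtain ⟨p', q', hy'⟩ := h'.2.exists_corner
    exact ⟨t, mem_tiling_of_corner_eq h0 h (hy.trans hy'.symm), h'⟩

theorem adj_iff (y : Vertex) {a b c : Fin 3} (hab : a ≠ b) (hac : a ≠ c) (hbc : b ≠ c)
    {s r : Bool} : Adj tiling y.1 a s b r ↔
      0 ≤ hgt y.1 - lo a s - lo b r ∧ hgt y.1 - lo a s - lo b r < wt c := by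
  rw [adj_tiling_iff, adj_plane_iff hab hac hbc]

theorem Adj.eq_of_same {y : Vertex} {a : Fin 3} {s r : Bool} (h : Adj tiling y.1 a s a r) :
    s = r :=
  adj_plane_same ((adj_tiling_iff y).mp h)

theorem IsEdge.exists_dvec {T : Set Tile} {y w : ℤ × ℤ} (h : IsEdge T y w) :
    ∃ a s, w = y + dvec a s := by
  obtain ⟨t, -, h⟩ := h
  obtain ⟨p, q, -, h | h⟩ := isSide_iff.mp h
  · exact ⟨_, _, h⟩
  · exact ⟨_, _, h⟩

/-- Every edge is a side of a rhombus, and so adjacent to an edge in another direction. -/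
theorem IsEdge.exists_adj {y : ℤ × ℤ} {a : Fin 3} {s : Bool}
    (h : IsEdge tiling y (y + dvec a s)) : ∃ b r, b ≠ a ∧ Adj tiling y a s b r := by
  obtain ⟨t, htt, h⟩ := h
  obtain ⟨p, q, rfl⟩ := h.exists_corner
  have h12 := add_one_ne_add_two t.2
  obtain ⟨rfl, rfl⟩ | ⟨rfl, rfl⟩ := isSide_add_iff.mp h
  · exact ⟨t.2 + 2, !q, h12.symm, t, htt, h.symm, isSide_add_iff.mpr (Or.inr ⟨rfl, rfl⟩)⟩
  · exact ⟨t.2 + 1, !p, h12, t, htt, h.symm, isSide_add_iff.mpr (Or.inl ⟨rfl, rfl⟩)⟩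

/-- The change of height along an edge. -/
theorem hgt_add_dvec {y : ℤ × ℤ} {a : Fin 3} {s : Bool} (h : IsEdge tiling y (y + dvec a s)) :
    hgt (y + dvec a s) = hgt y + (if s then wt a else -wt a) := by
  obtain ⟨t, htt, h⟩ := h
  obtain ⟨p, q, rfl⟩ := h.exists_corner
  have htp := mem_plane_of_mem_tiling htt
  obtain ⟨rfl, rfl⟩ | ⟨rfl, rfl⟩ := isSide_add_iff.mp h
  · rw [← corner_not_left, hgt_corner htp, hgt_corner htp]
    cases p <;> simp [lo] <;> ring
  · rw [← corner_not_right, hgt_corner htp, hgt_corner htp]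
    cases q <;> simp [lo]

/-! ### Consecutive edges -/

/-- The edges from `x` to `y` and from `y` to `z` are sides of a common rhombus. -/
def Near (x y z : ℤ × ℤ) : Prop := ∃ t ∈ tiling, IsSide t x y ∧ IsSide t y z

/-- `x`, `y`, `z`, `u` are the consecutive corners of a rhombus. -/
def IsRhombus (x y z u : ℤ × ℤ) : Prop :=
  ∃ t ∈ tiling, IsSide t x y ∧ IsSide t y z ∧ IsSide t z u ∧ IsSide t u x ∧
    IsOpposite t x z ∧ IsOpposite t y u

theorem near_iff_adj {y : ℤ × ℤ} {a b : Fin 3} {s r : Bool} :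
    Near (y + dvec a s) y (y + dvec b r) ↔ Adj tiling y a s b r := Iff.rfl

theorem Near.symm {x y z : ℤ × ℤ} (h : Near x y z) : Near z y x :=
  let ⟨t, h, h1, h2⟩ := h
  ⟨t, h, h2.symm, h1.symm⟩

theorem Near.left {x y z : ℤ × ℤ} (h : Near x y z) : IsEdge tiling x y :=
  let ⟨t, h, h1, _⟩ := h
  ⟨t, h, h1⟩

theorem Near.right {x y z : ℤ × ℤ} (h : Near x y z) : IsEdge tiling y z :=
  h.symm.left.symm

theorem IsEdge.mem_corners {T : Set Tile} {u v : ℤ × ℤ} (h : IsEdge T u v) :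
    ∃ t ∈ T, u ∈ corners t :=
  let ⟨t, ht, hs⟩ := h
  ⟨t, ht, hs.mem_corners⟩

theorem IsOpposite.symm {t : Tile} {u v : ℤ × ℤ} (h : IsOpposite t u v) : IsOpposite t v u := by
  obtain ⟨p, q, rfl, rfl⟩ := h
  exact ⟨!p, !q, rfl, by rw [Bool.not_not, Bool.not_not]⟩

theorem Near.isRhombus {x y z : ℤ × ℤ} (h : Near x y z) (hxz : x ≠ z) :
    IsRhombus x y z (x + z - y) := by
  obtain ⟨t, htt, h1, h2⟩ := h
  obtain ⟨p, q, rfl, h2⟩ := h2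
  obtain ⟨p', q', hc, h1⟩ := h1.symm
  obtain ⟨rfl, rfl⟩ := corner_inj hc
  have e : corner t (!p) q + corner t p (!q) - corner t p q = corner t (!p) (!q) := by
    rw [corner_not_left t p (!q), corner_not_left t p q]
    abel
  have e' : corner t p (!q) + corner t (!p) q - corner t p q = corner t (!p) (!q) := by
    rw [add_comm, e]
  obtain rfl | rfl := h1 <;> obtain rfl | rfl := h2
  · exact absurd rfl hxz
  · rw [e]
    exact ⟨t, htt, ⟨!p, q, rfl, by simp⟩, ⟨p, q, rfl, by simp⟩, ⟨p, !q, rfl, by simp⟩,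
      ⟨!p, !q, rfl, by simp⟩, ⟨!p, q, rfl, by simp⟩, ⟨p, q, rfl, by simp⟩⟩
  · rw [e']
    exact ⟨t, htt, ⟨p, !q, rfl, by simp⟩, ⟨p, q, rfl, by simp⟩, ⟨!p, q, rfl, by simp⟩,
      ⟨!p, !q, rfl, by simp⟩, ⟨p, !q, rfl, by simp⟩, ⟨p, q, rfl, by simp⟩⟩
  · exact absurd rfl hxz

theorem IsRhombus.rotate {x y z u : ℤ × ℤ} (h : IsRhombus x y z u) : IsRhombus y z u x :=
  let ⟨t, ht, h1, h2, h3, h4, h5, h6⟩ := h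
  ⟨t, ht, h2, h3, h4, h1, h6, h5.symm⟩

theorem IsRhombus.near {x y z u : ℤ × ℤ} (h : IsRhombus x y z u) : Near x y z :=
  let ⟨t, ht, h1, h2, _⟩ := h
  ⟨t, ht, h1, h2⟩

theorem Near.exists_dvec {x y z : ℤ × ℤ} (h : Near x y z) (hxz : x ≠ z) :
    ∃ a s b r, a ≠ b ∧ x = y + dvec a s ∧ z = y + dvec b r := by
  obtain ⟨a, s, rfl⟩ := h.left.symm.exists_dvec
  obtain ⟨b, r, rfl⟩ := h.right.exists_dvec
  refine ⟨a, s, b, r, ?_, rfl, rfl⟩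
  rintro rfl
  have := Adj.eq_of_same (y := ⟨y, h.right.mem_corners⟩) (near_iff_adj.mp h)
  exact hxz (by rw [this])

theorem IsRhombus.reflect {x y z u : ℤ × ℤ} (h : IsRhombus x y z u) : IsRhombus z y x u :=
  let ⟨t, ht, h1, h2, h3, h4, h5, h6⟩ := h
  ⟨t, ht, h2.symm, h1.symm, h4.symm, h3.symm, h5.symm, h6⟩

theorem IsRhombus.ne {x y z u : ℤ × ℤ} (h : IsRhombus x y z u) : x ≠ z := by
  obtain ⟨t, -, -, -, -, -, ⟨p, q, rfl, rfl⟩, -⟩ := h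
  intro e
  simpa using corner_inj e

theorem Near.axis_ne {x y z : ℤ × ℤ} (h : Near x y z) (hxz : x ≠ z) (a : Fin 3) (s r : Bool)
    (hz : z = y + dvec a s) : x ≠ y + dvec a r := by
  obtain ⟨b, q, c, p, hbc, rfl, rfl⟩ := h.exists_dvec hxz
  rw [add_right_inj, dvec_inj] at hz
  rw [Ne, add_right_inj, dvec_inj]
  exact fun h => hbc (h.1.trans hz.1.symm)

theorem third_axis {a b c d : Fin 3} (hab : a ≠ b) (hac : a ≠ c) (hbc : b ≠ c) :
    d = a ∨ d = b ∨ d = c := by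
  revert a b c d
  decide

/-- Two edges that span a rhombus at `w` cannot be moved along a third edge `w v` to a pair of
edges that span a rhombus at `v`. -/
theorem Near.not_near_add {x w r v : ℤ × ℤ} (h : Near x w r) (hxr : x ≠ r)
    (hv : IsEdge tiling w v) (hax : ∀ a s r, v = w + dvec a s → x ≠ w + dvec a r)
    (har : ∀ a s s', v = w + dvec a s → r ≠ w + dvec a s') :
    ¬ Near (x + v - w) v (r + v - w) := by
  intro h'
  obtain ⟨a, s, c, r, hac, rfl, rfl⟩ := h.exists_dvec hxr
  obtain ⟨b, q, rfl⟩ := hv.exists_dvec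
  have hab : a ≠ b := fun e => hax b q s rfl (by rw [e])
  have hcb : c ≠ b := fun e => har b q r rfl (by rw [e])
  have e1 : w + dvec a s + (w + dvec b q) - w = w + dvec b q + dvec a s := by abel
  have e2 : w + dvec c r + (w + dvec b q) - w = w + dvec b q + dvec c r := by abel
  rw [e1, e2, near_iff_adj] at h'
  rw [near_iff_adj] at h
  have h' := (adj_iff ⟨_, hv.symm.mem_corners⟩ hac hab hcb).mp h'
  have h := (adj_iff ⟨_, hv.mem_corners⟩ hac hab hcb).mp h
  simp only at h h'
  rw [hgt_add_dvec hv] at h'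
  cases q <;> simp at h' <;> linarith

/-- The equality up to sign. -/
def EqUpToSign {B : Type*} [AddCommGroup B] (u v : B) : Prop := u = v ∨ u = -v

theorem EqUpToSign.symm {B : Type*} [AddCommGroup B] {u v : B} (h : EqUpToSign u v) :
    EqUpToSign v u :=
  h.imp Eq.symm fun h => by rw [h, neg_neg]

theorem eqUpToSign_neg_left {B : Type*} [AddCommGroup B] {u v : B} :
    EqUpToSign (-u) v ↔ EqUpToSign u v := by
  rw [EqUpToSign, EqUpToSign, neg_inj, neg_eq_iff_eq_neg, or_comm]

theorem eqUpToSign_neg_right {B : Type*} [AddCommGroup B] {u v : B} :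
    EqUpToSign u (-v) ↔ EqUpToSign u v := by
  rw [EqUpToSign, EqUpToSign, neg_neg, or_comm]

theorem eqUpToSign_zero_right {B : Type*} [AddCommGroup B] {u : B} :
    EqUpToSign u 0 ↔ u = 0 := by
  rw [EqUpToSign, neg_zero, or_self]

theorem EqUpToSign.trans {B : Type*} [AddCommGroup B] {u v w : B} (h : EqUpToSign u v)
    (h' : EqUpToSign v w) : EqUpToSign u w := by
  obtain rfl | rfl := h
  · exact h'
  · rwa [eqUpToSign_neg_left]

theorem EqUpToSign.map {B C F : Type*} [AddCommGroup B] [AddCommGroup C] [FunLike F B C]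
    [AddMonoidHomClass F B C] (f : F) {u v : B} (h : EqUpToSign u v) :
    EqUpToSign (f u) (f v) := by
  obtain rfl | rfl := h
  · exact Or.inl rfl
  · exact Or.inr (map_neg f v)

/-- The star relations at a vertex, multiplied by an arrow: if of the elements belonging to the six
directions at `y` only those of one edge and its two neighbours may be different from zero, then
the elements of the two neighbours agree up to sign, and the element of the edge between them is
zero or agrees with them up to sign. -/
theorem exists_neighbours {B : Type*} [AddCommGroup B] (y : Vertex) {a : Fin 3} {s : Bool}
    (hE : IsEdge tiling y.1 (y.1 + dvec a s)) (X : Fin 3 → Bool → B)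
    (hD : ∀ b c, EqUpToSign (X b true - X b false) (X c true - X c false))
    (h0 : ∀ b r, ¬ Adj tiling y.1 a s b r → X b r = 0) :
    ∃ b r c q, (b, r) ≠ (c, q) ∧ b ≠ a ∧ c ≠ a ∧ Adj tiling y.1 a s b r ∧
      Adj tiling y.1 a s c q ∧
      (∀ d p, d ≠ a → Adj tiling y.1 a s d p → (d, p) = (b, r) ∨ (d, p) = (c, q)) ∧
      EqUpToSign (X b r) (X c q) ∧ (X a s = 0 ∨ EqUpToSign (X a s) (X b r)) := by
  obtain ⟨b, r, hba, hadj⟩ := hE.exists_adj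
  obtain ⟨c, hac, hbc⟩ : ∃ c, a ≠ c ∧ b ≠ c := by
    clear hadj hD h0 hE
    revert a b
    decide
  have hab := hba.symm
  have Hb : ∀ r, Adj tiling y.1 a s b r ↔ _ := fun r => adj_iff y hab hac hbc
  have Hc : ∀ r, Adj tiling y.1 a s c r ↔ _ := fun r => adj_iff y hac hab hbc.symm
  have Ha : X a (!s) = 0 := h0 _ _ fun h => by simpa using h.eq_of_same
  have hDa : ∀ b, EqUpToSign (X a s) (X b true - X b false) := by
    intro b
    have h := hD a b
    cases s
    · rw [Bool.not_false] at Ha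
      rwa [Ha, zero_sub, eqUpToSign_neg_left] at h
    · rw [Bool.not_true] at Ha
      rwa [Ha, sub_zero] at h
  have pb := wt_pos b
  have pc := wt_pos c
  rw [Hb] at hadj
  generalize hG : hgt y.1 - lo a s = G at Hb Hc hadj
  have hG0 : 0 ≤ G := by
    have : 0 ≤ lo b r := by
      cases r
      · exact pb.le
      · exact le_rfl
    linarith
  have hG1 : G < wt b + wt c := by
    have : lo b r ≤ wt b := by
      cases r
      · exact le_rfl
      · exact pb.le
    linarith
  have Hbt := Hb true
  have Hbf := Hb false
  have Hct := Hc true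
  have Hcf := Hc false
  simp only [lo, if_true, Bool.false_eq_true, if_false, sub_zero] at Hbt Hbf Hct Hcf
  have hall : ∀ (P : Fin 3 → Bool → Prop), P b true → P b false → P c true → P c false →
      ∀ d p, d ≠ a → P d p := by
    intro P h1 h2 h3 h4 d p hd
    obtain rfl | rfl | rfl := third_axis (d := d) hab hac hbc
    · exact absurd rfl hd
    · cases p <;> assumption
    · cases p <;> assumption
  have hDbc := hD b c
  by_cases h1 : G < wt b <;> by_cases h2 : G < wt c
  · have nb : ¬ Adj tiling y.1 a s b false := fun h => by linarith [(Hbf.mp h).1]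
    have nc : ¬ Adj tiling y.1 a s c false := fun h => by linarith [(Hcf.mp h).1]
    rw [h0 _ _ nb, h0 _ _ nc, sub_zero, sub_zero] at hDbc
    refine ⟨b, true, c, true, by simp [hbc], hba, hac.symm, Hbt.mpr ⟨hG0, h2⟩, Hct.mpr ⟨hG0, h1⟩,
      hall _ ?_ ?_ ?_ ?_, hDbc, ?_⟩
    · exact fun _ => Or.inl rfl
    · exact fun h => absurd h nb
    · exact fun _ => Or.inr rfl
    · exact fun h => absurd h nc
    · have := hDa b
      rw [h0 _ _ nb, sub_zero] at this
      exact Or.inr this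
  · have nb : ¬ Adj tiling y.1 a s b true := fun h => by linarith [(Hbt.mp h).2]
    have nb' : ¬ Adj tiling y.1 a s b false := fun h => by linarith [(Hbf.mp h).1]
    have hX : X c true - X c false = 0 := by
      rw [h0 _ _ nb, h0 _ _ nb', sub_zero] at hDbc
      exact eqUpToSign_zero_right.mp hDbc.symm
    refine ⟨c, true, c, false, by simp, hac.symm, hac.symm, Hct.mpr ⟨hG0, h1⟩,
      Hcf.mpr ⟨by linarith, by linarith⟩, hall _ ?_ ?_ ?_ ?_, Or.inl (sub_eq_zero.mp hX), ?_⟩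
    · exact fun h => absurd h nb
    · exact fun h => absurd h nb'
    · exact fun _ => Or.inl rfl
    · exact fun _ => Or.inr rfl
    · have := hDa c
      rw [hX, eqUpToSign_zero_right] at this
      exact Or.inl this
  · have nc : ¬ Adj tiling y.1 a s c true := fun h => by linarith [(Hct.mp h).2]
    have nc' : ¬ Adj tiling y.1 a s c false := fun h => by linarith [(Hcf.mp h).1]
    have hX : X b true - X b false = 0 := by
      rw [h0 _ _ nc, h0 _ _ nc', sub_zero] at hDbc
      exact eqUpToSign_zero_right.mp hDbc
    refine ⟨b, true, b, false, by simp, hba, hba, Hbt.mpr ⟨hG0, h2⟩,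
      Hbf.mpr ⟨by linarith, by linarith⟩, hall _ ?_ ?_ ?_ ?_, Or.inl (sub_eq_zero.mp hX), ?_⟩
    · exact fun _ => Or.inl rfl
    · exact fun _ => Or.inr rfl
    · exact fun h => absurd h nc
    · exact fun h => absurd h nc'
    · have := hDa b
      rw [hX, eqUpToSign_zero_right] at this
      exact Or.inl this
  · have nb : ¬ Adj tiling y.1 a s b true := fun h => by linarith [(Hbt.mp h).2]
    have nc : ¬ Adj tiling y.1 a s c true := fun h => by linarith [(Hct.mp h).2]
    rw [h0 _ _ nb, h0 _ _ nc, zero_sub, zero_sub] at hDbc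
    refine ⟨b, false, c, false, by simp [hbc], hba, hac.symm, Hbf.mpr ⟨by linarith, by linarith⟩,
      Hcf.mpr ⟨by linarith, by linarith⟩, hall _ ?_ ?_ ?_ ?_, ?_, ?_⟩
    · exact fun h => absurd h nb
    · exact fun _ => Or.inl rfl
    · exact fun h => absurd h nc
    · exact fun _ => Or.inr rfl
    · rwa [eqUpToSign_neg_left, eqUpToSign_neg_right] at hDbc
    · have := hDa b
      rw [h0 _ _ nb, zero_sub, eqUpToSign_neg_right] at this
      exact Or.inr this

open PathAlgebra

/-! ### Products of arrows in the Rauzy algebra -/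

section Arrows

variable (K : Type*) [Field K] (ε : Vertex → Fin 3 → ℤˣ)

/-- The class in the Rauzy algebra of an element of the path algebra. -/
noncomputable def cls : PathAlgebra K Vertex →ₗ[K] RauzyAlgebra K ε where
  toFun := PathAlgebra.Quot.mk (relationIdeal K ε)
  map_add' _ _ := rfl
  map_smul' _ _ := rfl

theorem cls_mul (f g : PathAlgebra K Vertex) : cls K ε (f * g) = cls K ε f * cls K ε g := rfl

theorem cls_surjective : Function.Surjective (cls K ε) := PathAlgebra.Quot.mk_surjective _

theorem cls_eq_zero_iff {f : PathAlgebra K Vertex} :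
    cls K ε f = 0 ↔ f ∈ relationIdeal K ε := by
  change ((f : (relationIdeal K ε).ringCon.Quotient) = ((0 : PathAlgebra K Vertex) :
    (relationIdeal K ε).ringCon.Quotient)) ↔ _
  rw [RingCon.eq, TwoSidedIdeal.rel_iff, sub_zero]

theorem cls_eq_zero {f : PathAlgebra K Vertex} (h : Relation K ε f) : cls K ε f = 0 :=
  (cls_eq_zero_iff K ε).mpr (TwoSidedIdeal.subset_span h)

open Classical in
/-- The arrow from `u` to `v` as an element of the Rauzy algebra, and zero if there is none. -/
noncomputable def ar (u v : ℤ × ℤ) : RauzyAlgebra K ε :=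
  if h : IsEdge tiling u v then
    arrowElt K ε (u := ⟨u, h.mem_corners⟩) (v := ⟨v, h.symm.mem_corners⟩) ⟨h⟩
  else 0

theorem arrowElt_eq {u v : Vertex} (b : u ⟶ v) : arrowElt K ε b = ar K ε u.1 v.1 := by
  rw [ar, dif_pos b.down]
  rfl

theorem ar_eq_zero {u v : ℤ × ℤ} (h : ¬ IsEdge tiling u v) : ar K ε u v = 0 := dif_neg h

theorem ar_mul_ar_eq_zero {x y z : ℤ × ℤ} (h : ¬ Near x y z) : ar K ε x y * ar K ε y z = 0 := by
  by_cases h1 : IsEdge tiling x y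
  · by_cases h2 : IsEdge tiling y z
    · rw [ar, ar, dif_pos h1, dif_pos h2]
      exact cls_eq_zero K ε (Relation.two_rhombus _ _ h)
    · rw [ar_eq_zero K ε h2, mul_zero]
  · rw [ar_eq_zero K ε h1, zero_mul]

theorem IsRhombus.ar_mul_ar {x y z u : ℤ × ℤ} (h : IsRhombus x y z u) :
    ar K ε x y * ar K ε y z = ar K ε x u * ar K ε u z := by
  have h1 := h.near.left
  have h2 := h.near.right
  have h3 := h.rotate.rotate.near.left.symm
  have h4 := h.rotate.rotate.near.right.symm
  rw [ar, ar, ar, ar, dif_pos h1, dif_pos h2, dif_pos h3, dif_pos h4]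
  obtain ⟨t, ht, -, -, -, -, h5, -⟩ := h
  exact sub_eq_zero.mp (cls_eq_zero K ε (Relation.mirror (y := ⟨y, h2.mem_corners⟩)
    (y' := ⟨u, h3.mem_corners⟩) ⟨h1⟩ ⟨h2⟩ ⟨h4⟩ ⟨h3⟩ ⟨t, ht, h5⟩))

/-- The path of length two from `y` along an edge and back. -/
noncomputable def backForth (y : ℤ × ℤ) (a : Fin 3) (s : Bool) : RauzyAlgebra K ε :=
  ar K ε y (y + dvec a s) * ar K ε (y + dvec a s) y

theorem cls_spoke (y : Vertex) (a : Fin 3) (s : Bool) :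
    cls K ε (spoke K y (dvec a s)) = backForth K ε y.1 a s := by
  rw [spoke, backForth]
  split_ifs with h
  · rw [ar, ar, dif_pos h, dif_pos h.symm]
    rfl
  · rw [ar_eq_zero K ε h, zero_mul, map_zero]

/-- The difference of the two paths `b b̄` in opposite directions. -/
noncomputable def backForthDiff (y : ℤ × ℤ) (a : Fin 3) : RauzyAlgebra K ε :=
  backForth K ε y a true - backForth K ε y a false

theorem cls_axisDiff (y : Vertex) (a : Fin 3) :
    cls K ε (axisDiff K y a) = backForthDiff K ε y.1 a := by
  rw [backForthDiff, ← cls_spoke, ← cls_spoke]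
  rfl

theorem star_relation (y : Vertex) (a : Fin 3) : backForthDiff K ε y.1 (a + 1) =
    (ε y a : ℤ) • backForthDiff K ε y.1 (a + 2) := by
  rw [← cls_axisDiff, ← cls_axisDiff, ← map_zsmul, ← sub_eq_zero, ← map_sub]
  exact cls_eq_zero K ε (Relation.star y a)

variable {ε}

/-- All star relations at a vertex say that `ε_a D_a` is independent of the direction `a`. -/
theorem star_relation_zero (hε : IsSignSystem ε) (y : Vertex) (a : Fin 3) :
    backForthDiff K ε y.1 a = (ε y a * ε y 0 : ℤˣ) • backForthDiff K ε y.1 0 := by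
  have hp := hε.prod_eq_one y
  have h1 := star_relation K ε y 1
  have h2 := star_relation K ε y 2
  simp only [Fin.isValue, Fin.reduceAdd] at h1 h2
  have key : ∀ u v w : ℤˣ, u * v * w = 1 → v * u = w ∧ w * u = v := by decide
  obtain ⟨e1, e2⟩ := key _ _ _ hp
  match a with
  | 0 => rw [Int.units_mul_self, one_smul]
  | 1 =>
    rw [e1, h2, Units.smul_def, smul_smul, ← Units.val_mul, Int.units_mul_self, Units.val_one,
      one_smul]
  | 2 =>
    rw [e2, h1]
    rw [Units.smul_def]

theorem eqUpToSign_backForthDiff (hε : IsSignSystem ε) (y : Vertex) (a b : Fin 3) :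
    EqUpToSign (backForthDiff K ε y.1 a) (backForthDiff K ε y.1 b) := by
  have h : ∀ a, EqUpToSign (backForthDiff K ε y.1 a) (backForthDiff K ε y.1 0) := by
    intro a
    rw [star_relation_zero K hε y a]
    obtain h | h := Int.units_eq_one_or (ε y a * ε y 0) <;> rw [h]
    · exact Or.inl (one_smul _ _)
    · exact Or.inr (by rw [Units.smul_def]; simp)
  obtain ha | ha := h a <;> obtain hb | hb := (h b).symm <;> rw [ha, hb]
  · exact Or.inl rfl
  · exact Or.inr rfl
  · exact Or.inr rfl
  · exact Or.inl (neg_neg _)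

end Arrows

/-! ### Long paths vanish -/

section LongPaths

variable (K : Type*) [Field K] {ε : Vertex → Fin 3 → ℤˣ}

/-- The product of the arrows of a path of length three. -/
noncomputable def ar₃ (ε : Vertex → Fin 3 → ℤˣ) (x y z w : ℤ × ℤ) : RauzyAlgebra K ε :=
  ar K ε x y * ar K ε y z * ar K ε z w

theorem ar₃_eq_zero_left {x y z : ℤ × ℤ} (w : ℤ × ℤ) (h : ¬ Near x y z) :
    ar₃ K ε x y z w = 0 := by
  rw [ar₃, ar_mul_ar_eq_zero K ε h, zero_mul]

theorem ar₃_eq_zero_right (x : ℤ × ℤ) {y z w : ℤ × ℤ} (h : ¬ Near y z w) :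
    ar₃ K ε x y z w = 0 := by
  rw [ar₃, mul_assoc, ar_mul_ar_eq_zero K ε h, mul_zero]

theorem ar₃_eq_left {x y z u : ℤ × ℤ} (w : ℤ × ℤ) (h : IsRhombus x y z u) :
    ar₃ K ε x y z w = ar₃ K ε x u z w := by
  rw [ar₃, h.ar_mul_ar K ε, ar₃]

theorem ar₃_eq_right (x : ℤ × ℤ) {y z w u : ℤ × ℤ} (h : IsRhombus y z w u) :
    ar₃ K ε x y z w = ar₃ K ε x y u w := by
  rw [ar₃, mul_assoc, h.ar_mul_ar K ε, ← mul_assoc, ar₃]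

/-- Moving a path `b b̄` along a side of a rhombus. -/
theorem ar₃_transport {w r v u : ℤ × ℤ} (h : IsRhombus r w v u) :
    ar₃ K ε w r w v = ar₃ K ε w v u v := by
  rw [ar₃_eq_right K w h, ar₃_eq_left K v h.reflect.rotate]

/-- At the end `w` of an edge `x w` there are two neighbouring edges `w r₁` and `w r₂`; the
corresponding paths of length three agree up to sign. -/
theorem exists_neighbours_ar₃ (hε : IsSignSystem ε) {x w : ℤ × ℤ} (h : IsEdge tiling x w) :
    ∃ r₁ r₂, r₁ ≠ r₂ ∧ r₁ ≠ x ∧ r₂ ≠ x ∧ Near x w r₁ ∧ Near x w r₂ ∧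
      (∀ r, r ≠ x → Near x w r → r = r₁ ∨ r = r₂) ∧
      EqUpToSign (ar₃ K ε x w r₁ w) (ar₃ K ε x w r₂ w) ∧
      (ar₃ K ε x w x w = 0 ∨ EqUpToSign (ar₃ K ε x w x w) (ar₃ K ε x w r₁ w)) := by
  obtain ⟨a, s, rfl⟩ := h.symm.exists_dvec
  have hX : ∀ b r, ar₃ K ε (w + dvec a s) w (w + dvec b r) w =
      ar K ε (w + dvec a s) w * backForth K ε w b r := by
    intro b r
    rw [ar₃, mul_assoc, backForth]
  obtain ⟨b, r, c, q, hne, hb, hc, h1, h2, h3, h4, h5⟩ :=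
    exists_neighbours ⟨w, h.symm.mem_corners⟩ h.symm
    (fun b r => ar₃ K ε (w + dvec a s) w (w + dvec b r) w) (fun b c => by
      simp only [hX, ← mul_sub]
      exact (eqUpToSign_backForthDiff K hε ⟨w, h.symm.mem_corners⟩ b c).imp
        (fun h => congrArg _ h) fun h => by
          rw [← mul_neg]
          exact congrArg _ h)
    (fun b r hn => ar₃_eq_zero_left K _ hn)
  have hinj : ∀ {b c : Fin 3} {r q : Bool}, w + dvec b r = w + dvec c q ↔ (b, r) = (c, q) := by
    intro b c r q
    rw [add_right_inj, dvec_inj, Prod.mk.injEq]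
  refine ⟨w + dvec b r, w + dvec c q, fun h => hne (hinj.mp h), fun h => hb ?_, fun h => hc ?_,
    h1, h2, ?_, h4, h5⟩
  · exact (Prod.mk.inj (hinj.mp h)).1
  · exact (Prod.mk.inj (hinj.mp h)).1
  · intro y hy hn
    obtain ⟨d, p, rfl⟩ := hn.right.exists_dvec
    have hd : d ≠ a := by
      rintro rfl
      have := Adj.eq_of_same (y := ⟨w, h.symm.mem_corners⟩) (near_iff_adj.mp hn)
      exact hy (by rw [this])
    exact (h3 d p hd hn).imp hinj.mpr hinj.mpr

/-- Every path of length three from `x` to `w` is zero or agrees up to sign with a path that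
turns back at a neighbour of `x` around `w`. -/
theorem ar₃_eq_zero_or (hε : IsSignSystem ε) (x y z w : ℤ × ℤ) :
    ar₃ K ε x y z w = 0 ∨
      ∃ r, r ≠ x ∧ Near x w r ∧ EqUpToSign (ar₃ K ε x y z w) (ar₃ K ε x w r w) := by
  by_cases hxyz : Near x y z
  swap
  · exact Or.inl (ar₃_eq_zero_left K _ hxyz)
  by_cases hyzw : Near y z w
  swap
  · exact Or.inl (ar₃_eq_zero_right K _ hyzw)
  by_cases hxz : x = z
  · subst hxz
    by_cases hyw : y = w
    · subst hyw
      obtain ⟨r₁, r₂, -, h1, -, h2, -, -, -, h3⟩ := exists_neighbours_ar₃ K hε hxyz.left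
      exact h3.imp id fun h3 => ⟨r₁, h1, h2, h3⟩
    · have hR := hyzw.isRhombus hyw
      exact Or.inr ⟨_, hR.rotate.ne.symm, hR.rotate.near, Or.inl (ar₃_transport K hR)⟩
  · by_cases hyw : y = w
    · subst hyw
      exact Or.inr ⟨z, Ne.symm hxz, hxyz, Or.inl rfl⟩
    · have hR := hxyz.isRhombus hxz
      have hR' := hyzw.isRhombus hyw
      by_cases hw : w = x + z - y
      · subst hw
        refine Or.inr ⟨z, Ne.symm hxz, ?_, Or.inl (ar₃_eq_left K _ hR)⟩
        exact hR.rotate.rotate.near.symm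
      · left
        -- Moving the first or the last edge across a rhombus yields two consecutive edges which
        -- are not sides of a common rhombus.
        by_cases hn : Near x y (y + w - z)
        · rw [ar₃_eq_left K w hR]
          refine ar₃_eq_zero_right K _ fun hn' => hn.not_near_add ?_ hyzw.left
            (hxyz.axis_ne hxz) ?_ (by convert hn' using 1; abel)
          · rintro rfl
            exact hw (by abel)
          · rintro a s r hz hw'
            refine hyzw.symm.axis_ne (Ne.symm hyw) a (!s) r ?_ ?_
            · rw [hz, dvec_not]
              abel
            · rwa [add_sub_assoc, add_right_inj, sub_eq_iff_eq_add'] at hw'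
        · rw [ar₃_eq_right K x hR', ar₃_eq_zero_left K _ hn]

/-- Moving the path `b b̄` at `w` along the next edge yields a path that does not stay in one
rhombus. -/
theorem ar₃_mul_ar_eq_zero_aux {x w r v : ℤ × ℤ} (hrx : r ≠ x)
    (h : Near x w r) (hrv : r ≠ v) (hvx : v ≠ x) : ar₃ K ε x w r w * ar K ε w v = 0 := by
  by_cases hrwv : Near r w v
  swap
  · rw [ar₃, mul_assoc, ar_mul_ar_eq_zero K ε hrwv, mul_zero]
  have hR := hrwv.isRhombus hrv
  have e : ar₃ K ε x w r w * ar K ε w v = ar₃ K ε x w v (r + v - w) * ar K ε (r + v - w) v := by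
    have := ar₃_transport K (ε := ε) hR
    rw [ar₃, ar₃] at this
    rw [ar₃, ar₃]
    simp only [mul_assoc] at this ⊢
    rw [this]
  rw [e]
  by_cases hxwv : Near x w v
  swap
  · rw [ar₃_eq_zero_left K _ hxwv, zero_mul]
  rw [ar₃_eq_left K _ (hxwv.isRhombus hvx.symm), ar₃_eq_zero_right, zero_mul]
  exact h.not_near_add hrx.symm hxwv.right (hxwv.axis_ne hvx.symm) (hrwv.axis_ne hrv)

/-- If the path continues along the edge where it turned back, the star relations at `w` replace
this edge by another one. -/
theorem ar₃_mul_ar_eq_zero (hε : IsSignSystem ε) {x w r v : ℤ × ℤ} (hrx : r ≠ x)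
    (h : Near x w r) (hvx : v ≠ x) : ar₃ K ε x w r w * ar K ε w v = 0 := by
  by_cases hrv : r = v
  swap
  · exact ar₃_mul_ar_eq_zero_aux K hrx h hrv hvx
  subst hrv
  obtain ⟨r₁, r₂, hne, h1, h2, n1, n2, hr, he, -⟩ := exists_neighbours_ar₃ K hε h.left
  have key : ∀ u, EqUpToSign (ar₃ K ε x w r w) u → u * ar K ε w r = 0 →
      ar₃ K ε x w r w * ar K ε w r = 0 := by
    rintro u (e | e) h
    · rw [e, h]
    · rw [e, neg_mul, h, neg_zero]
  obtain rfl | rfl := hr r hrx h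
  · exact key _ he (ar₃_mul_ar_eq_zero_aux K h2 n2 hne.symm hvx)
  · exact key _ he.symm (ar₃_mul_ar_eq_zero_aux K h1 n1 hne hvx)

/-- Paths of length four which are not closed vanish. -/
theorem ar₄_eq_zero (hε : IsSignSystem ε) (x y z w : ℤ × ℤ) {v : ℤ × ℤ} (hvx : v ≠ x) :
    ar₃ K ε x y z w * ar K ε w v = 0 := by
  obtain h | ⟨r, hrx, hn, h | h⟩ := ar₃_eq_zero_or K hε x y z w
  · rw [h, zero_mul]
  · rw [h, ar₃_mul_ar_eq_zero K hε hrx hn hvx]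
  · rw [h, neg_mul, ar₃_mul_ar_eq_zero K hε hrx hn hvx, neg_zero]

theorem mul_ar₃_eq_zero (hε : IsSignSystem ε) (x y z w : ℤ × ℤ) {v : ℤ × ℤ} (hvx : v ≠ x) :
    ar K ε x y * ar₃ K ε y z w v = 0 := by
  have := ar₄_eq_zero K hε x y z w hvx
  rw [ar₃] at this ⊢
  rw [← this]
  simp only [mul_assoc]

/-- Paths of length five vanish. -/
theorem ar₅_eq_zero (hε : IsSignSystem ε) (x y z w v u : ℤ × ℤ) :
    ar K ε x y * ar K ε y z * ar K ε z w * ar K ε w v * ar K ε v u = 0 := by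
  by_cases hvx : v = x
  swap
  · have := ar₄_eq_zero K hε x y z w hvx
    rw [ar₃] at this
    rw [this, zero_mul]
  subst hvx
  have key : ∀ q r, r ≠ v → Near v q r →
      ar₃ K ε v q r q * (ar K ε q v * ar K ε v u) = 0 := by
    intro q r hr hn
    by_cases hu : u = q
    swap
    · have h := mul_ar₃_eq_zero K hε q r q v hu
      have e : ar₃ K ε v q r q * (ar K ε q v * ar K ε v u) =
          ar K ε v q * (ar K ε q r * ar₃ K ε r q v u) := by
        simp only [ar₃, mul_assoc]
      rw [e, h, mul_zero]
    subst hu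
    -- The two paths `b b̄` at the end of the path change places by moving both across a rhombus.
    have hR := hn.symm.isRhombus hr
    have h1 := ar₃_transport K (ε := ε) hR
    have h2 := ar₃_transport K (ε := ε) hR.rotate.reflect
    have h3 := ar₄_eq_zero K hε v u v u hr
    calc ar₃ K ε v u r u * (ar K ε u v * ar K ε v u)
        = ar K ε v u * ar₃ K ε u r u v * ar K ε v u := by simp only [ar₃, mul_assoc]
      _ = ar K ε v u * ar K ε u v * ar₃ K ε v (r + v - u) v u := by
        rw [h1]
        simp only [ar₃, mul_assoc]
      _ = ar₃ K ε v u v u * ar K ε u r * ar K ε r u := by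
        rw [h2]
        simp only [ar₃, mul_assoc]
      _ = 0 := by rw [h3, zero_mul]
  obtain h | ⟨r, hr, hn, h | h⟩ := ar₃_eq_zero_or K hε v y z w
  · rw [ar₃] at h
    rw [h, zero_mul, zero_mul]
  · rw [mul_assoc, ← ar₃, h, key _ _ hr hn]
  · rw [mul_assoc, ← ar₃, h, neg_mul, key _ _ hr hn, neg_zero]

end LongPaths

/-! ### Filtration by path length and functionals on the Rauzy algebra -/

section Functionals

variable (K : Type*) [Field K]

/-- The span of the paths of length at least `m`. -/
noncomputable def longPaths (m : ℕ) : Submodule K (PathAlgebra K Vertex) :=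
  Submodule.span K {f | ∃ (x y : Vertex) (p : Quiver.Path x y), m ≤ p.length ∧ f = ofPath K p}

variable {K}

theorem ofPath_mem_longPaths {m : ℕ} {x y : Vertex} {p : Quiver.Path x y} (h : m ≤ p.length) :
    ofPath K p ∈ longPaths K m :=
  Submodule.subset_span ⟨x, y, p, h, rfl⟩

theorem longPaths_induction {m : ℕ} {P : PathAlgebra K Vertex → Prop} (zero : P 0)
    (add : ∀ f g, P f → P g → P (f + g)) (smul : ∀ (c : K) f, P f → P (c • f))
    (path : ∀ (x y : Vertex) (p : Quiver.Path x y), m ≤ p.length → P (ofPath K p))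
    {f : PathAlgebra K Vertex} (hf : f ∈ longPaths K m) : P f := by
  refine Submodule.span_induction (p := fun g _ => P g) ?_ zero (fun f g _ _ => add f g)
    (fun c f _ => smul c f) hf
  rintro _ ⟨x, y, p, h, rfl⟩
  exact path x y p h

theorem mem_longPaths_zero (f : PathAlgebra K Vertex) : f ∈ longPaths K 0 :=
  induction_path K f (zero_mem _) (fun _ _ => add_mem) (fun c _ => Submodule.smul_mem _ c)
    fun _ _ _ => ofPath_mem_longPaths (Nat.zero_le _)

theorem mul_mem_longPaths {m n : ℕ} {f g : PathAlgebra K Vertex} (hf : f ∈ longPaths K m)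
    (hg : g ∈ longPaths K n) : f * g ∈ longPaths K (m + n) := by
  refine longPaths_induction (P := fun f => f * g ∈ longPaths K (m + n)) ?_ ?_ ?_ ?_ hf
  · rw [zero_mul]
    exact zero_mem _
  · intro f f' h h'
    rw [add_mul]
    exact add_mem h h'
  · intro c f h
    rw [smul_mul_assoc]
    exact Submodule.smul_mem _ c h
  intro x y p hp
  refine longPaths_induction (P := fun g => ofPath K p * g ∈ longPaths K (m + n)) ?_ ?_ ?_ ?_ hg
  · rw [mul_zero]
    exact zero_mem _
  · intro f f' h h'
    rw [mul_add]
    exact add_mem h h'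
  · intro c f h
    rw [mul_smul_comm]
    exact Submodule.smul_mem _ c h
  intro x' y' q hq
  by_cases h : y = x'
  · subst h
    rw [ofPath_mul_comp]
    refine ofPath_mem_longPaths ?_
    rw [Quiver.Path.length_comp]
    exact add_le_add hp hq
  · rw [ofPath_mul_ne K p q h]
    exact zero_mem _

theorem longPaths_anti {m n : ℕ} (h : m ≤ n) : longPaths K n ≤ longPaths K m :=
  Submodule.span_mono fun _ ⟨x, y, p, hp, e⟩ => ⟨x, y, p, h.trans hp, e⟩

theorem arrow_mem_longPaths {x y : Vertex} (a : x ⟶ y) : arrow K a ∈ longPaths K 1 :=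
  ofPath_mem_longPaths le_rfl

theorem arrow_mul_arrow {x y z : Vertex} (a : x ⟶ y) (b : y ⟶ z) :
    arrow K a * arrow K b = ofPath K ((Quiver.Path.nil.cons a).cons b) :=
  ofPath_mul_comp K _ _

theorem arrow_mul_arrow_mem_longPaths {x y z : Vertex} (a : x ⟶ y) (b : y ⟶ z) :
    arrow K a * arrow K b ∈ longPaths K 2 := by
  rw [arrow_mul_arrow]
  exact ofPath_mem_longPaths le_rfl

theorem spoke_mem_longPaths (z : Vertex) (d : ℤ × ℤ) : spoke K z d ∈ longPaths K 2 := by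
  unfold spoke
  split
  · exact arrow_mul_arrow_mem_longPaths _ _
  · exact zero_mem _

theorem axisDiff_mem_longPaths (z : Vertex) (a : Fin 3) : axisDiff K z a ∈ longPaths K 2 :=
  Submodule.sub_mem _ (spoke_mem_longPaths z _) (spoke_mem_longPaths z _)

theorem relation_mem_longPaths {ε : Vertex → Fin 3 → ℤˣ} {r : PathAlgebra K Vertex}
    (h : Relation K ε r) : r ∈ longPaths K 2 := by
  cases h with
  | two_rhombus b c h => exact arrow_mul_arrow_mem_longPaths _ _
  | mirror b c b' c' h =>
    exact Submodule.sub_mem _ (arrow_mul_arrow_mem_longPaths _ _)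
      (arrow_mul_arrow_mem_longPaths _ _)
  | star z a =>
    exact Submodule.sub_mem _ (axisDiff_mem_longPaths z _)
      (zsmul_mem (axisDiff_mem_longPaths z _) _)

/-- The value at a path of the linear form that picks the coefficient of the trivial path. -/
def nilVal (K : Type*) [Field K] (z : Vertex) [DecidableEq Vertex] :
    ∀ {x y : Vertex}, Quiver.Path x y → K
  | x, _, .nil => if x = z then 1 else 0
  | _, _, .cons _ _ => 0

/-- The value at a path of a linear form that combines the coefficients of the paths of length two
from `z` to `z`; the coefficient belonging to such a path depends on its middle vertex. -/
def turnVal (z : Vertex) (c : Vertex → K) [DecidableEq Vertex] :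
    ∀ {x y : Vertex}, Quiver.Path x y → K
  | x, y, @Quiver.Path.cons _ _ _ m _ (.cons .nil _) _ => if x = z ∧ y = z then c m else 0
  | _, _, _ => 0

open Classical in
/-- The linear form that picks the coefficient of the trivial path at `z`. -/
noncomputable def nilForm (K : Type*) [Field K] (z : Vertex) : PathAlgebra K Vertex →ₗ[K] K :=
  (pathBasis K).constr K fun p => nilVal K z p.2.2

open Classical in
/-- A linear combination of the coefficients of the paths of length two from `z` to `z`. -/
noncomputable def turnForm (z : Vertex) (c : Vertex → K) : PathAlgebra K Vertex →ₗ[K] K :=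
  (pathBasis K).constr K fun p => turnVal z c p.2.2

open Classical in
theorem nilForm_ofPath (z : Vertex) {x y : Vertex} (p : Quiver.Path x y) :
    nilForm K z (ofPath K p) = nilVal K z p := by
  rw [nilForm, ofPath, Module.Basis.constr_basis]

open Classical in
theorem turnForm_ofPath (z : Vertex) (c : Vertex → K) {x y : Vertex} (p : Quiver.Path x y) :
    turnForm z c (ofPath K p) = turnVal z c p := by
  rw [turnForm, ofPath, Module.Basis.constr_basis]

open Classical in
theorem nilForm_vertexIdem (z x : Vertex) :
    nilForm K z (vertexIdem K x) = if x = z then 1 else 0 := by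
  rw [vertexIdem, nilForm_ofPath, nilVal]

theorem nilForm_eq_zero {z : Vertex} {f : PathAlgebra K Vertex} (hf : f ∈ longPaths K 1) :
    nilForm K z f = 0 := by
  refine longPaths_induction (P := fun f => nilForm K z f = 0) (map_zero _) ?_ ?_ ?_ hf
  · intro f g h h'
    rw [map_add, h, h', add_zero]
  · intro c f h
    rw [map_smul, h, smul_zero]
  · intro x y p hp
    rw [nilForm_ofPath]
    cases p with
    | nil => simp at hp
    | cons p a => rfl

theorem turnVal_eq_zero [DecidableEq Vertex] (z : Vertex) (c : Vertex → K) {x y : Vertex}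
    (p : Quiver.Path x y) (hp : 3 ≤ p.length) : turnVal z c p = 0 := by
  match p, hp with
  | .cons (.cons (.cons _ _) _) _, _ => rfl

/-- An induction principle for bilinear statements. -/
theorem induction_path_two {P : PathAlgebra K Vertex → PathAlgebra K Vertex → Prop} {m n : ℕ}
    (hl : ∀ g, P 0 g ∧ (∀ f f', P f g → P f' g → P (f + f') g) ∧
      ∀ (c : K) f, P f g → P (c • f) g)
    (hr : ∀ f, P f 0 ∧ (∀ g g', P f g → P f g' → P f (g + g')) ∧
      ∀ (c : K) g, P f g → P f (c • g))
    (path : ∀ (x y z w : Vertex) (p : Quiver.Path x y) (q : Quiver.Path z w), m ≤ p.length →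
      n ≤ q.length → P (ofPath K p) (ofPath K q)) {f g : PathAlgebra K Vertex}
    (hf : f ∈ longPaths K m) (hg : g ∈ longPaths K n) : P f g :=
  longPaths_induction (hl g).1 (hl g).2.1 (hl g).2.2 (fun x y p hp =>
    longPaths_induction (hr _).1 (hr _).2.1 (hr _).2.2 (fun z w q hq => path x y z w p q hp hq)
      hg) hf

theorem nilForm_mul (z : Vertex) (f g : PathAlgebra K Vertex) :
    nilForm K z (f * g) = nilForm K z f * nilForm K z g := by
  classical
  refine induction_path_two (P := fun f g => nilForm K z (f * g) = nilForm K z f * nilForm K z g)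
    ?_ ?_ ?_ (mem_longPaths_zero f) (mem_longPaths_zero g)
  · intro g
    refine ⟨by simp, fun f f' h h' => ?_, fun c f h => ?_⟩
    · rw [add_mul, map_add, map_add, h, h', add_mul]
    · rw [smul_mul_assoc, map_smul, map_smul, h, smul_mul_assoc]
  · intro g
    refine ⟨by simp, fun f f' h h' => ?_, fun c f h => ?_⟩
    · rw [mul_add, map_add, map_add, h, h', mul_add]
    · rw [mul_smul_comm, map_smul, map_smul, h, mul_smul_comm]
  intro x y x' y' p q _ _
  by_cases h : y = x'
  · subst h
    rw [ofPath_mul_comp, nilForm_ofPath, nilForm_ofPath, nilForm_ofPath]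
    cases q with
    | nil => cases p <;> simp [nilVal]
    | cons q a => simp [nilVal]
  · rw [ofPath_mul_ne K p q h, map_zero, nilForm_ofPath, nilForm_ofPath]
    cases p with
    | cons p a => simp [nilVal]
    | nil =>
      cases q with
      | cons q a => simp [nilVal]
      | nil =>
        rw [nilVal, nilVal]
        split_ifs with h1 h2
        · exact absurd (h1.trans h2.symm) h
        all_goals simp

/-- On combinations of paths of length at least two, the form `turnForm` sees only the trivial paths
in a factor on the left; likewise on the right. -/
theorem turnForm_mul_right (z : Vertex) (c : Vertex → K) (f : PathAlgebra K Vertex)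
    {g : PathAlgebra K Vertex} (hg : g ∈ longPaths K 2) :
    turnForm z c (f * g) = nilForm K z f * turnForm z c g := by
  classical
  refine induction_path_two
    (P := fun f g => turnForm z c (f * g) = nilForm K z f * turnForm z c g)
    ?_ ?_ ?_ (mem_longPaths_zero f) hg
  · intro g
    refine ⟨by simp, fun f f' h h' => ?_, fun c f h => ?_⟩
    · rw [add_mul, map_add, map_add, h, h', add_mul]
    · rw [smul_mul_assoc, map_smul, map_smul, h, smul_mul_assoc]
  · intro g
    refine ⟨by simp, fun f f' h h' => ?_, fun c f h => ?_⟩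
    · rw [mul_add, map_add, map_add, h, h', mul_add]
    · rw [mul_smul_comm, map_smul, map_smul, h, mul_smul_comm]
  intro x y x' y' p q _ hq
  rw [nilForm_ofPath, turnForm_ofPath]
  by_cases h : y = x'
  · subst h
    rw [ofPath_mul_comp, turnForm_ofPath]
    cases p with
    | nil =>
      rw [Quiver.Path.nil_comp, nilVal]
      match q, hq with
      | .cons (.cons (.cons _ _) _) _, _ => simp [turnVal]
      | .cons (.cons .nil _) _, _ =>
        by_cases hx : x = z <;> simp [turnVal, hx]
    | cons p a =>
      rw [turnVal_eq_zero, nilVal, zero_mul]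
      rw [Quiver.Path.length_comp, Quiver.Path.length_cons]
      omega
  · rw [ofPath_mul_ne K p q h, map_zero]
    cases p with
    | cons p a => rw [nilVal, zero_mul]
    | nil =>
      rw [nilVal]
      match q, hq with
      | .cons (.cons (.cons _ _) _) _, _ => simp [turnVal]
      | .cons (.cons .nil _) _, _ =>
        rw [turnVal]
        split_ifs with h1 h2
        · exact absurd (h1.trans h2.1.symm) h
        all_goals simp

theorem turnForm_mul_left (z : Vertex) (c : Vertex → K) {f : PathAlgebra K Vertex}
    (hf : f ∈ longPaths K 2) (g : PathAlgebra K Vertex) :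
    turnForm z c (f * g) = turnForm z c f * nilForm K z g := by
  classical
  refine induction_path_two
    (P := fun f g => turnForm z c (f * g) = turnForm z c f * nilForm K z g)
    ?_ ?_ ?_ hf (mem_longPaths_zero g)
  · intro g
    refine ⟨by simp, fun f f' h h' => ?_, fun c f h => ?_⟩
    · rw [add_mul, map_add, map_add, h, h', add_mul]
    · rw [smul_mul_assoc, map_smul, map_smul, h, smul_mul_assoc]
  · intro g
    refine ⟨by simp, fun f f' h h' => ?_, fun c f h => ?_⟩
    · rw [mul_add, map_add, map_add, h, h', mul_add]
    · rw [mul_smul_comm, map_smul, map_smul, h, mul_smul_comm]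
  intro x y x' y' p q hp _
  rw [nilForm_ofPath, turnForm_ofPath]
  by_cases h : y = x'
  · subst h
    rw [ofPath_mul_comp, turnForm_ofPath]
    cases q with
    | nil =>
      rw [Quiver.Path.comp_nil, nilVal]
      match p, hp with
      | .cons (.cons (.cons _ _) _) _, _ => simp [turnVal]
      | .cons (.cons .nil _) _, _ =>
        by_cases hy : y = z <;> simp [turnVal, hy]
    | cons q a =>
      rw [turnVal_eq_zero, nilVal, mul_zero]
      rw [Quiver.Path.length_comp, Quiver.Path.length_cons]
      omega
  · rw [ofPath_mul_ne K p q h, map_zero]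
    cases q with
    | cons q a => rw [nilVal, mul_zero]
    | nil =>
      rw [nilVal]
      match p, hp with
      | .cons (.cons (.cons _ _) _) _, _ => simp [turnVal]
      | .cons (.cons .nil _) _, _ =>
        rw [turnVal]
        split_ifs with h1 h2
        · exact absurd (h1.2.trans h2.symm) h
        all_goals simp

variable {ε : Vertex → Fin 3 → ℤˣ}

/-- An ideal contains the ideal of relations if it contains the relations. -/
theorem mem_of_mem_relationIdeal (J : Submodule K (PathAlgebra K Vertex))
    (left : ∀ x y, y ∈ J → x * y ∈ J) (right : ∀ x y, x ∈ J → x * y ∈ J)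
    (h : ∀ r, Relation K ε r → r ∈ J) {f : PathAlgebra K Vertex} (hf : f ∈ relationIdeal K ε) :
    f ∈ J := by
  have key := TwoSidedIdeal.mem_span_iff.mp hf (TwoSidedIdeal.mk' J (zero_mem _) add_mem neg_mem
    (fun {x y} hy => left x y hy) (fun {x y} hx => right x y hx))
    (fun r hr => by
      rw [SetLike.mem_coe, TwoSidedIdeal.mem_mk']
      exact h r hr)
  rwa [TwoSidedIdeal.mem_mk'] at key

/-- The ideal of relations consists of combinations of paths of length at least two. -/
theorem mem_longPaths_of_mem_relationIdeal {f : PathAlgebra K Vertex}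
    (hf : f ∈ relationIdeal K ε) : f ∈ longPaths K 2 :=
  mem_of_mem_relationIdeal (longPaths K 2)
    (fun x y hy => by simpa using mul_mem_longPaths (mem_longPaths_zero x) hy)
    (fun x y hx => by simpa using mul_mem_longPaths hx (mem_longPaths_zero y))
    (fun r hr => relation_mem_longPaths hr) hf

/-- A linear form on the paths of length two vanishes on the ideal of relations if it vanishes on
the relations. -/
theorem turnForm_eq_zero {z : Vertex} {c : Vertex → K}
    (h : ∀ r, Relation K ε r → turnForm z c r = 0) {f : PathAlgebra K Vertex}
    (hf : f ∈ relationIdeal K ε) : turnForm z c f = 0 := by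
  refine (Submodule.mem_inf.mp (mem_of_mem_relationIdeal
    (longPaths K 2 ⊓ LinearMap.ker (turnForm z c)) ?_ ?_ ?_ hf)).2
  · intro x y hy
    obtain ⟨h1, h2⟩ := Submodule.mem_inf.mp hy
    refine Submodule.mem_inf.mpr ⟨by simpa using mul_mem_longPaths (mem_longPaths_zero x) h1, ?_⟩
    rw [LinearMap.mem_ker, turnForm_mul_right z c x h1, LinearMap.mem_ker.mp h2, mul_zero]
  · intro x y hx
    obtain ⟨h1, h2⟩ := Submodule.mem_inf.mp hx
    refine Submodule.mem_inf.mpr ⟨by simpa using mul_mem_longPaths h1 (mem_longPaths_zero y), ?_⟩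
    rw [LinearMap.mem_ker, turnForm_mul_left z c h1, LinearMap.mem_ker.mp h2, zero_mul]
  · exact fun r hr => Submodule.mem_inf.mpr ⟨relation_mem_longPaths hr, h r hr⟩

/-- A linear form that vanishes on the ideal of relations factors through the Rauzy algebra. -/
theorem exists_form (φ : PathAlgebra K Vertex →ₗ[K] K) (h : ∀ f ∈ relationIdeal K ε, φ f = 0) :
    ∃ ψ : RauzyAlgebra K ε →ₗ[K] K, ∀ f, ψ (cls K ε f) = φ f := by
  obtain ⟨g, hg⟩ := (cls K ε).exists_rightInverse_of_surjective
    (LinearMap.range_eq_top.mpr (cls_surjective K ε))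
  refine ⟨φ ∘ₗ g, fun f => ?_⟩
  have h1 : cls K ε (g (cls K ε f) - f) = 0 := by
    rw [map_sub, sub_eq_zero]
    exact LinearMap.congr_fun hg (cls K ε f)
  have h2 := h _ ((cls_eq_zero_iff K ε).mp h1)
  rw [map_sub, sub_eq_zero] at h2
  exact h2

theorem arrowElt_ne_zero {x y : Vertex} (a : x ⟶ y) : arrowElt K ε a ≠ 0 := by
  classical
  intro h
  have h1 := mem_longPaths_of_mem_relationIdeal ((cls_eq_zero_iff K ε).mp h)
  have h2 : ∀ f ∈ longPaths K 2, (pathBasis K).coord ⟨x, y, a.toPath⟩ f = 0 := by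
    intro f hf
    refine longPaths_induction (P := fun f => (pathBasis K).coord ⟨x, y, a.toPath⟩ f = 0)
      (map_zero _) ?_ ?_ ?_ hf
    · intro f g h h'
      rw [map_add, h, h', add_zero]
    · intro c f h
      rw [map_smul, h, smul_zero]
    · intro x' y' p hp
      rw [ofPath, Module.Basis.coord_apply, Module.Basis.repr_self, Finsupp.single_apply,
        if_neg]
      intro e
      have : p.length = a.toPath.length :=
        congrArg (fun q : QuiverPath Vertex => q.2.2.length) e
      rw [this] at hp
      simp [Quiver.Hom.toPath] at hp
  have h3 := h2 _ h1
  rw [arrow, ofPath, Module.Basis.coord_apply, Module.Basis.repr_self,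
    Finsupp.single_eq_same] at h3
  exact one_ne_zero h3

end Functionals

/-! ### The radical of the finite-dimensional Rauzy algebra -/

section Radical

variable {K : Type*} [Field K] {ε : Vertex → Fin 3 → ℤˣ}

theorem exists_ofPath_eq_mul_arrow {n : ℕ} {x y : Vertex} (p : Quiver.Path x y)
    (h : n + 1 ≤ p.length) : ∃ (z : Vertex) (q : Quiver.Path x z) (a : z ⟶ y), n ≤ q.length ∧
      ofPath K p = ofPath K q * arrow K a := by
  cases p with
  | nil => simp at h
  | cons q a => exact ⟨_, q, a, by simpa using h, (ofPath_mul_comp K q a.toPath).symm⟩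

/-- Paths of length five are zero in the Rauzy algebra. -/
theorem cls_ofPath_eq_zero (hε : IsSignSystem ε) {x y : Vertex} (p : Quiver.Path x y)
    (h : 5 ≤ p.length) : cls K ε (ofPath K p) = 0 := by
  obtain ⟨_, p, e, h, h5⟩ := exists_ofPath_eq_mul_arrow (K := K) p h
  obtain ⟨_, p, d, h, h4⟩ := exists_ofPath_eq_mul_arrow (K := K) p h
  obtain ⟨_, p, c, h, h3⟩ := exists_ofPath_eq_mul_arrow (K := K) p h
  obtain ⟨_, p, b, h, h2⟩ := exists_ofPath_eq_mul_arrow (K := K) p h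
  obtain ⟨_, p, a, -, h1⟩ := exists_ofPath_eq_mul_arrow (K := K) p h
  have h' : ∀ {u v : Vertex} (b : u ⟶ v), cls K ε (arrow K b) = ar K ε u.1 v.1 :=
    fun b => arrowElt_eq K ε b
  have h0 := ar₅_eq_zero K hε
  rw [h5, h4, h3, h2, h1]
  simp only [cls_mul, h', mul_assoc] at h0 ⊢
  rw [h0, mul_zero]

theorem cls_eq_zero_of_mem_longPaths (hε : IsSignSystem ε) {f : PathAlgebra K Vertex}
    (hf : f ∈ longPaths K 5) : cls K ε f = 0 := by
  refine longPaths_induction (P := fun f => cls K ε f = 0) (map_zero _) ?_ ?_ ?_ hf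
  · intro f g h h'
    rw [map_add, h, h', add_zero]
  · intro c f h
    rw [map_smul, h, smul_zero]
  · exact fun x y p hp => cls_ofPath_eq_zero hε p hp

/-- The sum of the trivial paths at the vertices of a patch. -/
noncomputable def patchIdem (K : Type*) [Field K] (i : ℕ) : PathAlgebra K Vertex :=
  ∑ v ∈ vertices i, vertexIdem K v

theorem cls_patchIdem (i : ℕ) : cls K ε (patchIdem K i) = idem K ε i := rfl

theorem coe_mul {i : ℕ} (x y : FinRauzyAlgebra K ε i) : (x * y).1 = x.1 * y.1 := rfl

theorem idem_mul {i : ℕ} (x : FinRauzyAlgebra K ε i) : idem K ε i * x.1 = x.1 :=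
  ((Subsemigroup.mem_corner_iff (isIdempotentElem_idem K ε i)).mp x.2).1

theorem mul_idem {i : ℕ} (x : FinRauzyAlgebra K ε i) : x.1 * idem K ε i = x.1 :=
  ((Subsemigroup.mem_corner_iff (isIdempotentElem_idem K ε i)).mp x.2).2

open Classical in
theorem ofPath_mul_patchIdem (i : ℕ) {x y : Vertex} (p : Quiver.Path x y) :
    ofPath K p * patchIdem K i = if y ∈ vertices i then ofPath K p else 0 := by
  have h : ∀ v, ofPath K p * vertexIdem K v = if y = v then ofPath K p else 0 := by
    intro v
    split_ifs with hv
    · subst hv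
      rw [vertexIdem, ofPath_mul_comp, Quiver.Path.comp_nil]
    · exact ofPath_mul_ne K _ _ hv
  simp only [patchIdem, Finset.mul_sum, h, Finset.sum_ite_eq]

open Classical in
theorem patchIdem_mul_ofPath (i : ℕ) {x y : Vertex} (p : Quiver.Path x y) :
    patchIdem K i * ofPath K p = if x ∈ vertices i then ofPath K p else 0 := by
  have h : ∀ v, vertexIdem K v * ofPath K p = if v = x then ofPath K p else 0 := by
    intro v
    split_ifs with hv
    · subst hv
      rw [vertexIdem, ofPath_mul_comp, Quiver.Path.nil_comp]
    · exact ofPath_mul_ne K _ _ hv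
  simp only [patchIdem, Finset.sum_mul, h, Finset.sum_ite_eq']

theorem pow_five_eq_zero (hε : IsSignSystem ε) {i : ℕ} {x : FinRauzyAlgebra K ε i}
    {f : PathAlgebra K Vertex} (hf : f ∈ longPaths K 1) (hx : x.1 = cls K ε f) : x ^ 5 = 0 := by
  have h2 := mul_mem_longPaths (mul_mem_longPaths hf hf) (mul_mem_longPaths
    (mul_mem_longPaths hf hf) hf)
  have h3 : (x * x * (x * x * x)).1 = 0 := by
    simp only [coe_mul, hx, ← cls_mul]
    exact cls_eq_zero_of_mem_longPaths hε h2
  have h4 : x ^ 5 = x * x * (x * x * x) := by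
    simp only [pow_succ, pow_zero, one_mul, mul_assoc]
  rw [h4]
  exact Subtype.ext h3

/-- Classes of combinations of paths of positive length lie in the radical. -/
theorem mem_jacobson_of_mem_longPaths (hε : IsSignSystem ε) {i : ℕ} {x : FinRauzyAlgebra K ε i}
    {f : PathAlgebra K Vertex} (hf : f ∈ longPaths K 1) (hx : x.1 = cls K ε f) :
    x ∈ Ring.jacobson (FinRauzyAlgebra K ε i) := by
  rw [← Ideal.jacobson_bot, Ideal.mem_jacobson_iff]
  intro y
  obtain ⟨g, hg⟩ := cls_surjective K ε y.1
  have h1 : g * f ∈ longPaths K 1 := by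
    simpa using mul_mem_longPaths (mem_longPaths_zero g) hf
  have h2 : (y * x) ^ 5 = 0 :=
    pow_five_eq_zero hε h1 (by rw [coe_mul, hx, ← hg, cls_mul])
  have h3 : IsUnit (1 + y * x) := IsNilpotent.isUnit_one_add ⟨5, h2⟩
  obtain ⟨z, hz⟩ := h3.exists_left_inv
  refine ⟨z, ?_⟩
  rw [mul_add, mul_one] at hz
  rw [Ideal.mem_bot, mul_assoc, add_comm, hz, sub_self]

theorem nilForm_eq_zero_of_mem_relationIdeal (v : Vertex) {f : PathAlgebra K Vertex}
    (hf : f ∈ relationIdeal K ε) : nilForm K v f = 0 :=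
  nilForm_eq_zero (longPaths_anti one_le_two (mem_longPaths_of_mem_relationIdeal hf))

/-- Elements of the radical have no component at the trivial paths. -/
theorem nilForm_eq_zero_of_mem_jacobson {i : ℕ} {x : FinRauzyAlgebra K ε i}
    (hx : x ∈ Ring.jacobson (FinRauzyAlgebra K ε i)) {v : Vertex} (hv : v ∈ vertices i)
    {f : PathAlgebra K Vertex} (hf : x.1 = cls K ε f) : nilForm K v f = 0 := by
  classical
  obtain ⟨ψ, hψ⟩ := exists_form (ε := ε) (nilForm K v)
    fun f hf => nilForm_eq_zero_of_mem_relationIdeal v hf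
  have hmul : ∀ a b, ψ (a * b) = ψ a * ψ b := by
    intro a b
    obtain ⟨f, rfl⟩ := cls_surjective K ε a
    obtain ⟨g, rfl⟩ := cls_surjective K ε b
    rw [← cls_mul, hψ, hψ, hψ, nilForm_mul]
  have hone : ψ (idem K ε i) = 1 := by
    rw [← cls_patchIdem, hψ, patchIdem, map_sum]
    simp only [nilForm_vertexIdem, Finset.sum_ite_eq', if_pos hv]
  rw [← hψ, ← hf]
  by_contra hne
  rw [← Ideal.jacobson_bot, Ideal.mem_jacobson_iff] at hx
  obtain ⟨z, hz⟩ := hx (algebraMap K _ (-(ψ x.1)⁻¹))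
  have h1 := congrArg (fun y : FinRauzyAlgebra K ε i => ψ y.1) (Ideal.mem_bot.mp hz)
  have h2 : ψ (z.1 * (-(ψ x.1)⁻¹ • idem K ε i) * x.1 + z.1 - idem K ε i) = ψ 0 := h1
  rw [map_sub, map_add, hmul, hmul, map_smul, hone, map_zero, smul_eq_mul, mul_one, mul_neg,
    neg_mul, mul_assoc, inv_mul_cancel₀ hne, mul_one, neg_add_cancel, zero_sub, neg_eq_zero] at h2
  exact one_ne_zero h2

/-- Every element of the algebra of a patch is a combination of trivial paths at vertices of the
patch and of longer paths. -/
theorem patchIdem_mul_mul_patchIdem (i : ℕ) (f : PathAlgebra K Vertex) :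
    patchIdem K i * f * patchIdem K i - ∑ v ∈ vertices i, nilForm K v f • vertexIdem K v ∈
      longPaths K 1 := by
  classical
  refine induction_path K (P := fun f => patchIdem K i * f * patchIdem K i -
    ∑ v ∈ vertices i, nilForm K v f • vertexIdem K v ∈ longPaths K 1) f ?_ ?_ ?_ ?_
  · simp
  · intro f g hf hg
    have h := add_mem hf hg
    simp only [mul_add, add_mul, map_add, add_smul, Finset.sum_add_distrib]
    convert h using 1
    abel
  · intro c f hf
    have h := Submodule.smul_mem _ c hf
    simpa only [mul_smul_comm, smul_mul_assoc, map_smul, smul_sub, Finset.smul_sum, smul_smul,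
      smul_eq_mul] using h
  · intro x y p
    cases p with
    | cons p a =>
      have h : (.cons p a : Quiver.Path x y).length ≥ 1 := by simp
      have h1 := ofPath_mem_longPaths (K := K) h
      simp only [nilForm_eq_zero h1, zero_smul, Finset.sum_const_zero, sub_zero]
      rw [patchIdem_mul_ofPath]
      split_ifs
      · rw [ofPath_mul_patchIdem]
        split_ifs
        exacts [h1, zero_mem _]
      · rw [zero_mul]
        exact zero_mem _
    | nil =>
      have h : patchIdem K i * ofPath K (.nil : Quiver.Path x x) * patchIdem K i =
          if x ∈ vertices i then vertexIdem K x else 0 := by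
        rw [patchIdem_mul_ofPath]
        split_ifs with hx
        · rw [ofPath_mul_patchIdem, if_pos hx, vertexIdem]
        · rw [zero_mul]
      have h' : ∀ v, nilForm K v (ofPath K (.nil : Quiver.Path x x)) • vertexIdem K v =
          if x = v then vertexIdem K v else 0 := by
        intro v
        rw [nilForm_ofPath, nilVal, ite_smul, one_smul, zero_smul]
      simp only [h, h', Finset.sum_ite_eq, sub_self, zero_mem]

theorem exists_longPaths_of_mem_jacobson {i : ℕ} {x : FinRauzyAlgebra K ε i}
    (hx : x ∈ Ring.jacobson (FinRauzyAlgebra K ε i)) :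
    ∃ f ∈ longPaths K 1, x.1 = cls K ε f := by
  obtain ⟨f, hf⟩ := cls_surjective K ε x.1
  have h := patchIdem_mul_mul_patchIdem i f
  rw [Finset.sum_eq_zero, sub_zero] at h
  · refine ⟨_, h, ?_⟩
    rw [cls_mul, cls_mul, hf, cls_patchIdem, idem_mul, mul_idem]
  · intro v hv
    rw [nilForm_eq_zero_of_mem_jacobson hx hv hf.symm, zero_smul]

/-- A product of two paths of positive length that meet in the patch is not seen by a form that is
supported at the paths of length two with middle vertex outside the patch. -/
theorem turnForm_mul_patchIdem_mul {i : ℕ} {z : Vertex} {c : Vertex → K}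
    (hc : ∀ v ∈ vertices i, c v = 0) {f g : PathAlgebra K Vertex} (hf : f ∈ longPaths K 1)
    (hg : g ∈ longPaths K 1) : turnForm z c (f * patchIdem K i * g) = 0 := by
  classical
  refine induction_path_two (P := fun f g => turnForm z c (f * patchIdem K i * g) = 0)
    ?_ ?_ ?_ hf hg
  · intro g
    refine ⟨by simp, fun f f' h h' => ?_, fun c f h => ?_⟩
    · rw [add_mul, add_mul, map_add, h, h', add_zero]
    · rw [smul_mul_assoc, smul_mul_assoc, map_smul, h, smul_zero]
  · intro f
    refine ⟨by simp, fun f f' h h' => ?_, fun c f h => ?_⟩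
    · rw [mul_add, map_add, h, h', add_zero]
    · rw [mul_smul_comm, map_smul, h, smul_zero]
  intro x y x' y' p q hp hq
  rw [ofPath_mul_patchIdem]
  split_ifs with hy
  · by_cases h : y = x'
    · subst h
      rw [ofPath_mul_comp, turnForm_ofPath]
      match p, q, hp, hq with
      | .cons .nil a, .cons .nil b, _, _ =>
        change turnVal z c ((Quiver.Path.nil.cons a).cons b) = 0
        rw [turnVal, hc _ hy, ite_self]
      | .cons (.cons p a) b, .cons q d, _, _ =>
        apply turnVal_eq_zero
        simp only [Quiver.Path.length_comp, Quiver.Path.length_cons]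
        omega
      | .cons p b, .cons (.cons q d) e, _, _ =>
        apply turnVal_eq_zero
        simp only [Quiver.Path.length_comp, Quiver.Path.length_cons]
        omega
    · rw [ofPath_mul_ne K _ _ h, map_zero]
  · rw [zero_mul, map_zero]

/-- A form supported at the paths of length two with middle vertex outside the patch vanishes on the
square of the radical. -/
theorem eq_zero_of_mem_radSq {i : ℕ} {z : Vertex} {c : Vertex → K}
    (hc : ∀ v ∈ vertices i, c v = 0) {ψ : RauzyAlgebra K ε →ₗ[K] K}
    (hψ : ∀ f, ψ (cls K ε f) = turnForm z c f) {x : FinRauzyAlgebra K ε i}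
    (hx : x ∈ radSq K ε i) : ψ x.1 = 0 := by
  refine Submodule.smul_induction_on (p := fun x : FinRauzyAlgebra K ε i => ψ x.1 = 0) hx ?_ ?_
  · intro a ha b hb
    obtain ⟨f, hf, hf'⟩ := exists_longPaths_of_mem_jacobson ha
    obtain ⟨g, hg, hg'⟩ := exists_longPaths_of_mem_jacobson hb
    have h : (a • b).1 = cls K ε (f * patchIdem K i * g) := by
      rw [cls_mul, cls_mul, cls_patchIdem, ← hf', ← hg', mul_idem]
      rfl
    rw [h, hψ]
    exact turnForm_mul_patchIdem_mul hc hf hg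
  · intro a b ha hb
    have h : (a + b).1 = a.1 + b.1 := rfl
    rw [h, map_add, ha, hb, add_zero]

theorem idem_mul_arrowElt {i : ℕ} {x y : Vertex} (b : x ⟶ y) (hx : x ∈ vertices i) :
    idem K ε i * arrowElt K ε b = arrowElt K ε b := by
  classical
  change cls K ε (patchIdem K i * ofPath K b.toPath) = _
  rw [patchIdem_mul_ofPath, if_pos hx]
  rfl

theorem arrowElt_mul_idem {i : ℕ} {x y : Vertex} (b : x ⟶ y) (hy : y ∈ vertices i) :
    arrowElt K ε b * idem K ε i = arrowElt K ε b := by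
  classical
  change cls K ε (ofPath K b.toPath * patchIdem K i) = _
  rw [ofPath_mul_patchIdem, if_pos hy]
  rfl

theorem arrowElt_mem_corner_iff {i : ℕ} {x y : Vertex} (b : x ⟶ y) :
    arrowElt K ε b ∈ NonUnitalRing.corner (idem K ε i) ↔ x ∈ vertices i ∧ y ∈ vertices i := by
  classical
  change arrowElt K ε b ∈ Subsemigroup.corner (idem K ε i) ↔ _
  rw [Subsemigroup.mem_corner_iff (isIdempotentElem_idem K ε i)]
  refine ⟨fun ⟨h1, h2⟩ => ?_, fun ⟨h1, h2⟩ => ⟨idem_mul_arrowElt b h1, arrowElt_mul_idem b h2⟩⟩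
  constructor
  · by_contra hx
    apply arrowElt_ne_zero (K := K) (ε := ε) b
    rw [← h1]
    change cls K ε (patchIdem K i * ofPath K b.toPath) = _
    rw [patchIdem_mul_ofPath, if_neg hx, map_zero]
  · by_contra hy
    apply arrowElt_ne_zero (K := K) (ε := ε) b
    rw [← h2]
    change cls K ε (ofPath K b.toPath * patchIdem K i) = _
    rw [ofPath_mul_patchIdem, if_neg hy, map_zero]

end Radical

/-! ### Edges at a vertex of a patch -/

theorem mem_vertices_iff {i : ℕ} {v : Vertex} :
    v ∈ vertices i ↔ ∃ t ∈ patch i, v.1 ∈ corners t := by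
  classical
  exact Finset.mem_subtype.trans Finset.mem_biUnion

/-- An edge at a vertex of the patch belongs to the patch if and only if its other end does. -/
theorem mem_vertices_iff_isEdge {i : ℕ} {z w : Vertex} (hz : z ∈ vertices i)
    (h : IsEdge tiling z.1 w.1) : w ∈ vertices i ↔ IsEdge (patch i : Set Tile) z.1 w.1 := by
  rw [mem_vertices_iff] at hz ⊢
  refine ⟨isEdge_patch_of_mem_corners h hz, fun ⟨t, ht, hs⟩ => ⟨t, ht, hs.symm.mem_corners⟩⟩

theorem IsEdge.of_patch {i : ℕ} {u v : ℤ × ℤ} (h : IsEdge (patch i : Set Tile) u v) :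
    IsEdge tiling u v :=
  let ⟨t, ht, hs⟩ := h
  ⟨t, ⟨i, ht⟩, hs⟩

/-- The edge at `z` in the given direction belongs to the tiling, but not to the `i`-th patch. -/
def IsOuter (i : ℕ) (z : ℤ × ℤ) (a : Fin 3) (s : Bool) : Prop :=
  IsEdge tiling z (z + dvec a s) ∧ ¬ IsEdge (patch i : Set Tile) z (z + dvec a s)

theorem IsOuter.unique {i : ℕ} {z : Vertex} (hz : z ∈ vertices i) {a : Fin 3} {s r : Bool}
    (hs : IsOuter i z.1 a s) (hr : IsOuter i z.1 a r) : s = r := by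
  by_contra hne
  have h : ∀ q, IsOuter i z.1 a q := by
    intro q
    obtain rfl | rfl : q = s ∨ q = r := by
      clear hs hr
      revert s r q
      decide
    exacts [hs, hr]
  obtain ⟨q, hq⟩ := isEdge_patch_or (mem_vertices_iff.mp hz) (h true).1 (h false).1
  exact (h q).2 hq

theorem ncard_isEdge (T : Set Tile) (z : ℤ × ℤ) [DecidablePred fun d : Fin 3 × Bool =>
    IsEdge T z (z + dvec d.1 d.2)] : {w | IsEdge T z w}.ncard =
      (Finset.univ.filter fun d : Fin 3 × Bool => IsEdge T z (z + dvec d.1 d.2)).card := by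
  have hinj : Function.Injective fun d : Fin 3 × Bool => z + dvec d.1 d.2 := by
    intro d e h
    obtain ⟨h1, h2⟩ := dvec_inj.mp (add_left_cancel h)
    exact Prod.ext h1 h2
  rw [← Set.ncard_coe_finset, ← Set.ncard_image_of_injective _ hinj]
  congr 1
  ext w
  simp only [Set.mem_ofPred_eq, Finset.coe_filter, Finset.mem_univ, true_and, Set.mem_image]
  constructor
  · intro h
    obtain ⟨a, s, rfl⟩ := h.exists_dvec
    exact ⟨(a, s), h, rfl⟩
  · rintro ⟨d, h, rfl⟩
    exact h

/-- The edges at a `(k, n)`-vertex of the patch, counted by directions: at most one of the edges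
outside the patch lies in each of the three directions. -/
theorem IsKNVertex.bounds {i : ℕ} {z : Vertex} {k n : ℕ} (h : IsKNVertex i z k n) :
    2 ≤ k ∧ n ≤ 6 ∧ k ≤ n ∧ n ≤ k + 3 ∧ (n = k + 3 ↔ ∀ a, ∃ s, IsOuter i z.1 a s) := by
  classical
  obtain ⟨hz, hk, hn⟩ := h
  rw [ncard_isEdge] at hk hn
  set P := Finset.univ.filter fun d : Fin 3 × Bool =>
    IsEdge (patch i : Set Tile) z.1 (z.1 + dvec d.1 d.2)
  set N := Finset.univ.filter fun d : Fin 3 × Bool => IsEdge tiling z.1 (z.1 + dvec d.1 d.2)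
  have hPN : P ⊆ N := by
    intro d hd
    simp only [P, N, Finset.mem_filter, Finset.mem_univ, true_and] at hd ⊢
    exact hd.of_patch
  have hO : ∀ d, d ∈ N \ P ↔ IsOuter i z.1 d.1 d.2 := by
    intro d
    simp only [P, N, Finset.mem_sdiff, Finset.mem_filter, Finset.mem_univ, true_and, IsOuter]
  have hcard : ((N \ P).image Prod.fst).card = n - k := by
    rw [Finset.card_image_of_injOn, Finset.card_sdiff_of_subset hPN, hk, hn]
    intro d hd e he hde
    rw [Finset.mem_coe, hO] at hd he
    have hde : d.1 = e.1 := hde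
    refine Prod.ext hde ?_
    rw [hde] at hd
    exact hd.unique hz he
  have hle := Finset.card_le_card hPN
  have h3 := Finset.card_le_univ ((N \ P).image Prod.fst)
  have h6 := Finset.card_le_univ N
  have hmem : (n - k = 3) ↔ ∀ a, ∃ s, IsOuter i z.1 a s := by
    have h := Finset.card_eq_iff_eq_univ ((N \ P).image Prod.fst)
    rw [Fintype.card_fin, hcard, Finset.eq_univ_iff_forall] at h
    refine h.trans (forall_congr' fun a => ?_)
    rw [Finset.mem_image]
    constructor
    · rintro ⟨d, hd, rfl⟩
      exact ⟨d.2, (hO d).mp hd⟩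
    · rintro ⟨s, hs⟩
      exact ⟨(a, s), (hO _).mpr hs, rfl⟩
  have hk2 : 2 ≤ P.card := by
    obtain ⟨t, ht, hc⟩ := mem_vertices_iff.mp hz
    obtain ⟨p, q, hc⟩ := mem_corners_iff.mp hc
    have h12 := add_one_ne_add_two t.2
    have h1 : (t.2 + 1, !p) ∈ P := by
      simp only [P, Finset.mem_filter, Finset.mem_univ, true_and]
      exact ⟨t, ht, by rw [← hc]; exact isSide_add_iff.mpr (Or.inl ⟨rfl, rfl⟩)⟩
    have h2 : (t.2 + 2, !q) ∈ P := by
      simp only [P, Finset.mem_filter, Finset.mem_univ, true_and]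
      exact ⟨t, ht, by rw [← hc]; exact isSide_add_iff.mpr (Or.inr ⟨rfl, rfl⟩)⟩
    exact Finset.one_lt_card.mpr ⟨_, h1, _, h2, fun e => h12 (congrArg Prod.fst e)⟩
  simp only [Fintype.card_prod, Fintype.card_fin, Fintype.card_bool] at h3 h6
  rw [hcard] at h3
  rw [hk, hn] at hle
  rw [hk] at hk2
  rw [hn] at h6
  refine ⟨hk2, by omega, hle, by omega, ?_⟩
  rw [← hmem]
  omega

/-! ### Loops -/

section Loops

variable {K : Type*} [Field K] {ε : Vertex → Fin 3 → ℤˣ}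

/-- The vertex at the end of an edge. -/
def tip {z : Vertex} {a : Fin 3} {s : Bool} (h : IsEdge tiling z.1 (z.1 + dvec a s)) : Vertex :=
  ⟨z.1 + dvec a s, h.symm.mem_corners⟩

/-- The arrow along an edge. -/
def toTip {z : Vertex} {a : Fin 3} {s : Bool} (h : IsEdge tiling z.1 (z.1 + dvec a s)) :
    z ⟶ tip h := ⟨h⟩

theorem backForth_eq {z : Vertex} {a : Fin 3} {s : Bool}
    (h : IsEdge tiling z.1 (z.1 + dvec a s)) :
    backForth K ε z.1 a s = arrowElt K ε (toTip h) * arrowElt K ε (bar (toTip h)) := by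
  rw [arrowElt_eq, arrowElt_eq]
  rfl

theorem backForth_eq_zero {z : ℤ × ℤ} {a : Fin 3} {s : Bool}
    (h : ¬ IsEdge tiling z (z + dvec a s)) : backForth K ε z a s = 0 := by
  rw [backForth, ar_eq_zero K ε h, zero_mul]

theorem backForth_mem_corner {i : ℕ} {z : Vertex} (hz : z ∈ vertices i) (a : Fin 3) (s : Bool) :
    backForth K ε z.1 a s ∈ NonUnitalRing.corner (idem K ε i) := by
  by_cases h : IsEdge tiling z.1 (z.1 + dvec a s)
  · rw [backForth_eq h]
    change _ ∈ Subsemigroup.corner (idem K ε i)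
    rw [Subsemigroup.mem_corner_iff (isIdempotentElem_idem K ε i)]
    constructor
    · rw [← mul_assoc, idem_mul_arrowElt _ hz]
    · rw [mul_assoc, arrowElt_mul_idem _ hz]
  · rw [backForth_eq_zero h]
    exact zero_mem _

/-- The path along an edge and back as an element of the algebra of the patch. -/
noncomputable def turn (K : Type*) [Field K] (ε : Vertex → Fin 3 → ℤˣ) {i : ℕ} {z : Vertex}
    (hz : z ∈ vertices i) (a : Fin 3) (s : Bool) : FinRauzyAlgebra K ε i :=
  ⟨backForth K ε z.1 a s, backForth_mem_corner hz a s⟩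

/-- Along an edge of the patch, the path `b b̄` is a product of two elements of the radical. -/
theorem turn_mem_radSq (hε : IsSignSystem ε) {i : ℕ} {z : Vertex} (hz : z ∈ vertices i)
    {a : Fin 3} {s : Bool} (h : ¬ IsOuter i z.1 a s) : turn K ε hz a s ∈ radSq K ε i := by
  by_cases he : IsEdge tiling z.1 (z.1 + dvec a s)
  · have hw : tip he ∈ vertices i := by
      rw [mem_vertices_iff_isEdge hz he]
      by_contra hp
      exact h ⟨he, hp⟩
    have h1 := (arrowElt_mem_corner_iff (K := K) (ε := ε) (toTip he)).mpr ⟨hz, hw⟩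
    have h2 := (arrowElt_mem_corner_iff (K := K) (ε := ε) (bar (toTip he))).mpr ⟨hw, hz⟩
    have e : turn K ε hz a s = ⟨_, h1⟩ * ⟨_, h2⟩ := Subtype.ext (backForth_eq he)
    rw [e]
    exact Ideal.mul_mem_mul (mem_jacobson_of_mem_longPaths hε (arrow_mem_longPaths _) rfl)
      (mem_jacobson_of_mem_longPaths hε (arrow_mem_longPaths _) rfl)
  · have e : turn K ε hz a s = 0 := Subtype.ext (backForth_eq_zero he)
    rw [e]
    exact zero_mem _

theorem exists_turn_of_isLoopAt {i : ℕ} {z : Vertex} (hz : z ∈ vertices i)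
    {β : FinRauzyAlgebra K ε i} (h : IsLoopAt K ε i z β) : ∃ a s, β = turn K ε hz a s := by
  obtain ⟨x, b, hb, -⟩ := h
  obtain ⟨a, s, hx⟩ := b.down.symm.exists_dvec
  refine ⟨a, s, Subtype.ext ?_⟩
  rw [hb, arrowElt_eq, arrowElt_eq, hx]
  rfl

/-- The class of an element of the algebra of the patch modulo the square of the radical. -/
noncomputable abbrev modRadSq (K : Type*) [Field K] (ε : Vertex → Fin 3 → ℤˣ) (i : ℕ) :
    FinRauzyAlgebra K ε i →ₗ[K] FinRauzyAlgebra K ε i ⧸ (radSq K ε i).restrictScalars K :=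
  ((radSq K ε i).restrictScalars K).mkQ

theorem modRadSq_eq_zero_iff {i : ℕ} {x : FinRauzyAlgebra K ε i} :
    modRadSq K ε i x = 0 ↔ x ∈ radSq K ε i := by
  rw [modRadSq, Submodule.mkQ_apply, Submodule.Quotient.mk_eq_zero, Submodule.restrictScalars_mem]

theorem modRadSq_turn (hε : IsSignSystem ε) {i : ℕ} {z : Vertex} (hz : z ∈ vertices i)
    {a : Fin 3} {s : Bool} (h : ¬ IsOuter i z.1 a s) : modRadSq K ε i (turn K ε hz a s) = 0 :=
  modRadSq_eq_zero_iff.mpr (turn_mem_radSq hε hz h)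

/-- Modulo the square of the radical, the star relations reduce to relations between the paths
along the edges outside the patch. -/
theorem eqUpToSign_modRadSq (hε : IsSignSystem ε) {i : ℕ} {z : Vertex} (hz : z ∈ vertices i)
    {a b : Fin 3} {s r : Bool} (hs : ¬ IsOuter i z.1 a (!s)) (hr : ¬ IsOuter i z.1 b (!r)) :
    EqUpToSign (modRadSq K ε i (turn K ε hz a s)) (modRadSq K ε i (turn K ε hz b r)) := by
  have h1 : ∀ {a : Fin 3} {s : Bool}, ¬ IsOuter i z.1 a (!s) →
      EqUpToSign (modRadSq K ε i (turn K ε hz a s))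
        (modRadSq K ε i (turn K ε hz a true - turn K ε hz a false)) := by
    intro a s h
    have h := modRadSq_turn (K := K) hε hz h
    rw [map_sub]
    cases s
    · rw [Bool.not_false] at h
      rw [h, zero_sub]
      exact Or.inr (neg_neg _).symm
    · rw [Bool.not_true] at h
      rw [h, sub_zero]
      exact Or.inl rfl
  have h2 : EqUpToSign (turn K ε hz a true - turn K ε hz a false)
      (turn K ε hz b true - turn K ε hz b false) :=
    (eqUpToSign_backForthDiff K hε z a b).imp (fun h => Subtype.ext h) fun h => Subtype.ext h
  exact (h1 hs).trans ((h2.map (modRadSq K ε i)).trans (h1 hr).symm)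

/-- An axis without an edge outside the patch forces all the paths `b b̄` at `z` into the square of
the radical. -/
theorem exists_isOuter_of_yieldsLoop (hε : IsSignSystem ε) {i : ℕ} {z : Vertex}
    (hz : z ∈ vertices i) (h : YieldsLoop K ε i z) (b : Fin 3) : ∃ s, IsOuter i z.1 b s := by
  obtain ⟨β, h⟩ := h
  obtain ⟨a, s, rfl⟩ := exists_turn_of_isLoopAt hz h
  obtain ⟨-, -, -, -, -, h⟩ := h
  by_contra! hb
  refine h (modRadSq_eq_zero_iff.mp ?_)
  have hs : IsOuter i z.1 a s := by
    by_contra hs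
    exact h (turn_mem_radSq hε hz hs)
  have hs' : ¬ IsOuter i z.1 a (!s) := fun h' => Bool.not_ne_self s (h'.unique hz hs)
  have key := eqUpToSign_modRadSq (K := K) hε hz (r := true) hs' (hb _)
  rw [modRadSq_turn hε hz (hb true)] at key
  exact eqUpToSign_zero_right.mp key

theorem turnForm_arrow_mul_arrow (z : Vertex) (c : Vertex → K) {x y w : Vertex} (a : x ⟶ y)
    (b : y ⟶ w) [Decidable (x = z ∧ w = z)] :
    turnForm z c (arrow K a * arrow K b) = if x = z ∧ w = z then c y else 0 := by
  rw [arrow_mul_arrow, turnForm_ofPath, turnVal]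
  congr

theorem spoke_eq {z : Vertex} {a : Fin 3} {s : Bool} (h : IsEdge tiling z.1 (z.1 + dvec a s)) :
    spoke K z (dvec a s) = arrow K (toTip h) * arrow K (bar (toTip h)) := dif_pos h

theorem spoke_eq_zero {z : Vertex} {a : Fin 3} {s : Bool}
    (h : ¬ IsEdge tiling z.1 (z.1 + dvec a s)) : spoke K z (dvec a s) = 0 := dif_neg h

theorem axisDiff_eq (z : Vertex) (a : Fin 3) :
    axisDiff K z a = spoke K z (dvec a true) - spoke K z (dvec a false) := rfl

theorem turnForm_spoke_of_ne {z y : Vertex} (c : Vertex → K) (h : y ≠ z) (a : Fin 3) (s : Bool) :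
    turnForm z c (spoke K y (dvec a s)) = 0 := by
  classical
  by_cases he : IsEdge tiling y.1 (y.1 + dvec a s)
  · rw [spoke_eq he, turnForm_arrow_mul_arrow, if_neg fun h' => h h'.1]
  · rw [spoke_eq_zero he, map_zero]

/-- The coefficients of a linear form that is compatible with the star relations at `z` and
supported at the ends of the edges from `z` in the directions `s`, one along each axis. -/
noncomputable def outerCoeff (K : Type*) [Field K] (ε : Vertex → Fin 3 → ℤˣ) (z : Vertex)
    (s : Fin 3 → Bool) (v : Vertex) : K :=
  ∑ a, if v.1 = z.1 + dvec a (s a) then ((if s a then 1 else -1) * (ε z a : ℤ) : ℤ) else 0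

theorem outerCoeff_tip {z : Vertex} (s : Fin 3 → Bool) {a : Fin 3} {r : Bool}
    (h : IsEdge tiling z.1 (z.1 + dvec a r)) : outerCoeff K ε z s (tip h) =
      if r = s a then (((if s a then 1 else -1) * (ε z a : ℤ) : ℤ) : K) else 0 := by
  rw [outerCoeff, Finset.sum_eq_single a]
  · simp only [tip, add_right_inj, dvec_inj, true_and]
  · intro b _ hb
    simp only [tip, add_right_inj, dvec_inj, hb.symm, false_and, if_false]
  · exact fun h => absurd (Finset.mem_univ a) h

theorem turnForm_outerCoeff_spoke {z : Vertex} {s : Fin 3 → Bool}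
    (hs : ∀ a, IsEdge tiling z.1 (z.1 + dvec a (s a))) (a : Fin 3) (r : Bool) :
    turnForm z (outerCoeff K ε z s) (spoke K z (dvec a r)) =
      if r = s a then (((if s a then 1 else -1) * (ε z a : ℤ) : ℤ) : K) else 0 := by
  classical
  by_cases he : IsEdge tiling z.1 (z.1 + dvec a r)
  · rw [spoke_eq he, turnForm_arrow_mul_arrow, if_pos ⟨rfl, rfl⟩, outerCoeff_tip]
  · rw [spoke_eq_zero he, map_zero, if_neg]
    rintro rfl
    exact he (hs a)

theorem turnForm_outerCoeff_axisDiff {z : Vertex} {s : Fin 3 → Bool}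
    (hs : ∀ a, IsEdge tiling z.1 (z.1 + dvec a (s a))) (a : Fin 3) :
    turnForm z (outerCoeff K ε z s) (axisDiff K z a) = ((ε z a : ℤ) : K) := by
  have h := turnForm_outerCoeff_spoke (K := K) (ε := ε) hs a
  rw [axisDiff_eq, map_sub, h, h]
  cases s a <;> simp

/-- On the difference along the axis `a` at `z` the form has the value `ε z a`, and the star
relations hold since `ε z (a + 1) = ε z a * ε z (a + 2)`. -/
theorem turnForm_outerCoeff_relation (hε : IsSignSystem ε) {z : Vertex} {s : Fin 3 → Bool}
    (hs : ∀ a, IsEdge tiling z.1 (z.1 + dvec a (s a))) (r : PathAlgebra K Vertex)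
    (hr : Relation K ε r) : turnForm z (outerCoeff K ε z s) r = 0 := by
  classical
  cases hr with
  | two_rhombus b c h =>
    rw [turnForm_arrow_mul_arrow, if_neg]
    rintro ⟨rfl, rfl⟩
    obtain ⟨t, ht, hs⟩ := b.down
    exact h ⟨t, ht, hs, hs.symm⟩
  | mirror b c b' c' h =>
    have hne : ∀ u v : Vertex, (∃ t ∈ tiling, IsOpposite t u.1 v.1) → ¬ (u = z ∧ v = z) := by
      rintro u v ⟨t, -, p, q, h1, h2⟩ ⟨rfl, rfl⟩
      have := corner_inj (h1.symm.trans h2)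
      simp at this
    rw [map_sub, turnForm_arrow_mul_arrow, turnForm_arrow_mul_arrow, if_neg (hne _ _ h),
      if_neg (hne _ _ h), sub_zero]
  | star y a =>
    rw [map_sub, map_zsmul]
    by_cases hy : y = z
    · subst hy
      rw [turnForm_outerCoeff_axisDiff hs, turnForm_outerCoeff_axisDiff hs]
      have hp := hε.prod_eq_one y
      have key : ∀ u v w : ℤˣ, u * v * w = 1 → u = v * w ∧ v = w * u ∧ w = u * v := by decide
      obtain ⟨e1, e2, e3⟩ := key _ _ _ hp
      have e : ε y (a + 1) = ε y a * ε y (a + 2) := by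
        match a with
        | 0 => exact e2.trans (mul_comm _ _)
        | 1 => exact e3.trans (mul_comm _ _)
        | 2 => exact e1.trans (mul_comm _ _)
      rw [e, zsmul_eq_mul, Units.val_mul, Int.cast_mul, sub_self]
    · have h : ∀ b, turnForm z (outerCoeff K ε z s) (axisDiff K y b) = 0 := by
        intro b
        rw [axisDiff_eq, map_sub, turnForm_spoke_of_ne _ hy, turnForm_spoke_of_ne _ hy, sub_zero]
      rw [h, h, smul_zero, sub_zero]

/-- If each axis has an edge outside the patch, then the corresponding paths `b b̄` are loops, since
they are detected by a linear form that vanishes on the square of the radical. -/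
theorem isLoopAt_turn (hε : IsSignSystem ε) {i : ℕ} {z : Vertex} (hz : z ∈ vertices i)
    {s : Fin 3 → Bool} (hs : ∀ a, IsOuter i z.1 a (s a)) (a : Fin 3) :
    IsLoopAt K ε i z (turn K ε hz a (s a)) := by
  have he := (hs a).1
  have hw : tip he ∉ vertices i := by
    rw [mem_vertices_iff_isEdge hz he]
    exact (hs a).2
  refine ⟨tip he, bar (toTip he), backForth_eq he, ?_, ?_, ?_⟩
  · rw [arrowElt_mem_corner_iff]
    exact fun h => hw h.1
  · rw [arrowElt_mem_corner_iff]
    exact fun h => hw h.2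
  intro hrad
  have hrel := turnForm_outerCoeff_relation (K := K) hε fun a => (hs a).1
  obtain ⟨ψ, hψ⟩ := exists_form (ε := ε) _ fun f hf => turnForm_eq_zero hrel hf
  have h0 : ∀ v ∈ vertices i, outerCoeff K ε z s v = 0 := by
    intro v hv
    refine Finset.sum_eq_zero fun b _ => if_neg fun h => ?_
    have he := (hs b).1
    rw [← h] at he
    have := (mem_vertices_iff_isEdge hz he).mp hv
    rw [h] at this
    exact (hs b).2 this
  have h1 := eq_zero_of_mem_radSq h0 hψ hrad
  have h2 : (turn K ε hz a (s a)).1 = cls K ε (spoke K z (dvec a (s a))) :=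
    (cls_spoke K ε z a (s a)).symm
  rw [h2, hψ, turnForm_outerCoeff_spoke fun a => (hs a).1, if_pos rfl] at h1
  obtain h | h := Int.units_eq_one_or (ε z a) <;> rw [h] at h1 <;>
    split_ifs at h1 <;> simp at h1

/-- All loops agree up to sign modulo the square of the radical. -/
theorem numLoops_eq_one (hε : IsSignSystem ε) {i : ℕ} {z : Vertex} (hz : z ∈ vertices i)
    (h : ∀ a, ∃ s, IsOuter i z.1 a s) : numLoops K ε i z = 1 := by
  choose s hs using h
  have hloop := isLoopAt_turn (K := K) hε hz hs
  have hne : modRadSq K ε i (turn K ε hz 0 (s 0)) ≠ 0 := by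
    obtain ⟨-, -, -, -, -, h⟩ := hloop 0
    rwa [Ne, modRadSq_eq_zero_iff]
  have hspan : Submodule.span K (modRadSq K ε i '' {β | IsLoopAt K ε i z β}) =
      Submodule.span K {modRadSq K ε i (turn K ε hz 0 (s 0))} := by
    apply le_antisymm
    · rw [Submodule.span_le]
      rintro _ ⟨β, hβ, rfl⟩
      have hβ : IsLoopAt K ε i z β := hβ
      obtain ⟨a, r, rfl⟩ := exists_turn_of_isLoopAt hz hβ
      obtain ⟨-, -, -, -, -, hβ⟩ := hβ
      have hr : IsOuter i z.1 a r := by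
        by_contra hr
        exact hβ (turn_mem_radSq hε hz hr)
      have hno : ∀ {a r}, IsOuter i z.1 a r → ¬ IsOuter i z.1 a (!r) :=
        fun h h' => Bool.not_ne_self _ (h'.unique hz h)
      obtain e | e := eqUpToSign_modRadSq (K := K) hε hz (hno hr) (hno (hs 0))
      · rw [SetLike.mem_coe, e]
        exact Submodule.mem_span_singleton_self _
      · rw [SetLike.mem_coe, e]
        exact neg_mem (Submodule.mem_span_singleton_self _)
    · exact Submodule.span_mono (Set.singleton_subset_iff.mpr ⟨_, hloop 0, rfl⟩)
  rw [numLoops, hspan]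
  exact finrank_span_singleton hne

theorem yieldsLoop_iff (hε : IsSignSystem ε) {i : ℕ} {z : Vertex} (hz : z ∈ vertices i) :
    YieldsLoop K ε i z ↔ ∀ a, ∃ s, IsOuter i z.1 a s := by
  refine ⟨exists_isOuter_of_yieldsLoop hε hz, fun h => ?_⟩
  choose s hs using h
  exact ⟨_, isLoopAt_turn hε hz hs 0⟩

end Loops

end Rauzy

theorem mainTheorem5 (K : Type*) [Field K] (ε : Rauzy.Vertex → Fin 3 → ℤˣ)
    (hε : Rauzy.IsSignSystem ε) (i : ℕ) (z : Rauzy.Vertex) (k n : ℕ)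
    (hz : Rauzy.IsKNVertex i z k n) :
    (Rauzy.YieldsLoop K ε i z ↔ (k : ℤ) < (n : ℤ) - 2) ∧
      (n : ℤ) - k ≤ 3 ∧
      (Rauzy.YieldsLoop K ε i z ↔ (k = 3 ∧ n = 6) ∨ (k = 2 ∧ n = 5)) ∧
      (Rauzy.YieldsLoop K ε i z → Rauzy.numLoops K ε i z = 1) := by
  obtain ⟨h2, h6, hle, h3, hiff⟩ := hz.bounds
  have h := Rauzy.yieldsLoop_iff (K := K) hε hz.1
  refine ⟨?_, by omega, ?_, fun hl => Rauzy.numLoops_eq_one hε hz.1 (h.mp hl)⟩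
  · rw [h, ← hiff]
    omega
  · rw [h, ← hiff]
    omega
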